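/- \textbf{Setting.} Manifolds are smooth, finite-dimensional, Hausdorff and second countable. Let $G$ be a connected Lie group with Lie algebra $\mathfrak g$ acting smoothly on a manifold $M$, with infinitesimal action $\psi:\mathfrak g\to\Gamma(TM)$. Let $E\to M$ be an exact Courant algebroid with pairing $\langle\cdot,\cdot\rangle$, bracket $[\cdot,\cdot]$ on $\Gamma(E)$ (satisfying $[e,e]=\tfrac12\pi^*d\langle e,e\rangle$) and anchor $\pi:E\to TM$; view $T^*M\subset E$ through $\pi^*$. Let $0\to\mathfrak h\to\mathfrak a\to\mathfrak g\to 0$ be an exact Courant algebra, that is, $\mathfrak a$ is a (left) Leibniz algebra with a surjective bracket-preserving map to $\mathfrak g$ whose kernel $\mathfrak h$ is abelian, and let $\rho:\mathfrak a\to\Gamma(E)$ be an extended $G$-action: $\rho$ is linear, preserves brackets, covers $\psi$, satisfies $[\rho(\mathfrak h),\Gamma(E)]=0$, and the induced action of $\mathfrak g=\mathfrak a/\mathfrak h$ on $\Gamma(E)$ integrates to a smooth action of $G$ on the total space of $E$ by bundle maps over the action on $M$. Put $K=\rho(\mathfrak a)$, $\Delta_b=\pi(K+K^\perp)$ and $\widetilde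 K=K\cap(K^\perp+T^*M)$. Let $P\subset M$ be a leaf of $\Delta_b$ (a maximal connected integral submanifold) on which $G$ acts freely and properly and along which $\rho(\mathfrak h)$ has constant rank. Let $$E_{red}=\left.\frac{K^\perp|_P}{K\cap K^\perp|_P}\right/G$$ be the reduced Courant algebroid over $M_{red}=P/G$: its pairing and anchor are induced by those of $E$, and the bracket of two of its sections is obtained by representing them near points of $P$ by sections of $K^\perp|_P$, extending these to sections of $E$ over $M$, taking their bracket, restricting it to $P$, and passing to the quotient. \textbf{Theorem.} Assume that $E_{red}$ is exact, i.e. that $0\to T^*M_{red}\to E_{red}\to TM_{red}\to 0$ is an exact sequence. Let $D\subset E$ be a Dirac structure (a maximal isotropic smooth subbundle whose sections are closed under the bracket) preserved by the extended action, i.e. $[\rho(\mathfrak a),\Gamma(D)]\subset\Gamma(D)$. Using the canonical isomorphism $K^\perp/(K\cap K^\perp)\cong\widetilde K^\perp/\widetilde K$ along $P$, put $$D_{red}=\left.\frac{(D\cap\widetilde K^\perp+\widetilde K)|_P}{\widetilde K|_P}\right/G\ \subset\ E_{red}.$$ \begin{enumerate} \item If $D_{red}$ is a smooth subbundle of $E_{red}$,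 then it is a Dirac structure in $E_{red}$: it is maximal isotropic, and the bracket of any two smooth sections of $D_{red}$ is a smooth section of $D_{red}$. \item If $D\cap\widetilde K$ has constant rank along $P$, then $D_{red}$ is a smooth subbundle of $E_{red}$. \end{enumerate} -/

import Mathlib

open Bundle
open scoped Manifold ContDiff Topology

noncomputable section

namespace CourantReduction

/-! ### Linear algebra of a single fibre -/

section LinearAlgebra

variable {V T : Type*} [AddCommGroup V] [Module ℝ V] [AddCommGroup T] [Module ℝ T]

/-- `L` is isotropic for the bilinear form `β`. -/
def IsIsotropic (β : LinearMap.BilinForm ℝ V) (L : Submodule ℝ V) : Prop :=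
  ∀ x ∈ L, ∀ y ∈ L, β x y = 0

/-- `L` is maximal among the isotropic subspaces of `(V, β)`. -/
def IsMaximalIsotropic (β : LinearMap.BilinForm ℝ V) (L : Submodule ℝ V) : Prop :=
  IsIsotropic β L ∧ ∀ W : Submodule ℝ V, IsIsotropic β W → L ≤ W → W = L

/-- The image of `α^* : T^* → V^* ≅ V`, where `V^* ≅ V` through `β`: the vectors `e` for which
`β e = ξ ∘ α` for some covector `ξ`. -/
def cotangent (β : LinearMap.BilinForm ℝ V) (α : V →ₗ[ℝ] T) : Submodule ℝ V where
  carrier := {e | ∃ ξ : Module.Dual ℝ T, ∀ v, β e v = ξ (α v)}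
  add_mem' := by
    rintro a b ⟨ξ, hξ⟩ ⟨η, hη⟩
    exact ⟨ξ + η, fun v => by simp [hξ, hη]⟩
  zero_mem' := ⟨0, fun v => by simp⟩
  smul_mem' := by
    rintro c a ⟨ξ, hξ⟩
    exact ⟨c • ξ, fun v => by simp [hξ]⟩

/-- Exactness of `0 → T^* → V → T → 0`, with the maps `α^*` and `α`. -/
structure IsExactFibre (β : LinearMap.BilinForm ℝ V) (α : V →ₗ[ℝ] T) : Prop where
  dual_injective : Function.Injective α.dualMap
  exact_middle : cotangent β α = LinearMap.ker α
  surjective : Function.Surjective α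

/-- `K ∩ K^⊥`, as a subspace of `K^⊥`. -/
abbrev redKernel (β : LinearMap.BilinForm ℝ V) (K : Submodule ℝ V) :
    Submodule ℝ (β.orthogonal K) :=
  K.comap (β.orthogonal K).subtype

/-- `K^⊥ / (K ∩ K^⊥)`. -/
abbrev RedSpace (β : LinearMap.BilinForm ℝ V) (K : Submodule ℝ V) : Type _ :=
  (β.orthogonal K) ⧸ redKernel β K

/-- `e ∈ V` lies in `K^⊥` and its class in `K^⊥ / (K ∩ K^⊥)` is `c`. -/
def Represents (β : LinearMap.BilinForm ℝ V) (K : Submodule ℝ V) (e : V) (c : RedSpace β K) :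
    Prop :=
  ∃ h : e ∈ β.orthogonal K, (redKernel β K).mkQ ⟨e, h⟩ = c

theorem Represents.add {β : LinearMap.BilinForm ℝ V} {K : Submodule ℝ V} {e e' : V}
    {c c' : RedSpace β K} (h : Represents β K e c) (h' : Represents β K e' c') :
    Represents β K (e + e') (c + c') := by
  obtain ⟨h, rfl⟩ := h
  obtain ⟨h', rfl⟩ := h'
  exact ⟨add_mem h h', rfl⟩

theorem Represents.smul {β : LinearMap.BilinForm ℝ V} {K : Submodule ℝ V} {e : V}
    {c : RedSpace β K} (t : ℝ) (h : Represents β K e c) : Represents β K (t • e) (t • c) := by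
  obtain ⟨h, rfl⟩ := h
  exact ⟨Submodule.smul_mem _ t h, rfl⟩

theorem Represents.zero (β : LinearMap.BilinForm ℝ V) (K : Submodule ℝ V) :
    Represents β K 0 0 :=
  ⟨zero_mem _, map_zero _⟩

/-- The bilinear form on `K^⊥ / (K ∩ K^⊥)` induced by a symmetric form `β` on `V`. -/
def redForm (β : LinearMap.BilinForm ℝ V) (hβ : β.IsSymm) (K : Submodule ℝ V) :
    LinearMap.BilinForm ℝ (RedSpace β K) :=
  ((redKernel β K).liftQ
    (((redKernel β K).liftQ (β.restrict (β.orthogonal K)) (by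
      intro x hx
      ext y
      exact y.2 _ hx)).flip)
    (by
      intro y hy
      ext x
      have h : β (y : V) (x : V) = 0 := x.2 _ hy
      exact (hβ.eq (x : V) (y : V)).trans h)).flip

/-- `α(K + K^⊥) / α(K)`. -/
abbrev RedTangent (β : LinearMap.BilinForm ℝ V) (α : V →ₗ[ℝ] T) (K : Submodule ℝ V) : Type _ :=
  ((K ⊔ β.orthogonal K).map α) ⧸ (K.map α).comap ((K ⊔ β.orthogonal K).map α).subtype

/-- The map `K^⊥ / (K ∩ K^⊥) → α(K + K^⊥) / α(K)` induced by `α`. -/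
def redAnchor (β : LinearMap.BilinForm ℝ V) (α : V →ₗ[ℝ] T) (K : Submodule ℝ V) :
    RedSpace β K →ₗ[ℝ] RedTangent β α K :=
  Submodule.mapQ (redKernel β K) ((K.map α).comap ((K ⊔ β.orthogonal K).map α).subtype)
    (α.restrict (p := β.orthogonal K) (q := (K ⊔ β.orthogonal K).map α)
      (fun _ hx => Submodule.mem_map_of_mem (Submodule.mem_sup_right hx)))
    (fun _ hx => Submodule.mem_map_of_mem hx)

/-- `K̃ = K ∩ (K^⊥ + T^*)`. -/
def tildeK (β : LinearMap.BilinForm ℝ V) (α : V →ₗ[ℝ] T) (K : Submodule ℝ V) : Submodule ℝ V :=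
  K ⊓ (β.orthogonal K ⊔ cotangent β α)

/-- `(D ∩ K̃^⊥ + K̃) / K̃`, as a subspace of `K^⊥ / (K ∩ K^⊥)`. In the exact case
`K̃^⊥ = K^⊥ + K̃` and `K^⊥ ∩ K̃ = K ∩ K^⊥`, so that the inclusion of `K^⊥` in `K̃^⊥` induces
`K^⊥ / (K ∩ K^⊥) ≅ K̃^⊥ / K̃`, and through this isomorphism `(D ∩ K̃^⊥ + K̃) / K̃` consists of the
classes of the elements of `K^⊥` that lie in `D ∩ K̃^⊥ + K̃`. -/
def redSubspace (β : LinearMap.BilinForm ℝ V) (α : V →ₗ[ℝ] T) (K D : Submodule ℝ V) :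
    Submodule ℝ (RedSpace β K) :=
  (((D ⊓ β.orthogonal (tildeK β α K)) ⊔ tildeK β α K).comap (β.orthogonal K).subtype).map
    (redKernel β K).mkQ

end LinearAlgebra

/-! ### Smooth subbundles and Dirac structures -/

/-- A family of vector spaces over a space `B`, together with a notion of smoothness of a
section near a point, a fibrewise bilinear form, and a relation `IsBracket u w z`, which says
that the section `z` is the bracket of the sections `u` and `w`. The two instances below are a
Courant algebroid over a manifold and the reduced Courant algebroid over the orbit space. -/
structure BracketBundle (B : Type*) [TopologicalSpace B] (V : B → Type*)
    [∀ b, AddCommGroup (V b)] [∀ b, Module ℝ (V b)] where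
  SmoothNear : (∀ b, V b) → B → Prop
  form : ∀ b, LinearMap.BilinForm ℝ (V b)
  IsBracket : (∀ b, V b) → (∀ b, V b) → (∀ b, V b) → Prop

namespace BracketBundle

variable {B : Type*} [TopologicalSpace B] {V : B → Type*}
  [∀ b, AddCommGroup (V b)] [∀ b, Module ℝ (V b)]

/-- `u` is a smooth section of the family of subspaces `L`. -/
def IsSectionOf (𝓑 : BracketBundle B V) (L : ∀ b, Submodule ℝ (V b)) (u : ∀ b, V b) : Prop :=
  ∀ b, 𝓑.SmoothNear u b ∧ u b ∈ L b

/-- `L` is a smooth subbundle: its rank is locally constant and every vector of `L` extends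
locally to a smooth section with values in `L`. -/
structure IsSmoothSubbundle (𝓑 : BracketBundle B V) (L : ∀ b, Submodule ℝ (V b)) : Prop where
  rank_locally_constant :
    ∀ b, ∀ᶠ b' in 𝓝 b, Module.finrank ℝ (L b') = Module.finrank ℝ (L b)
  exists_local_section : ∀ b, ∀ e ∈ L b, ∃ u : ∀ b, V b,
    𝓑.SmoothNear u b ∧ (∀ᶠ b' in 𝓝 b, u b' ∈ L b') ∧ u b = e

/-- `L` is a Dirac structure: a maximal isotropic smooth subbundle whose space of smooth
sections is closed under the bracket. -/
structure IsDirac (𝓑 : BracketBundle B V) (L : ∀ b, Submodule ℝ (V b)) : Prop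
    extends 𝓑.IsSmoothSubbundle L where
  maximal_isotropic : ∀ b, IsMaximalIsotropic (𝓑.form b) (L b)
  integrable : ∀ u w, 𝓑.IsSectionOf L u → 𝓑.IsSectionOf L w →
    ∃ z, 𝓑.IsBracket u w z ∧ 𝓑.IsSectionOf L z

end BracketBundle

/-! ### Courant algebroids -/

section Manifold

variable {EM : Type*} [NormedAddCommGroup EM] [NormedSpace ℝ EM]
  {M : Type*} [TopologicalSpace M] [ChartedSpace EM M]

/-- The derivative of the real function `f` at `m` in the direction `X`. -/
def dirDeriv (f : M → ℝ) (m : M) (X : TangentSpace 𝓘(ℝ, EM) m) : ℝ :=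
  mfderiv 𝓘(ℝ, EM) 𝓘(ℝ, ℝ) f m X

end Manifold

/-- A Courant algebroid structure on the smooth vector bundle `E → M`. -/
structure CourantAlgebroid (EM : Type*) [NormedAddCommGroup EM] [NormedSpace ℝ EM]
    (M : Type*) [TopologicalSpace M] [ChartedSpace EM M] [IsManifold 𝓘(ℝ, EM) ∞ M]
    (F : Type*) [NormedAddCommGroup F] [NormedSpace ℝ F]
    (E : M → Type*) [∀ m, AddCommGroup (E m)] [∀ m, Module ℝ (E m)]
    [TopologicalSpace (TotalSpace F E)] [∀ m, TopologicalSpace (E m)]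
    [FiberBundle F E] [VectorBundle ℝ F E] [ContMDiffVectorBundle ∞ F E 𝓘(ℝ, EM)] where
  form : ∀ m, LinearMap.BilinForm ℝ (E m)
  form_symm : ∀ m, (form m).IsSymm
  form_nondegenerate : ∀ m, (form m).Nondegenerate
  form_smooth : ∀ s t : Cₛ^∞⟮𝓘(ℝ, EM); F, E⟯,
    ContMDiff 𝓘(ℝ, EM) 𝓘(ℝ, ℝ) ∞ (fun m => form m (s m) (t m))
  anchor : ∀ m, E m →ₗ[ℝ] TangentSpace 𝓘(ℝ, EM) m
  anchor_smooth : ∀ s : Cₛ^∞⟮𝓘(ℝ, EM); F, E⟯,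
    ContMDiff 𝓘(ℝ, EM) 𝓘(ℝ, EM).tangent ∞
      (fun m => (⟨m, anchor m (s m)⟩ : TangentBundle 𝓘(ℝ, EM) M))
  bracket : Cₛ^∞⟮𝓘(ℝ, EM); F, E⟯ →ₗ[ℝ] Cₛ^∞⟮𝓘(ℝ, EM); F, E⟯ →ₗ[ℝ] Cₛ^∞⟮𝓘(ℝ, EM); F, E⟯
  /-- C1: the Leibniz identity. -/
  leibniz : ∀ e₁ e₂ e₃,
    bracket e₁ (bracket e₂ e₃) = bracket (bracket e₁ e₂) e₃ + bracket e₂ (bracket e₁ e₃)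
  /-- C2: the anchor preserves brackets. -/
  anchor_bracket : ∀ e₁ e₂ m, anchor m (bracket e₁ e₂ m) =
    VectorField.mlieBracket 𝓘(ℝ, EM) (fun x => anchor x (e₁ x)) (fun x => anchor x (e₂ x)) m
  /-- C3: `[e₁, f e₂] = f [e₁, e₂] + (π(e₁) f) e₂`. -/
  bracket_smul : ∀ (e₁ e₂ e₃ : Cₛ^∞⟮𝓘(ℝ, EM); F, E⟯) (f : M → ℝ),
    ContMDiff 𝓘(ℝ, EM) 𝓘(ℝ, ℝ) ∞ f → (∀ m, e₃ m = f m • e₂ m) →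
    ∀ m, bracket e₁ e₃ m = f m • bracket e₁ e₂ m + dirDeriv f m (anchor m (e₁ m)) • e₂ m
  /-- C4: `π(e₁)⟨e₂, e₃⟩ = ⟨[e₁, e₂], e₃⟩ + ⟨e₂, [e₁, e₃]⟩`. -/
  form_bracket : ∀ (e₁ e₂ e₃ : Cₛ^∞⟮𝓘(ℝ, EM); F, E⟯) (m : M),
    dirDeriv (fun x => form x (e₂ x) (e₃ x)) m (anchor m (e₁ m)) =
      form m (bracket e₁ e₂ m) (e₃ m) + form m (e₂ m) (bracket e₁ e₃ m)
  /-- C5: `[e, e] = 𝒟⟨e, e⟩` with `𝒟 = ½ π^* d`, that is, `⟨𝒟f, v⟩ = ½ df(π(v))`. -/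
  bracket_self : ∀ (e : Cₛ^∞⟮𝓘(ℝ, EM); F, E⟯) (m : M) (v : E m),
    form m (bracket e e m) v = (1 / 2 : ℝ) * dirDeriv (fun x => form x (e x) (e x)) m (anchor m v)

namespace CourantAlgebroid

variable {EM : Type*} [NormedAddCommGroup EM] [NormedSpace ℝ EM]
  {M : Type*} [TopologicalSpace M] [ChartedSpace EM M] [IsManifold 𝓘(ℝ, EM) ∞ M]
  {F : Type*} [NormedAddCommGroup F] [NormedSpace ℝ F]
  {E : M → Type*} [∀ m, AddCommGroup (E m)] [∀ m, Module ℝ (E m)]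
  [TopologicalSpace (TotalSpace F E)] [∀ m, TopologicalSpace (E m)]
  [FiberBundle F E] [VectorBundle ℝ F E] [ContMDiffVectorBundle ∞ F E 𝓘(ℝ, EM)]

/-- `0 → T^*M → E → TM → 0` is exact. -/
def IsExact (𝒞 : CourantAlgebroid EM M F E) : Prop :=
  ∀ m, IsExactFibre (𝒞.form m) (𝒞.anchor m)

/-- The bracket bundle that underlies a Courant algebroid. -/
def toBracketBundle (𝒞 : CourantAlgebroid EM M F E) : BracketBundle M E where
  SmoothNear u m := ∀ᶠ m' in 𝓝 m,
    ContMDiffAt 𝓘(ℝ, EM) (𝓘(ℝ, EM).prod 𝓘(ℝ, F)) ∞ (fun x => TotalSpace.mk' F x (u x)) m'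
  form := 𝒞.form
  IsBracket u w z := ∃ U W : Cₛ^∞⟮𝓘(ℝ, EM); F, E⟯,
    (∀ m, U m = u m) ∧ (∀ m, W m = w m) ∧ ∀ m, 𝒞.bracket U W m = z m

end CourantAlgebroid

/-! ### Extended actions -/

/-- An exact Courant algebra `0 → 𝔥 → 𝔞 → 𝔤 → 0` over the Lie algebra `𝔤` of the Lie group `G`. -/
structure ExactCourantAlgebra (EG : Type*) [NormedAddCommGroup EG] [NormedSpace ℝ EG]
    (G : Type*) [TopologicalSpace G] [ChartedSpace EG G] [Group G]
    (𝔞 : Type*) [AddCommGroup 𝔞] [Module ℝ 𝔞] where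
  bracket : 𝔞 →ₗ[ℝ] 𝔞 →ₗ[ℝ] 𝔞
  proj : 𝔞 →ₗ[ℝ] GroupLieAlgebra 𝓘(ℝ, EG) G
  leibniz : ∀ a₁ a₂ a₃,
    bracket a₁ (bracket a₂ a₃) = bracket (bracket a₁ a₂) a₃ + bracket a₂ (bracket a₁ a₃)
  proj_bracket : ∀ a₁ a₂, proj (bracket a₁ a₂) = ⁅proj a₁, proj a₂⁆
  proj_surjective : Function.Surjective proj
  abelian : ∀ h₁ h₂, proj h₁ = 0 → proj h₂ = 0 → bracket h₁ h₂ = 0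

section Action

variable {EG : Type*} [NormedAddCommGroup EG] [NormedSpace ℝ EG]
  {G : Type*} [TopologicalSpace G] [ChartedSpace EG G] [Group G]
  {EM : Type*} [NormedAddCommGroup EM] [NormedSpace ℝ EM]
  {M : Type*} [TopologicalSpace M] [ChartedSpace EM M] [MulAction G M]

/-- The infinitesimal action `ψ : 𝔤 → Γ(TM)`, `ψ(X)_m = d/dt|₀ exp(-tX) m`: the sign for which
`ψ` is a homomorphism of Lie algebras, `𝔤` being the algebra of left-invariant fields. -/
def infinitesimalAction (X : GroupLieAlgebra 𝓘(ℝ, EG) G) (m : M) : TangentSpace 𝓘(ℝ, EM) m :=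
  mfderiv 𝓘(ℝ, EG) 𝓘(ℝ, EM) (fun g : G => g⁻¹ • m) 1 X

end Action

/-- An extension to the Courant algebroid `𝒞` of the action of `G` on `M`. The morphism `rho`
covers the infinitesimal action, `𝔥` acts trivially, and the induced action of `𝔤 = 𝔞/𝔥` on
sections, `π(a) ↦ [ρ(a), ·]`, integrates to the action `act` of `G` on the total space of `E` by
bundle maps over the action on `M`: here `act g h : E m → E m'` is the action of `g` on the fibre
over `m`, the proof `h : g • m = m'` serving only to name the target fibre. -/
structure ExtendedAction {EG : Type*} [NormedAddCommGroup EG] [NormedSpace ℝ EG]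
    {G : Type*} [TopologicalSpace G] [ChartedSpace EG G] [Group G]
    {EM : Type*} [NormedAddCommGroup EM] [NormedSpace ℝ EM]
    {M : Type*} [TopologicalSpace M] [ChartedSpace EM M] [IsManifold 𝓘(ℝ, EM) ∞ M]
    {F : Type*} [NormedAddCommGroup F] [NormedSpace ℝ F]
    {E : M → Type*} [∀ m, AddCommGroup (E m)] [∀ m, Module ℝ (E m)]
    [TopologicalSpace (TotalSpace F E)] [∀ m, TopologicalSpace (E m)]
    [FiberBundle F E] [VectorBundle ℝ F E] [ContMDiffVectorBundle ∞ F E 𝓘(ℝ, EM)]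
    [MulAction G M]
    (𝒞 : CourantAlgebroid EM M F E)
    {𝔞 : Type*} [AddCommGroup 𝔞] [Module ℝ 𝔞] (𝒜 : ExactCourantAlgebra EG G 𝔞) where
  rho : 𝔞 →ₗ[ℝ] Cₛ^∞⟮𝓘(ℝ, EM); F, E⟯
  rho_bracket : ∀ a b, rho (𝒜.bracket a b) = 𝒞.bracket (rho a) (rho b)
  anchor_rho : ∀ a m, 𝒞.anchor m (rho a m) = infinitesimalAction (𝒜.proj a) m
  rho_trivial : ∀ h, 𝒜.proj h = 0 → ∀ e, 𝒞.bracket (rho h) e = 0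
  act : ∀ (g : G) {m m' : M}, g • m = m' → E m →ₗ[ℝ] E m'
  act_one : ∀ {m : M} (h : (1 : G) • m = m) (v : E m), act 1 h v = v
  act_mul : ∀ (g₁ g₂ : G) {m m' m'' : M} (h₂ : g₂ • m = m') (h₁ : g₁ • m' = m'')
    (h : (g₁ * g₂) • m = m'') (v : E m), act (g₁ * g₂) h v = act g₁ h₁ (act g₂ h₂ v)
  act_smooth : ContMDiff (𝓘(ℝ, EG).prod (𝓘(ℝ, EM).prod 𝓘(ℝ, F))) (𝓘(ℝ, EM).prod 𝓘(ℝ, F)) ∞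
    (fun x : G × TotalSpace F E => TotalSpace.mk' F (x.1 • x.2.proj) (act x.1 rfl x.2.snd))
  /-- The derivative at `g = 1` of `(g · s)(m) = g · s(g⁻¹ m)` is `[ρ(a), s](m)`; the equality in
  the vector space `E m` is expressed through all the linear functionals. -/
  act_deriv : ∀ (a : 𝔞) (s : Cₛ^∞⟮𝓘(ℝ, EM); F, E⟯) (m : M) (φ : Module.Dual ℝ (E m)),
    dirDeriv (EM := EG) (fun g : G => φ (act g (smul_inv_smul g m) (s (g⁻¹ • m)))) 1 (𝒜.proj a) =
      φ (𝒞.bracket (rho a) s m)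

/-! ### Leaves -/

/-- `ι : P → M` is a connected integral submanifold of the distribution `Δ`: an injective smooth
immersion of a connected manifold with `T P = Δ` along `P`. -/
structure IsIntegralSubmanifold {EM : Type*} [NormedAddCommGroup EM] [NormedSpace ℝ EM]
    {M : Type*} [TopologicalSpace M] [ChartedSpace EM M]
    (Δ : ∀ m : M, Submodule ℝ (TangentSpace 𝓘(ℝ, EM) m))
    {EP : Type*} [NormedAddCommGroup EP] [NormedSpace ℝ EP]
    {P : Type*} [TopologicalSpace P] [ChartedSpace EP P] (ι : P → M) : Prop where
  connected : ConnectedSpace P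
  injective : Function.Injective ι
  smooth : ContMDiff 𝓘(ℝ, EP) 𝓘(ℝ, EM) ∞ ι
  immersion : Manifold.IsImmersion 𝓘(ℝ, EP) 𝓘(ℝ, EM) ∞ ι
  tangent : ∀ p, LinearMap.range (mfderiv 𝓘(ℝ, EP) 𝓘(ℝ, EM) ι p).toLinearMap = Δ (ι p)

universe uP in
/-- `ι : P → M` is a leaf of `Δ`: a maximal connected integral submanifold. -/
structure IsLeaf {EM : Type*} [NormedAddCommGroup EM] [NormedSpace ℝ EM]
    {M : Type*} [TopologicalSpace M] [ChartedSpace EM M]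
    (Δ : ∀ m : M, Submodule ℝ (TangentSpace 𝓘(ℝ, EM) m))
    {EP : Type*} [NormedAddCommGroup EP] [NormedSpace ℝ EP]
    {P : Type uP} [TopologicalSpace P] [ChartedSpace EP P] (ι : P → M) : Prop
    extends IsIntegralSubmanifold (EP := EP) Δ ι where
  maximal : ∀ (N : Type uP) [TopologicalSpace N] [ChartedSpace EP N] [IsManifold 𝓘(ℝ, EP) ∞ N]
    [T2Space N] [SecondCountableTopology N] (j : N → M) (k : P → N),
    IsIntegralSubmanifold (EP := EP) Δ j → ContMDiff 𝓘(ℝ, EP) 𝓘(ℝ, EP) ∞ k → j ∘ k = ι →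
    Function.Surjective k

/-! ### Reduction -/

namespace ExtendedAction

variable {EG : Type*} [NormedAddCommGroup EG] [NormedSpace ℝ EG]
  {G : Type*} [TopologicalSpace G] [ChartedSpace EG G] [Group G]
  {EM : Type*} [NormedAddCommGroup EM] [NormedSpace ℝ EM]
  {M : Type*} [TopologicalSpace M] [ChartedSpace EM M] [IsManifold 𝓘(ℝ, EM) ∞ M]
  {F : Type*} [NormedAddCommGroup F] [NormedSpace ℝ F]
  {E : M → Type*} [∀ m, AddCommGroup (E m)] [∀ m, Module ℝ (E m)]
  [TopologicalSpace (TotalSpace F E)] [∀ m, TopologicalSpace (E m)]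
  [FiberBundle F E] [VectorBundle ℝ F E] [ContMDiffVectorBundle ∞ F E 𝓘(ℝ, EM)]
  [MulAction G M]
  {𝒞 : CourantAlgebroid EM M F E}
  {𝔞 : Type*} [AddCommGroup 𝔞] [Module ℝ 𝔞] {𝒜 : ExactCourantAlgebra EG G 𝔞}

/-- `a ↦ ρ(a)(m)`. -/
def rhoAt (ρ : ExtendedAction 𝒞 𝒜) (m : M) : 𝔞 →ₗ[ℝ] E m where
  toFun a := ρ.rho a m
  map_add' a b := by simp
  map_smul' c a := by simp

/-- The distribution `K = ρ(𝔞)`. -/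
def K (ρ : ExtendedAction 𝒞 𝒜) (m : M) : Submodule ℝ (E m) := LinearMap.range (ρ.rhoAt m)

/-- The distribution `ρ(𝔥)`, where `𝔥 = ker(𝔞 → 𝔤)`. -/
def rhoH (ρ : ExtendedAction 𝒞 𝒜) (m : M) : Submodule ℝ (E m) :=
  (LinearMap.ker 𝒜.proj).map (ρ.rhoAt m)

/-- The distribution `K^⊥`. -/
def Kperp (ρ : ExtendedAction 𝒞 𝒜) (m : M) : Submodule ℝ (E m) := (𝒞.form m).orthogonal (ρ.K m)

/-- The big distribution `Δ_b = π(K + K^⊥)`. -/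
def bigDistribution (ρ : ExtendedAction 𝒞 𝒜) (m : M) :
    Submodule ℝ (TangentSpace 𝓘(ℝ, EM) m) :=
  (ρ.K m ⊔ ρ.Kperp m).map (𝒞.anchor m)

/-- The distribution `K̃ = K ∩ (K^⊥ + T^*M)`. -/
def Ktilde (ρ : ExtendedAction 𝒞 𝒜) (m : M) : Submodule ℝ (E m) :=
  tildeK (𝒞.form m) (𝒞.anchor m) (ρ.K m)

/-- The fibre at `m` of the quotient `K^⊥ / (K ∩ K^⊥)`. -/
abbrev RedFibre (ρ : ExtendedAction 𝒞 𝒜) (m : M) : Type _ := RedSpace (𝒞.form m) (ρ.K m)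

/-- The extended action preserves the family of subspaces `D`:
`[ρ(𝔞), Γ(D)] ⊆ Γ(D)`. -/
def Preserves (ρ : ExtendedAction 𝒞 𝒜) (D : ∀ m, Submodule ℝ (E m)) : Prop :=
  ∀ (a : 𝔞) (s : Cₛ^∞⟮𝓘(ℝ, EM); F, E⟯), (∀ m, s m ∈ D m) →
    ∀ m, 𝒞.bracket (ρ.rho a) s m ∈ D m

section Orbits

variable {P : Type*} [MulAction G P] {ι : P → M} (hι : ∀ (g : G) (p : P), ι (g • p) = g • ι p)

/-- The fibre over `b ∈ P/G` of `E_red = (K^⊥ / (K ∩ K^⊥))|_P / G`, as a vector space: its elements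
are the families `(s p)`, `p` in the orbit `b`, of elements of `K^⊥ / (K ∩ K^⊥)` at `p` such that
`s (g p) = g · s p`. When the action on `P` is free, `s` is determined by any one of its
values, and this value is arbitrary. -/
def RedBundle (ρ : ExtendedAction 𝒞 𝒜) (b : MulAction.orbitRel.Quotient G P) :
    Submodule ℝ (∀ p : {p : P // (Quotient.mk'' p : MulAction.orbitRel.Quotient G P) = b},
      ρ.RedFibre (ι p.1)) where
  carrier := {s | ∀ (p p' : {p : P // (Quotient.mk'' p : MulAction.orbitRel.Quotient G P) = b})
    (g : G) (h : g • p.1 = p'.1), ∃ v : E (ι p.1),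
      Represents (𝒞.form (ι p.1)) (ρ.K (ι p.1)) v (s p) ∧
      Represents (𝒞.form (ι p'.1)) (ρ.K (ι p'.1))
        (ρ.act g ((hι g p.1).symm.trans (congrArg ι h)) v) (s p')}
  add_mem' := by
    intro s t hs ht p p' g h
    obtain ⟨v, hv, hgv⟩ := hs p p' g h
    obtain ⟨w, hw, hgw⟩ := ht p p' g h
    refine ⟨v + w, hv.add hw, ?_⟩
    rw [map_add]
    exact hgv.add hgw
  zero_mem' := by
    intro p p' g h
    refine ⟨0, Represents.zero _ _, ?_⟩
    rw [map_zero]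
    exact Represents.zero _ _
  smul_mem' := by
    intro c s hs p p' g h
    obtain ⟨v, hv, hgv⟩ := hs p p' g h
    refine ⟨c • v, hv.smul c, ?_⟩
    rw [map_smul]
    exact hgv.smul c

/-- The value in `K^⊥ / (K ∩ K^⊥)` at `p` of an element of `E_red` over the orbit of `p`. -/
def evalAt (ρ : ExtendedAction 𝒞 𝒜) (b : MulAction.orbitRel.Quotient G P) (p : P)
    (hp : (Quotient.mk'' p : MulAction.orbitRel.Quotient G P) = b) :
    ρ.RedBundle hι b →ₗ[ℝ] ρ.RedFibre (ι p) :=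
  (LinearMap.proj (⟨p, hp⟩ :
    {p : P // (Quotient.mk'' p : MulAction.orbitRel.Quotient G P) = b})) ∘ₗ (ρ.RedBundle hι b).subtype

/-- A vector `e ∈ E` at `p` lies in `K^⊥` and represents at `p` the section `u` of `E_red`. -/
def RepresentsAt (ρ : ExtendedAction 𝒞 𝒜) (u : ∀ b, ρ.RedBundle hι b) (p : P) (e : E (ι p)) :
    Prop :=
  Represents (𝒞.form (ι p)) (ρ.K (ι p)) e (ρ.evalAt hι _ p rfl (u (Quotient.mk'' p)))

/-- The family of subspaces `D_red = ((D ∩ K̃^⊥ + K̃)|_P / K̃|_P) / G` of `E_red`. -/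
def redDirac (ρ : ExtendedAction 𝒞 𝒜) (D : ∀ m, Submodule ℝ (E m))
    (b : MulAction.orbitRel.Quotient G P) : Submodule ℝ (ρ.RedBundle hι b) :=
  ⨅ p : {p : P // (Quotient.mk'' p : MulAction.orbitRel.Quotient G P) = b},
    (redSubspace (𝒞.form (ι p.1)) (𝒞.anchor (ι p.1)) (ρ.K (ι p.1)) (D (ι p.1))).comap
      (ρ.evalAt hι b p.1 p.2)

/-- `E_red` is exact. At `p ∈ P` the fibre of `E_red` is `K^⊥ / (K ∩ K^⊥)`, the tangent space of
`P/G` is `T_p P / T_p (G p) = π(K + K^⊥) / π(K)`, and the anchor is induced by `π`. -/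
def IsReducedExact (ρ : ExtendedAction 𝒞 𝒜) (ι : P → M) : Prop :=
  ∀ p : P, IsExactFibre (redForm (𝒞.form (ι p)) (𝒞.form_symm (ι p)) (ρ.K (ι p)))
    (redAnchor (𝒞.form (ι p)) (𝒞.anchor (ι p)) (ρ.K (ι p)))

/-- The reduced Courant algebroid `E_red` over `P/G`.

* A section is smooth if it is represented, locally on `P`, by smooth sections of `K^⊥|_P`.
* The form is induced by that of `E` (at any point of the orbit; the form of `E` is
  `G`-invariant).
* The bracket `z` of two sections `u` and `w` is computed at every `p ∈ P` by extending sections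
  of `K^⊥|_P` which represent `u` and `w` near `p` to sections of `E` over `M`, taking their
  bracket at `p`, which is to lie in `K^⊥`, and passing to the quotient by `K ∩ K^⊥`. Such
  extensions are to exist, and all of them are to give the same result. -/
def reducedCourant {EP : Type*} [NormedAddCommGroup EP] [NormedSpace ℝ EP]
    [TopologicalSpace P] [ChartedSpace EP P] (ρ : ExtendedAction 𝒞 𝒜) :
    BracketBundle (MulAction.orbitRel.Quotient G P) (fun b => ρ.RedBundle hι b) where
  SmoothNear u b := ∀ p : P, (Quotient.mk'' p : MulAction.orbitRel.Quotient G P) = b →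
    ∃ v : ∀ p : P, E (ι p), ∀ᶠ p' in 𝓝 p,
      ContMDiffAt 𝓘(ℝ, EP) (𝓘(ℝ, EM).prod 𝓘(ℝ, F)) ∞
        (fun x => TotalSpace.mk' F (ι x) (v x)) p' ∧
      ρ.RepresentsAt hι u p' (v p')
  form b := (redForm (𝒞.form (ι b.out)) (𝒞.form_symm (ι b.out)) (ρ.K (ι b.out))).comp
    (ρ.evalAt hι b b.out b.out_eq') (ρ.evalAt hι b b.out b.out_eq')
  IsBracket u w z := ∀ p : P,
    (∃ U W : Cₛ^∞⟮𝓘(ℝ, EM); F, E⟯,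
      (∀ᶠ p' in 𝓝 p, ρ.RepresentsAt hι u p' (U (ι p'))) ∧
      (∀ᶠ p' in 𝓝 p, ρ.RepresentsAt hι w p' (W (ι p')))) ∧
    ∀ U W : Cₛ^∞⟮𝓘(ℝ, EM); F, E⟯,
      (∀ᶠ p' in 𝓝 p, ρ.RepresentsAt hι u p' (U (ι p'))) →
      (∀ᶠ p' in 𝓝 p, ρ.RepresentsAt hι w p' (W (ι p'))) →
      ρ.RepresentsAt hι z p (𝒞.bracket U W (ι p))

end Orbits

end ExtendedAction

end CourantReduction

end

open CourantReduction

noncomputable section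

namespace CourantReduction

set_option linter.unusedSectionVars false

/-! ### Linear algebra of Lagrangian subspaces and of the reduction of a fibre -/

section LagrangianAlgebra

open Module

variable {V T : Type*} [AddCommGroup V] [Module ℝ V] [AddCommGroup T] [Module ℝ T]
  {β : LinearMap.BilinForm ℝ V} {α : V →ₗ[ℝ] T}

theorem mem_orthogonal_symm (hβ : β.IsSymm) {W : Submodule ℝ V} {x : V} :
    x ∈ β.orthogonal W ↔ ∀ y ∈ W, β x y = 0 := by
  refine ⟨fun h y hy => ?_, fun h y hy => ?_⟩
  · rw [← hβ.eq]
    exact h y hy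
  · have := h y hy
    rwa [← hβ.eq] at this

theorem form_eq_zero_of_mem_orthogonal {W : Submodule ℝ V} {x y : V}
    (hx : x ∈ β.orthogonal W) (hy : y ∈ W) : β y x = 0 :=
  hx y hy

theorem orthogonal_sup_eq (W W' : Submodule ℝ V) :
    β.orthogonal (W ⊔ W') = β.orthogonal W ⊓ β.orthogonal W' := by
  refine le_antisymm (le_inf (LinearMap.BilinForm.orthogonal_le le_sup_left)
    (LinearMap.BilinForm.orthogonal_le le_sup_right)) ?_
  rintro x ⟨hx, hx'⟩ y hy
  obtain ⟨a, ha, b, hb, rfl⟩ := Submodule.mem_sup.1 hy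
  have h₁ : β a x = 0 := hx a ha
  have h₂ : β b x = 0 := hx' b hb
  change β (a + b) x = 0
  simp [h₁, h₂]

variable [FiniteDimensional ℝ V]

theorem orthogonal_orthogonal_eq (hβ : β.IsSymm) (hn : β.Nondegenerate) (W : Submodule ℝ V) :
    β.orthogonal (β.orthogonal W) = W :=
  LinearMap.BilinForm.orthogonal_orthogonal hn hβ.isRefl W

theorem orthogonal_inf_eq (hβ : β.IsSymm) (hn : β.Nondegenerate) (W W' : Submodule ℝ V) :
    β.orthogonal (W ⊓ W') = β.orthogonal W ⊔ β.orthogonal W' := by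
  rw [← orthogonal_orthogonal_eq hβ hn (β.orthogonal W ⊔ β.orthogonal W'), orthogonal_sup_eq,
    orthogonal_orthogonal_eq hβ hn, orthogonal_orthogonal_eq hβ hn]

theorem finrank_orthogonal_add (hn : β.Nondegenerate) (W : Submodule ℝ V) :
    finrank ℝ (β.orthogonal W) + finrank ℝ W = finrank ℝ V := by
  rw [LinearMap.BilinForm.finrank_orthogonal hn]
  have := Submodule.finrank_le W
  omega

theorem two_mul_finrank_of_orthogonal_eq (hn : β.Nondegenerate) {W : Submodule ℝ V}
    (hW : β.orthogonal W = W) : 2 * finrank ℝ W = finrank ℝ V := by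
  have := finrank_orthogonal_add hn W
  rw [hW] at this
  omega

omit [FiniteDimensional ℝ V] in
theorem IsExactFibre.orthogonal_ker (hβ : β.IsSymm) (hE : IsExactFibre β α) :
    β.orthogonal (LinearMap.ker α) = LinearMap.ker α := by
  refine le_antisymm ?_ ?_
  · intro x hx
    rw [← hE.exact_middle]
    have hle : LinearMap.ker α ≤ LinearMap.ker (β x) := fun y hy =>
      (mem_orthogonal_symm hβ).1 hx y hy
    obtain ⟨s, hs⟩ := α.exists_rightInverse_of_surjective (LinearMap.range_eq_top.2 hE.surjective)
    refine ⟨(β x) ∘ₗ s, fun v => ?_⟩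
    have : v - s (α v) ∈ LinearMap.ker α := by
      have h := LinearMap.congr_fun hs (α v)
      simp only [LinearMap.comp_apply, LinearMap.id_apply] at h
      simp [h]
    have h := hle this
    simpa [sub_eq_zero] using h
  · intro x hx
    rw [← hE.exact_middle] at hx
    obtain ⟨ξ, hξ⟩ := hx
    refine (mem_orthogonal_symm hβ).2 fun y hy => ?_
    rw [hξ, LinearMap.mem_ker.1 hy, map_zero]

theorem IsExactFibre.finrank_eq (hβ : β.IsSymm) (hn : β.Nondegenerate)
    (hE : IsExactFibre β α) : finrank ℝ V = 2 * finrank ℝ T := by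
  have h₁ := two_mul_finrank_of_orthogonal_eq hn (hE.orthogonal_ker hβ)
  have h₂ := α.finrank_range_add_finrank_ker
  rw [LinearMap.range_eq_top.2 hE.surjective, finrank_top] at h₂
  omega

omit [FiniteDimensional ℝ V] in
/-- A subspace that equals its orthogonal is maximal isotropic. -/
theorem isMaximalIsotropic_of_orthogonal_eq (hβ : β.IsSymm) {D : Submodule ℝ V}
    (hD : β.orthogonal D = D) : IsMaximalIsotropic β D := by
  refine ⟨fun x hx y hy => ?_, fun W hW hDW => le_antisymm (fun x hx => ?_) hDW⟩
  · rw [← hD] at hx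
    exact (mem_orthogonal_symm hβ).1 hx y hy
  · rw [← hD]
    exact (mem_orthogonal_symm hβ).2 fun y hy => hW x hx y (hDW hy)

/-- In the presence of a Lagrangian subspace `L`, maximal isotropic subspaces are Lagrangian. -/
theorem IsMaximalIsotropic.orthogonal_eq (hβ : β.IsSymm) (hn : β.Nondegenerate)
    {D L : Submodule ℝ V} (hL : β.orthogonal L = L) (hD : IsMaximalIsotropic β D) :
    β.orthogonal D = D := by
  have hle : D ≤ β.orthogonal D := fun x hx =>
    (mem_orthogonal_symm hβ).2 fun y hy => hD.1 x hx y hy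
  have hiso : IsIsotropic β (D ⊔ L ⊓ β.orthogonal D) := by
    intro x hx y hy
    obtain ⟨d, hd, l, hl, rfl⟩ := Submodule.mem_sup.1 hx
    obtain ⟨d', hd', l', hl', rfl⟩ := Submodule.mem_sup.1 hy
    have h₁ : β d d' = 0 := hD.1 d hd d' hd'
    have h₂ : β d l' = 0 := form_eq_zero_of_mem_orthogonal hl'.2 hd
    have h₃ : β l d' = 0 := (mem_orthogonal_symm hβ).1 hl.2 d' hd'
    have h₄ : β l l' = 0 := by
      have := hl'.1
      rw [← hL] at this
      exact form_eq_zero_of_mem_orthogonal this hl.1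
    simp [h₁, h₂, h₃, h₄]
  have h := hD.2 _ hiso le_sup_left
  have h' : L ⊓ β.orthogonal D ≤ D := le_sup_right.trans h.le
  refine le_antisymm ?_ hle
  have h'' := LinearMap.BilinForm.orthogonal_le (B := β) h'
  rw [orthogonal_inf_eq hβ hn, orthogonal_orthogonal_eq hβ hn, hL] at h''
  intro x hx
  obtain ⟨l, hl, d, hd, rfl⟩ := Submodule.mem_sup.1 (h'' hx)
  have : l ∈ β.orthogonal D := by
    have := Submodule.sub_mem _ hx (hle hd)
    simpa using this
  exact add_mem (h' ⟨hl, this⟩) hd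

end LagrangianAlgebra

section FibreReduction

open Module

variable {V T : Type*} [AddCommGroup V] [Module ℝ V] [AddCommGroup T] [Module ℝ T]
  {β : LinearMap.BilinForm ℝ V} {α : V →ₗ[ℝ] T} {K D : Submodule ℝ V}

theorem Represents.mem {e : V} {c : RedSpace β K} (h : Represents β K e c) :
    e ∈ β.orthogonal K := h.1

theorem exists_represents (c : RedSpace β K) : ∃ e, Represents β K e c := by
  obtain ⟨⟨e, he⟩, rfl⟩ := (redKernel β K).mkQ_surjective c
  exact ⟨e, he, rfl⟩

theorem represents_mk {e : V} (h : e ∈ β.orthogonal K) :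
    Represents β K e ((redKernel β K).mkQ ⟨e, h⟩) := ⟨h, rfl⟩

theorem represents_zero_iff {e : V} :
    Represents β K e 0 ↔ e ∈ K ⊓ β.orthogonal K := by
  constructor
  · rintro ⟨h, h'⟩
    rw [Submodule.mkQ_apply, Submodule.Quotient.mk_eq_zero] at h'
    exact ⟨h', h⟩
  · rintro ⟨h, h'⟩
    refine ⟨h', ?_⟩
    rw [Submodule.mkQ_apply, Submodule.Quotient.mk_eq_zero]
    exact h

theorem Represents.sub {e e' : V} {c c' : RedSpace β K} (h : Represents β K e c)
    (h' : Represents β K e' c') : Represents β K (e - e') (c - c') := by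
  obtain ⟨h, rfl⟩ := h
  obtain ⟨h', rfl⟩ := h'
  exact ⟨sub_mem h h', rfl⟩

theorem Represents.sub_mem_inf {e e' : V} {c : RedSpace β K} (h : Represents β K e c)
    (h' : Represents β K e' c) : e - e' ∈ K ⊓ β.orthogonal K := by
  have := h.sub h'
  rw [sub_self] at this
  exact represents_zero_iff.1 this

theorem Represents.of_sub_mem {e e' : V} {c : RedSpace β K} (h : Represents β K e c)
    (h' : e' - e ∈ K ⊓ β.orthogonal K) : Represents β K e' c := by
  have := h.add (represents_zero_iff.2 h')
  rwa [add_zero, add_sub_cancel] at this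

theorem Represents.eq {e : V} {c c' : RedSpace β K} (h : Represents β K e c)
    (h' : Represents β K e c') : c = c' := by
  obtain ⟨h, rfl⟩ := h
  obtain ⟨h', rfl⟩ := h'
  rfl

theorem Represents.redForm_apply {hβ : β.IsSymm} {e e' : V} {c c' : RedSpace β K}
    (h : Represents β K e c) (h' : Represents β K e' c') : redForm β hβ K c c' = β e e' := by
  obtain ⟨h, rfl⟩ := h
  obtain ⟨h', rfl⟩ := h'
  rfl

theorem redForm_isSymm (hβ : β.IsSymm) : (redForm β hβ K).IsSymm := by
  refine ⟨fun c c' => ?_⟩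
  obtain ⟨e, he⟩ := exists_represents c
  obtain ⟨e', he'⟩ := exists_represents c'
  rw [he.redForm_apply he', he'.redForm_apply he]
  exact hβ.eq e e'

theorem mem_ker_redAnchor {e : V} {c : RedSpace β K} (h : Represents β K e c) :
    c ∈ LinearMap.ker (redAnchor β α K) ↔ α e ∈ K.map α := by
  obtain ⟨h, rfl⟩ := h
  exact Submodule.Quotient.mk_eq_zero _

variable [FiniteDimensional ℝ V]

theorem redForm_nondegenerate (hβ : β.IsSymm) (hn : β.Nondegenerate) :
    (redForm β hβ K).Nondegenerate := by
  refine (redForm_isSymm hβ).isRefl.nondegenerate_iff_separatingLeft.2 ?_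
  intro c hc
  obtain ⟨e, he⟩ := exists_represents c
  have : e ∈ K := by
    rw [← orthogonal_orthogonal_eq hβ hn K]
    refine (mem_orthogonal_symm hβ).2 fun y hy => ?_
    rw [← he.redForm_apply (hβ := hβ) (represents_mk hy)]
    exact hc _
  exact he.eq (represents_zero_iff.2 ⟨this, he.mem⟩)

section Exact

variable (hβ : β.IsSymm) (hn : β.Nondegenerate) (hE : IsExactFibre β α)
  (hR : IsExactFibre (redForm β hβ K) (redAnchor β α K))
include hβ hn hE hR

omit [FiniteDimensional ℝ V] hn hE in
theorem form_eq_zero_of_anchor_mem {x y : V} (hx : x ∈ β.orthogonal K) (hy : y ∈ β.orthogonal K)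
    (hx' : α x ∈ K.map α) (hy' : α y ∈ K.map α) : β x y = 0 := by
  have h₁ := (mem_ker_redAnchor (represents_mk hx)).2 hx'
  have h₂ := (mem_ker_redAnchor (represents_mk hy)).2 hy'
  rw [← hR.orthogonal_ker (redForm_isSymm hβ)] at h₁
  rw [← (represents_mk hx).redForm_apply (hβ := hβ) (represents_mk hy)]
  exact (mem_orthogonal_symm (redForm_isSymm hβ)).1 h₁ _ h₂

omit hn in
theorem tildeK_le_orthogonal : tildeK β α K ≤ β.orthogonal (tildeK β α K) := by
  rintro x ⟨hxK, hx⟩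
  refine (mem_orthogonal_symm hβ).2 ?_
  rintro y ⟨hyK, hy⟩
  obtain ⟨u, hu, l, hl, rfl⟩ := Submodule.mem_sup.1 hx
  obtain ⟨u', hu', l', hl', rfl⟩ := Submodule.mem_sup.1 hy
  have hL := hE.orthogonal_ker hβ
  rw [hE.exact_middle] at hl hl'
  have h₁ : β (u + l) u' = 0 := hu' _ hxK
  have h₂ : β l l' = 0 := by
    rw [← hL] at hl
    exact (mem_orthogonal_symm hβ).1 hl _ hl'
  have h₃ : β u (u' + l') = 0 := (mem_orthogonal_symm hβ).1 hu _ hyK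
  have h₄ : β u u' = 0 := form_eq_zero_of_anchor_mem hβ hR hu hu'
    ⟨_, hxK, by simp [LinearMap.mem_ker.1 hl]⟩ ⟨_, hyK, by simp [LinearMap.mem_ker.1 hl']⟩
  simp only [map_add, LinearMap.add_apply] at h₁ h₃ ⊢
  linarith

omit hR in
theorem orthogonal_tildeK :
    β.orthogonal (tildeK β α K) = β.orthogonal K ⊔ (K ⊓ LinearMap.ker α) := by
  rw [tildeK, orthogonal_inf_eq hβ hn, orthogonal_sup_eq, orthogonal_orthogonal_eq hβ hn,
    hE.exact_middle, hE.orthogonal_ker hβ]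

theorem tildeK_eq : tildeK β α K = K ⊓ β.orthogonal K ⊔ K ⊓ LinearMap.ker α := by
  refine le_antisymm ?_ ?_
  · intro x hx
    have h := tildeK_le_orthogonal hβ hE hR hx
    rw [orthogonal_tildeK hβ hn hE] at h
    obtain ⟨a, ha, b, hb, rfl⟩ := Submodule.mem_sup.1 h
    refine Submodule.add_mem_sup ⟨?_, ha⟩ hb
    have := K.sub_mem hx.1 hb.1
    simpa using this
  · refine sup_le (inf_le_inf_left _ le_sup_left) (inf_le_inf_left _ ?_)
    rw [← hE.exact_middle]
    exact le_sup_right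

theorem inf_orthogonal_tildeK_le : K ⊓ β.orthogonal (tildeK β α K) ≤ tildeK β α K := by
  rintro x ⟨hxK, hx⟩
  rw [orthogonal_tildeK hβ hn hE] at hx
  rw [tildeK_eq hβ hn hE hR]
  obtain ⟨a, ha, b, hb, rfl⟩ := Submodule.mem_sup.1 hx
  refine Submodule.add_mem_sup ⟨?_, ha⟩ hb
  have := K.sub_mem hxK hb.1
  simpa using this

theorem orthogonal_reduction (hD : β.orthogonal D = D) :
    β.orthogonal (D ⊓ β.orthogonal (tildeK β α K) ⊔ tildeK β α K) =
      D ⊓ β.orthogonal (tildeK β α K) ⊔ tildeK β α K := by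
  rw [orthogonal_sup_eq, orthogonal_inf_eq hβ hn, orthogonal_orthogonal_eq hβ hn, hD]
  have := tildeK_le_orthogonal hβ hE hR
  rw [sup_comm, sup_inf_assoc_of_le _ this, sup_comm]

theorem Represents.mem_redSubspace_iff {e : V} {c : RedSpace β K} (h : Represents β K e c) :
    c ∈ redSubspace β α K D ↔ e ∈ D ⊓ β.orthogonal (tildeK β α K) ⊔ tildeK β α K := by
  constructor
  · rintro ⟨⟨x, hx⟩, hx', rfl⟩
    have h' := h.sub_mem_inf (represents_mk hx)
    have h₂ : e - x ∈ tildeK β α K :=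
      (tildeK_eq hβ hn hE hR).ge (Submodule.mem_sup_left h')
    have h₁ : x ∈ D ⊓ β.orthogonal (tildeK β α K) ⊔ tildeK β α K := hx'
    have := add_mem (Submodule.mem_sup_right (S := D ⊓ β.orthogonal (tildeK β α K)) h₂) h₁
    simpa using this
  · intro he
    obtain ⟨h, rfl⟩ := h
    exact ⟨⟨e, h⟩, he, rfl⟩

theorem orthogonal_redSubspace (hD : β.orthogonal D = D) :
    (redForm β hβ K).orthogonal (redSubspace β α K D) = redSubspace β α K D := by
  have hB := orthogonal_reduction hβ hn hE hR hD
  have hKt : tildeK β α K ≤ D ⊓ β.orthogonal (tildeK β α K) ⊔ tildeK β α K := le_sup_right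
  refine le_antisymm ?_ ?_
  · intro c hc
    obtain ⟨e, he⟩ := exists_represents c
    rw [he.mem_redSubspace_iff hβ hn hE hR]
    have h₁ : e ∈ β.orthogonal
        (β.orthogonal K ⊓ (D ⊓ β.orthogonal (tildeK β α K) ⊔ tildeK β α K)) := by
      refine (mem_orthogonal_symm hβ).2 fun y hy => ?_
      rw [← he.redForm_apply (hβ := hβ) (represents_mk hy.1)]
      exact (mem_orthogonal_symm (redForm_isSymm hβ)).1 hc _
        (((represents_mk hy.1).mem_redSubspace_iff hβ hn hE hR).2 hy.2)
    rw [orthogonal_inf_eq hβ hn, orthogonal_orthogonal_eq hβ hn, hB] at h₁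
    obtain ⟨k, hk, y, hy, rfl⟩ := Submodule.mem_sup.1 h₁
    refine add_mem (hKt (inf_orthogonal_tildeK_le hβ hn hE hR ⟨hk, ?_⟩)) hy
    have h₂ : k + y ∈ β.orthogonal (tildeK β α K) :=
      LinearMap.BilinForm.orthogonal_le inf_le_left he.mem
    have h₃ : y ∈ β.orthogonal (tildeK β α K) :=
      sup_le inf_le_right (tildeK_le_orthogonal hβ hE hR) hy
    have := sub_mem h₂ h₃
    simpa using this
  · intro c hc
    obtain ⟨e, he⟩ := exists_represents c
    refine (mem_orthogonal_symm (redForm_isSymm hβ)).2 fun c' hc' => ?_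
    obtain ⟨e', he'⟩ := exists_represents c'
    rw [he.redForm_apply he']
    rw [he.mem_redSubspace_iff hβ hn hE hR, ← hB] at hc
    exact (mem_orthogonal_symm hβ).1 hc _ ((he'.mem_redSubspace_iff hβ hn hE hR).1 hc')

end Exact

omit [FiniteDimensional ℝ V] in
theorem finrank_redSpace_add [FiniteDimensional ℝ V] :
    finrank ℝ (RedSpace β K) + finrank ℝ ↥(K ⊓ β.orthogonal K) = finrank ℝ (β.orthogonal K) := by
  have h := (redKernel β K).finrank_quotient_add_finrank
  have h' : finrank ℝ (redKernel β K) = finrank ℝ ↥(K ⊓ β.orthogonal K) := by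
    rw [← Submodule.finrank_map_subtype_eq (β.orthogonal K) (redKernel β K),
      Submodule.map_comap_subtype, inf_comm]
  rw [← h', h]

theorem finrank_redTangent_add :
    finrank ℝ (RedTangent β α K) + finrank ℝ (K.map α) =
      finrank ℝ ((K ⊔ β.orthogonal K).map α) := by
  have h := ((K.map α).comap ((K ⊔ β.orthogonal K).map α).subtype).finrank_quotient_add_finrank
  have h' : finrank ℝ ((K.map α).comap ((K ⊔ β.orthogonal K).map α).subtype) =
      finrank ℝ (K.map α) := by
    rw [← Submodule.finrank_map_subtype_eq ((K ⊔ β.orthogonal K).map α),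
      Submodule.map_comap_subtype, inf_eq_right.2 (Submodule.map_mono le_sup_left)]
  rw [← h', h]

end FibreReduction

/-! ### Smooth matrices and coefficients in a moving frame -/

section MovingFrame

variable {EX : Type*} [NormedAddCommGroup EX] [NormedSpace ℝ EX]
  {X : Type*} [TopologicalSpace X] [ChartedSpace EX X]
  {n : Type*} [Fintype n] [DecidableEq n]

theorem contMDiffAt_det {A : X → Matrix n n ℝ} {x : X}
    (hA : ∀ i j, ContMDiffAt 𝓘(ℝ, EX) 𝓘(ℝ, ℝ) ∞ (fun y => A y i j) x) :
    ContMDiffAt 𝓘(ℝ, EX) 𝓘(ℝ, ℝ) ∞ (fun y => (A y).det) x := by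
  simp only [Matrix.det_apply']
  exact contMDiffAt_finsetSum fun σ _ =>
    contMDiffAt_const.mul (contMDiffAt_finsetProd fun i _ => hA _ _)

theorem contMDiffAt_matrix_inv {A : X → Matrix n n ℝ} {x : X}
    (hA : ∀ i j, ContMDiffAt 𝓘(ℝ, EX) 𝓘(ℝ, ℝ) ∞ (fun y => A y i j) x) (h : (A x).det ≠ 0)
    (i j : n) : ContMDiffAt 𝓘(ℝ, EX) 𝓘(ℝ, ℝ) ∞ (fun y => (A y)⁻¹ i j) x := by
  simp only [Matrix.inv_def, Matrix.smul_apply, Ring.inverse_eq_inv', smul_eq_mul,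
    Matrix.adjugate_apply]
  refine ((contMDiffAt_det hA).inv₀ h).mul (contMDiffAt_det fun k l => ?_)
  by_cases hk : k = j
  · subst hk
    simpa using contMDiffAt_const
  · simpa [Matrix.updateRow_ne hk] using hA k l

theorem exists_dual_family {W : Type*} [AddCommGroup W] [Module ℝ W] {v : n → W}
    (hv : LinearIndependent ℝ v) :
    ∃ θ : n → Module.Dual ℝ W, ∀ i j, θ j (v i) = (1 : Matrix n n ℝ) j i := by
  obtain ⟨g, hg⟩ := (Fintype.linearCombination ℝ v).exists_leftInverse_of_injective
    (LinearMap.ker_eq_bot.2 hv.fintypeLinearCombination_injective)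
  refine ⟨fun j => LinearMap.proj j ∘ₗ g, fun i j => ?_⟩
  have h := LinearMap.congr_fun hg (Pi.single i 1)
  simp only [LinearMap.comp_apply, Fintype.linearCombination_apply_single, one_smul,
    LinearMap.id_apply] at h
  simp only [LinearMap.comp_apply, LinearMap.proj_apply, h, Matrix.one_apply, Pi.single_apply]

variable {W : Type*} [NormedAddCommGroup W] [NormedSpace ℝ W] [FiniteDimensional ℝ W]

/-- Vectors that depend smoothly on a point and are linearly independent at `x₀` are linearly
independent near `x₀`, and coefficients with respect to them depend smoothly on the point. -/
theorem exists_smooth_coefficients {f : n → X → W} {x₀ : X}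
    (hf : ∀ᶠ x in 𝓝 x₀, ∀ i, ContMDiffAt 𝓘(ℝ, EX) 𝓘(ℝ, W) ∞ (f i) x)
    (hli : LinearIndependent ℝ fun i => f i x₀) :
    ∃ (θ : n → Module.Dual ℝ W) (B : X → Matrix n n ℝ), ∀ᶠ x in 𝓝 x₀,
      (∀ i j, ContMDiffAt 𝓘(ℝ, EX) 𝓘(ℝ, ℝ) ∞ (fun y => B y i j) x) ∧
      (LinearIndependent ℝ fun i => f i x) ∧
      ∀ (a : n → ℝ) (i : n), a i = ∑ j, B x i j * θ j (∑ l, a l • f l x) := by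
  obtain ⟨θ, hθ⟩ := exists_dual_family hli
  let A : X → Matrix n n ℝ := fun x => Matrix.of fun j i => θ j (f i x)
  have hA : ∀ᶠ x in 𝓝 x₀, ∀ j i, ContMDiffAt 𝓘(ℝ, EX) 𝓘(ℝ, ℝ) ∞ (fun y => A y j i) x := by
    filter_upwards [hf] with x hx j i
    exact ((θ j).toContinuousLinearMap.contMDiff).contMDiffAt.comp x (hx i)
  have hA₀ : A x₀ = 1 := by
    ext j i
    exact hθ i j
  have hdet : ∀ᶠ x in 𝓝 x₀, (A x).det ≠ 0 := by
    have := (contMDiffAt_det hA.self_of_nhds).continuousAt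
    refine this.eventually_ne ?_
    simp [hA₀]
  have key : ∀ x, (A x).det ≠ 0 → ∀ (a : n → ℝ) (i : n),
      a i = ∑ j, (A x)⁻¹ i j * θ j (∑ l, a l • f l x) := by
    intro x hx a i
    have h₁ : (fun j => θ j (∑ l, a l • f l x)) = (A x).mulVec a := by
      ext j
      simp [A, Matrix.mulVec, dotProduct, mul_comm]
    have h₂ : (A x)⁻¹.mulVec ((A x).mulVec a) = a := by
      rw [Matrix.mulVec_mulVec, Matrix.nonsing_inv_mul _ (isUnit_iff_ne_zero.2 hx),
        Matrix.one_mulVec]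
    rw [← h₁] at h₂
    exact (congrFun h₂ i).symm
  refine ⟨θ, fun x => (A x)⁻¹, ?_⟩
  filter_upwards [hA, hdet] with x hAx hx
  refine ⟨fun i j => contMDiffAt_matrix_inv hAx hx i j, ?_, key x hx⟩
  rw [Fintype.linearIndependent_iff]
  intro a ha i
  rw [key x hx a i, ha]
  simp

end MovingFrame

/-! ### Global sections with prescribed local behaviour -/

section Sections

variable {EM : Type*} [NormedAddCommGroup EM] [NormedSpace ℝ EM] [FiniteDimensional ℝ EM]
  {M : Type*} [TopologicalSpace M] [ChartedSpace EM M] [IsManifold 𝓘(ℝ, EM) ∞ M] [T2Space M]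

theorem exists_bump {m₀ : M} {u : Set M} (hu : u ∈ 𝓝 m₀) :
    ∃ χ : M → ℝ, ContMDiff 𝓘(ℝ, EM) 𝓘(ℝ, ℝ) ∞ χ ∧ tsupport χ ⊆ u ∧ ∀ᶠ m in 𝓝 m₀, χ m = 1 := by
  obtain ⟨χ, -, hχ⟩ := (SmoothBumpFunction.nhds_basis_tsupport (I := 𝓘(ℝ, EM)) m₀).mem_iff.1 hu
  exact ⟨χ, χ.contMDiff, hχ, χ.eventuallyEq_one⟩

theorem exists_smooth_function_eventuallyEq {f : M → ℝ} {m₀ : M}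
    (hf : ∀ᶠ m in 𝓝 m₀, ContMDiffAt 𝓘(ℝ, EM) 𝓘(ℝ, ℝ) ∞ f m) :
    ∃ g : M → ℝ, ContMDiff 𝓘(ℝ, EM) 𝓘(ℝ, ℝ) ∞ g ∧ ∀ᶠ m in 𝓝 m₀, g m = f m := by
  obtain ⟨χ, hχ, hsupp, hone⟩ := exists_bump (EM := EM) hf
  refine ⟨fun m => χ m * f m, contMDiff_of_tsupport fun x hx => ?_, ?_⟩
  · exact hχ.contMDiffAt.mul (hsupp (tsupport_mul_subset_left hx))
  · filter_upwards [hone] with m hm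
    rw [hm, one_mul]

variable {F : Type*} [NormedAddCommGroup F] [NormedSpace ℝ F]
  {E : M → Type*} [∀ m, AddCommGroup (E m)] [∀ m, Module ℝ (E m)]
  [TopologicalSpace (TotalSpace F E)] [∀ m, TopologicalSpace (E m)]
  [FiberBundle F E] [VectorBundle ℝ F E] [ContMDiffVectorBundle ∞ F E 𝓘(ℝ, EM)]

/-- The product of a smooth section with a smooth function. -/
def mulSection (f : M → ℝ) (hf : ContMDiff 𝓘(ℝ, EM) 𝓘(ℝ, ℝ) ∞ f) (s : Cₛ^∞⟮𝓘(ℝ, EM); F, E⟯) :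
    Cₛ^∞⟮𝓘(ℝ, EM); F, E⟯ :=
  ⟨fun m => f m • s m, hf.smul_section s.contMDiff⟩

@[simp]
theorem mulSection_apply (f : M → ℝ) (hf : ContMDiff 𝓘(ℝ, EM) 𝓘(ℝ, ℝ) ∞ f)
    (s : Cₛ^∞⟮𝓘(ℝ, EM); F, E⟯) (m : M) : mulSection f hf s m = f m • s m := rfl

omit [FiniteDimensional ℝ EM] [IsManifold 𝓘(ℝ, EM) ∞ M] [T2Space M]
  [ContMDiffVectorBundle ∞ F E 𝓘(ℝ, EM)] in
@[simp]
theorem sum_section_apply {n : Type*} (t : Finset n) (s : n → Cₛ^∞⟮𝓘(ℝ, EM); F, E⟯) (m : M) :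
    (∑ i ∈ t, s i) m = ∑ i ∈ t, s i m := by
  have := map_sum (ContMDiffSection.coeAddHom 𝓘(ℝ, EM) F ∞ E) s t
  exact (congrFun this m).trans (Finset.sum_apply m t fun i => (s i : ∀ m, E m))

omit [ContMDiffVectorBundle ∞ F E 𝓘(ℝ, EM)] in
theorem exists_section_eventuallyEq {s : ∀ m, E m} {m₀ : M}
    (hs : ∀ᶠ m in 𝓝 m₀, ContMDiffAt 𝓘(ℝ, EM) (𝓘(ℝ, EM).prod 𝓘(ℝ, F)) ∞
      (fun x => TotalSpace.mk' F x (s x)) m) :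
    ∃ S : Cₛ^∞⟮𝓘(ℝ, EM); F, E⟯, ∀ᶠ m in 𝓝 m₀, S m = s m := by
  obtain ⟨u, hu, huo, hmu⟩ := eventually_nhds_iff.1 hs
  obtain ⟨χ, hχ, hsupp, hone⟩ := exists_bump (EM := EM) (huo.mem_nhds hmu)
  refine ⟨⟨fun m => χ m • s m, ContMDiffOn.smul_section_of_tsupport (u := u) hχ.contMDiffOn huo
    hsupp fun m hm => (hu m hm).contMDiffWithinAt⟩, ?_⟩
  filter_upwards [hone] with m hm
  change χ m • s m = s m
  rw [hm, one_smul]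

theorem exists_section_eq {m₀ : M} (e : E m₀) : ∃ S : Cₛ^∞⟮𝓘(ℝ, EM); F, E⟯, S m₀ = e := by
  obtain ⟨u, hu, hs⟩ := FiberBundle.exists_contMDiffOn_extend 𝓘(ℝ, EM) F (k := ∞) e
  have : ∀ᶠ m in 𝓝 m₀, ContMDiffAt 𝓘(ℝ, EM) (𝓘(ℝ, EM).prod 𝓘(ℝ, F)) ∞
      (fun x => TotalSpace.mk' F x (FiberBundle.extend F e x)) m := by
    filter_upwards [eventually_mem_nhds_iff.2 hu] with m hm
    exact hs.contMDiffAt hm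
  obtain ⟨S, hS⟩ := exists_section_eventuallyEq this
  exact ⟨S, by rw [hS.self_of_nhds]; simp⟩

omit [FiniteDimensional ℝ EM] [T2Space M] [IsManifold 𝓘(ℝ, EM) ∞ M] in
theorem contMDiffAt_trivialization_snd (S : Cₛ^∞⟮𝓘(ℝ, EM); F, E⟯) (m₀ : M) :
    ∀ᶠ m in 𝓝 m₀, ContMDiffAt 𝓘(ℝ, EM) 𝓘(ℝ, F) ∞
      (fun x => (trivializationAt F E m₀ ⟨x, S x⟩).2) m := by
  filter_upwards [(trivializationAt F E m₀).open_baseSet.mem_nhds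
    (mem_baseSet_trivializationAt F E m₀)] with m hm
  exact ((trivializationAt F E m₀).contMDiffAt_section_iff hm).1 S.contMDiff.contMDiffAt

variable [FiniteDimensional ℝ F] {n : Type*} [Fintype n]

/-- Sections that are linearly independent at `m₀` are so near `m₀`, and any section is near `m₀`
a combination of them with smooth coefficients wherever it lies in their span. -/
theorem exists_coefficient_functions (s : n → Cₛ^∞⟮𝓘(ℝ, EM); F, E⟯) {m₀ : M}
    (hs : LinearIndependent ℝ fun i => s i m₀) :
    (∀ᶠ m in 𝓝 m₀, LinearIndependent ℝ fun i => s i m) ∧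
    ∀ U : Cₛ^∞⟮𝓘(ℝ, EM); F, E⟯, ∃ c : n → M → ℝ,
      (∀ i, ContMDiff 𝓘(ℝ, EM) 𝓘(ℝ, ℝ) ∞ (c i)) ∧
      ∀ᶠ m in 𝓝 m₀, U m ∈ Submodule.span ℝ (Set.range fun i => s i m) →
        U m = ∑ i, c i m • s i m := by
  classical
  set e := trivializationAt F E m₀ with he
  have hbase : ∀ᶠ m in 𝓝 m₀, m ∈ e.baseSet :=
    e.open_baseSet.mem_nhds (mem_baseSet_trivializationAt F E m₀)
  have hlin : ∀ m (hm : m ∈ e.baseSet) (v : E m),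
      (e ⟨m, v⟩).2 = e.continuousLinearEquivAt ℝ m hm v :=
    fun m hm v => rfl
  have h₀ : LinearIndependent ℝ fun i => (e ⟨m₀, s i m₀⟩).2 := by
    simp only [hlin m₀ hbase.self_of_nhds]
    exact hs.map' (e.continuousLinearEquivAt ℝ m₀ hbase.self_of_nhds).toLinearMap
      (LinearMap.ker_eq_bot.2 (e.continuousLinearEquivAt ℝ m₀ hbase.self_of_nhds).injective)
  obtain ⟨θ, B, hB⟩ := exists_smooth_coefficients (f := fun i x => (e ⟨x, s i x⟩).2)
    (Filter.eventually_all.2 fun i => contMDiffAt_trivialization_snd (s i) m₀) h₀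
  refine ⟨?_, fun U => ?_⟩
  · filter_upwards [hB, hbase] with m hm hmb
    have := hm.2.1
    simp only [hlin m hmb] at this
    exact LinearIndependent.of_comp (e.continuousLinearEquivAt ℝ m hmb).toLinearMap this
  · have hc : ∀ i, ∃ c : M → ℝ, ContMDiff 𝓘(ℝ, EM) 𝓘(ℝ, ℝ) ∞ c ∧ ∀ᶠ m in 𝓝 m₀,
        c m = ∑ j, B m i j * θ j (e ⟨m, U m⟩).2 := fun i => by
      refine exists_smooth_function_eventuallyEq ?_
      filter_upwards [hB, contMDiffAt_trivialization_snd U m₀] with m hm hU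
      exact contMDiffAt_finsetSum fun j _ => (hm.1 i j).mul
        (((θ j).toContinuousLinearMap.contMDiff).contMDiffAt.comp m hU)
    choose c hc hc' using hc
    refine ⟨c, hc, ?_⟩
    filter_upwards [hB, hbase, Filter.eventually_all.2 hc'] with m hm hmb hcm hU
    obtain ⟨a, ha⟩ := (Submodule.mem_span_range_iff_exists_fun ℝ).1 hU
    rw [← ha]
    refine Finset.sum_congr rfl fun i _ => ?_
    rw [hcm i, hm.2.2 a i]
    congr 1
    refine Finset.sum_congr rfl fun j _ => ?_
    congr 2
    simp only [hlin m hmb, ← ha, map_sum, map_smul]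

end Sections

/-! ### Immersed submanifolds -/

section Immersion

variable {EM : Type*} [NormedAddCommGroup EM] [NormedSpace ℝ EM]
  {M : Type*} [TopologicalSpace M] [ChartedSpace EM M]
  {EP : Type*} [NormedAddCommGroup EP] [NormedSpace ℝ EP]
  {P : Type*} [TopologicalSpace P] [ChartedSpace EP P] {ι : P → M}

/-- An immersion has local smooth retractions. -/
theorem exists_local_retraction (hι : Manifold.IsImmersion 𝓘(ℝ, EP) 𝓘(ℝ, EM) ∞ ι) (p₀ : P) :
    ∃ r : M → P, r (ι p₀) = p₀ ∧ (∀ᶠ p in 𝓝 p₀, r (ι p) = p) ∧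
      ∀ᶠ m in 𝓝 (ι p₀), ContMDiffAt 𝓘(ℝ, EM) 𝓘(ℝ, EP) ∞ r m := by
  have h := hι.isImmersionAt p₀
  let q : EM → EP := fun y => (h.equiv.symm y).1
  have hq : ContMDiff 𝓘(ℝ, EM) 𝓘(ℝ, EP) ∞ q :=
    ((ContinuousLinearMap.fst ℝ EP h.complement).comp
      (h.equiv.symm : EM →L[ℝ] EP × h.complement)).contMDiff
  let r : M → P := fun m => h.domChart.symm (q (h.codChart m))
  have hw : ∀ p ∈ h.domChart.source, q (h.codChart (ι p)) = h.domChart p := by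
    intro p hp
    have ht : h.domChart p ∈ (h.domChart.extend 𝓘(ℝ, EP)).target := by
      simpa using h.domChart.map_source hp
    have h₁ := h.writtenInCharts ht
    simp only [Function.comp_apply, OpenPartialHomeomorph.extend_coe,
      OpenPartialHomeomorph.extend_coe_symm, modelWithCornersSelf_coe,
      modelWithCornersSelf_coe_symm, id_eq, h.domChart.left_inv hp] at h₁
    simp [q, h₁]
  have hr : ∀ p ∈ h.domChart.source, r (ι p) = p := fun p hp => by
    simp only [r, hw p hp, h.domChart.left_inv hp]
  refine ⟨r, hr _ h.mem_domChart_source, ?_, ?_⟩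
  · filter_upwards [h.domChart.open_source.mem_nhds h.mem_domChart_source] with p hp
    exact hr p hp
  · have hcont : ContinuousAt (fun m => q (h.codChart m)) (ι p₀) :=
      hq.continuous.continuousAt.comp (h.codChart.continuousAt h.mem_codChart_source)
    have htarget : ∀ᶠ m in 𝓝 (ι p₀), q (h.codChart m) ∈ h.domChart.target := by
      refine hcont.eventually (h.domChart.open_target.mem_nhds ?_)
      simp only [hw p₀ h.mem_domChart_source]
      exact h.domChart.map_source h.mem_domChart_source
    filter_upwards [htarget, h.codChart.open_source.mem_nhds h.mem_codChart_source] with m hm hm'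
    exact (contMDiffAt_symm_of_mem_maximalAtlas h.domChart_mem_maximalAtlas hm).comp m
      (hq.contMDiffAt.comp m (contMDiffAt_of_mem_maximalAtlas h.codChart_mem_maximalAtlas hm'))

theorem mfderiv_injective_of_isImmersion
    (hι : Manifold.IsImmersion 𝓘(ℝ, EP) 𝓘(ℝ, EM) ∞ ι)
    (hs : ContMDiff 𝓘(ℝ, EP) 𝓘(ℝ, EM) ∞ ι) (p : P) :
    Function.Injective (mfderiv 𝓘(ℝ, EP) 𝓘(ℝ, EM) ι p) := by
  obtain ⟨r, -, hrι, hr⟩ := exists_local_retraction hι p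
  have h₁ : MDifferentiableAt 𝓘(ℝ, EM) 𝓘(ℝ, EP) r (ι p) :=
    hr.self_of_nhds.mdifferentiableAt (by simp)
  have h₂ := mfderiv_comp p h₁ (hs.mdifferentiableAt (by simp))
  have h₃ : mfderiv 𝓘(ℝ, EP) 𝓘(ℝ, EP) (r ∘ ι) p = ContinuousLinearMap.id ℝ _ := by
    rw [Filter.EventuallyEq.mfderiv_eq (f₁ := r ∘ ι) (f := id) hrι, mfderiv_id]
  rw [h₃] at h₂
  intro v w hvw
  have h₄ := congrArg (fun L => L v) h₂
  have h₅ := congrArg (fun L => L w) h₂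
  simp only [ContinuousLinearMap.comp_apply] at h₄ h₅
  rw [hvw, ← h₅] at h₄
  exact h₄

/-- The derivative of a function that is constant on an immersed submanifold vanishes in the
directions tangent to the submanifold. -/
theorem dirDeriv_eq_zero_of_eventually_const (hs : ContMDiff 𝓘(ℝ, EP) 𝓘(ℝ, EM) ∞ ι)
    {f : M → ℝ} (hf : ContMDiff 𝓘(ℝ, EM) 𝓘(ℝ, ℝ) ∞ f) {p : P} {c : ℝ}
    (hfp : ∀ᶠ q in 𝓝 p, f (ι q) = c) {X : TangentSpace 𝓘(ℝ, EM) (ι p)}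
    (hX : X ∈ LinearMap.range (mfderiv 𝓘(ℝ, EP) 𝓘(ℝ, EM) ι p).toLinearMap) :
    dirDeriv f (ι p) X = 0 := by
  obtain ⟨v, rfl⟩ := hX
  have h₂ := mfderiv_comp p (hf.mdifferentiableAt (x := ι p) (by simp))
    (hs.mdifferentiableAt (x := p) (by simp))
  have h₃ : mfderiv 𝓘(ℝ, EP) 𝓘(ℝ, ℝ) (f ∘ ι) p = 0 := by
    exact ((hasMFDerivAt_const c p).congr_of_eventuallyEq hfp).mfderiv
  rw [h₃] at h₂
  exact (congrArg (fun L => L v) h₂).symm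

variable [FiniteDimensional ℝ EM] [IsManifold 𝓘(ℝ, EM) ∞ M] [T2Space M]
  {F : Type*} [NormedAddCommGroup F] [NormedSpace ℝ F]
  {E : M → Type*} [∀ m, AddCommGroup (E m)] [∀ m, Module ℝ (E m)]
  [TopologicalSpace (TotalSpace F E)] [∀ m, TopologicalSpace (E m)]
  [FiberBundle F E] [VectorBundle ℝ F E] [ContMDiffVectorBundle ∞ F E 𝓘(ℝ, EM)]

/-- A section along an immersion extends locally to a section of the ambient bundle. -/
theorem exists_section_extension (hι : Manifold.IsImmersion 𝓘(ℝ, EP) 𝓘(ℝ, EM) ∞ ι)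
    (hs : ContMDiff 𝓘(ℝ, EP) 𝓘(ℝ, EM) ∞ ι) {v : ∀ p, E (ι p)} {p₀ : P}
    (hv : ∀ᶠ p in 𝓝 p₀, ContMDiffAt 𝓘(ℝ, EP) (𝓘(ℝ, EM).prod 𝓘(ℝ, F)) ∞
      (fun x => TotalSpace.mk' F (ι x) (v x)) p) :
    ∃ U : Cₛ^∞⟮𝓘(ℝ, EM); F, E⟯, ∀ᶠ p in 𝓝 p₀, U (ι p) = v p := by
  obtain ⟨r, hr₀, hrι, hr⟩ := exists_local_retraction hι p₀
  set e := trivializationAt F E (ι p₀) with he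
  have hbase : ∀ᶠ m in 𝓝 (ι p₀), m ∈ e.baseSet :=
    e.open_baseSet.mem_nhds (mem_baseSet_trivializationAt F E (ι p₀))
  let w : P → F := fun p => (e ⟨ι p, v p⟩).2
  have hw : ∀ᶠ p in 𝓝 p₀, ContMDiffAt 𝓘(ℝ, EP) 𝓘(ℝ, F) ∞ w p := by
    filter_upwards [hv, hs.continuous.continuousAt.eventually hbase] with p hp hpb
    exact ((e.contMDiffAt_iff (IM := 𝓘(ℝ, EP)) (IB := 𝓘(ℝ, EM))
      (f := fun x => TotalSpace.mk' F (ι x) (v x)) (x₀ := p) (by simpa [e.mem_source] using hpb)).1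
      hp).2
  have hrc : ContinuousAt r (ι p₀) := hr.self_of_nhds.continuousAt
  have hr' : Filter.Tendsto r (𝓝 (ι p₀)) (𝓝 p₀) := by
    have := hrc.tendsto
    rwa [hr₀] at this
  obtain ⟨U, hU⟩ := exists_section_eventuallyEq (EM := EM) (F := F) (E := E) (m₀ := ι p₀)
    (s := fun m => e.symm m (w (r m))) (by
      filter_upwards [hr, hbase, hr'.eventually hw] with m hm hmb hmw
      refine (e.contMDiffAt_section_iff hmb).2 ?_
      refine (hmw.comp m hm).congr_of_eventuallyEq ?_
      filter_upwards [e.open_baseSet.mem_nhds hmb] with x hx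
      rw [e.apply_mk_symm hx]
      rfl)
  refine ⟨U, ?_⟩
  filter_upwards [hs.continuous.continuousAt.eventually hU,
    hs.continuous.continuousAt.eventually hbase, hrι] with p hp hpb hpr
  rw [hp, hpr]
  exact e.symm_apply_apply_mk hpb (v p)

end Immersion

/-! ### Subbundles along a map -/

section Families

open Module

variable (EM : Type*) [NormedAddCommGroup EM] [NormedSpace ℝ EM]
  {M : Type*} [TopologicalSpace M] [ChartedSpace EM M]
  (F : Type*) [NormedAddCommGroup F] [NormedSpace ℝ F]
  {E : M → Type*} [∀ m, AddCommGroup (E m)] [∀ m, Module ℝ (E m)]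
  [TopologicalSpace (TotalSpace F E)] [∀ m, TopologicalSpace (E m)]
  [FiberBundle F E] [VectorBundle ℝ F E]
  {P : Type*} [TopologicalSpace P]

/-- Every element of `L p₀` extends to a section of `E` that lies in `L` along `ι` near `p₀`. -/
def HasSectionsAt (ι : P → M) (L : ∀ p, Submodule ℝ (E (ι p))) (p₀ : P) : Prop :=
  ∀ e ∈ L p₀, ∃ s : Cₛ^∞⟮𝓘(ℝ, EM); F, E⟯, s (ι p₀) = e ∧ ∀ᶠ p in 𝓝 p₀, s (ι p) ∈ L p

/-- Near `p₀`, the family `L` is a subbundle of the pullback of `E` by `ι`. -/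
structure IsSubbundleAt (ι : P → M) (L : ∀ p, Submodule ℝ (E (ι p))) (p₀ : P) : Prop where
  hasSections : HasSectionsAt EM F ι L p₀
  rank_const : ∀ᶠ p in 𝓝 p₀, finrank ℝ (L p) = finrank ℝ (L p₀)

variable {EM} {ι : P → M}

section
include F

theorem finiteDimensional_fibre [FiniteDimensional ℝ F] (m : M) : FiniteDimensional ℝ (E m) :=
  ((trivializationAt F E m).continuousLinearEquivAt ℝ m
    (mem_baseSet_trivializationAt F E m)).symm.toLinearEquiv.finiteDimensional

theorem finrank_fibre (m : M) : finrank ℝ (E m) = finrank ℝ F :=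
  ((trivializationAt F E m).continuousLinearEquivAt ℝ m
    (mem_baseSet_trivializationAt F E m)).toLinearEquiv.finrank_eq

end

variable {F}

theorem HasSectionsAt.sup {L L' : ∀ p, Submodule ℝ (E (ι p))} {p₀ : P}
    (h : HasSectionsAt EM F ι L p₀) (h' : HasSectionsAt EM F ι L' p₀) :
    HasSectionsAt EM F ι (fun p => L p ⊔ L' p) p₀ := by
  intro e he
  obtain ⟨a, ha, b, hb, rfl⟩ := Submodule.mem_sup.1 he
  obtain ⟨s, rfl, hs'⟩ := h a ha
  obtain ⟨t, rfl, ht'⟩ := h' b hb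
  refine ⟨s + t, rfl, ?_⟩
  filter_upwards [hs', ht'] with p hp hp'
  exact Submodule.add_mem_sup hp hp'

variable [FiniteDimensional ℝ EM] [IsManifold 𝓘(ℝ, EM) ∞ M] [T2Space M]
  [ContMDiffVectorBundle ∞ F E 𝓘(ℝ, EM)] [FiniteDimensional ℝ F]

theorem HasSectionsAt.finrank_le {L : ∀ p, Submodule ℝ (E (ι p))} {p₀ : P}
    (h : HasSectionsAt EM F ι L p₀) (hι : Continuous ι) :
    ∀ᶠ p in 𝓝 p₀, finrank ℝ (L p₀) ≤ finrank ℝ (L p) := by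
  have := fun m => finiteDimensional_fibre F (E := E) m
  let b := finBasis ℝ (L p₀)
  choose s hs hsL using fun i => h (b i) (b i).2
  have hli : LinearIndependent ℝ fun i => s i (ι p₀) := by
    simp only [hs]
    exact b.linearIndependent.map' (L p₀).subtype (Submodule.ker_subtype _)
  filter_upwards [hι.continuousAt.eventually (exists_coefficient_functions s hli).1,
    Filter.eventually_all.2 hsL] with p hp hpL
  have h₁ : LinearIndependent ℝ fun i => (⟨s i (ι p), hpL i⟩ : L p) :=
    LinearIndependent.of_comp (L p).subtype hp
  simpa using h₁.fintype_card_le_finrank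

theorem eventually_span_eq {n : Type*} [Fintype n] {L : ∀ p, Submodule ℝ (E (ι p))} {p₀ : P}
    (hι : Continuous ι) {s : n → Cₛ^∞⟮𝓘(ℝ, EM); F, E⟯}
    (hli : LinearIndependent ℝ fun i => s i (ι p₀))
    (hs : ∀ i, ∀ᶠ p in 𝓝 p₀, s i (ι p) ∈ L p) (hcard : Fintype.card n = finrank ℝ (L p₀))
    (hrank : ∀ᶠ p in 𝓝 p₀, finrank ℝ (L p) = finrank ℝ (L p₀)) :
    ∀ᶠ p in 𝓝 p₀, Submodule.span ℝ (Set.range fun i => s i (ι p)) = L p := by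
  have := fun m => finiteDimensional_fibre F (E := E) m
  filter_upwards [hι.continuousAt.eventually (exists_coefficient_functions s hli).1,
    Filter.eventually_all.2 hs, hrank] with p hp hpL hpr
  refine Submodule.eq_of_le_of_finrank_eq (Submodule.span_le.2 ?_) ?_
  · rintro _ ⟨i, rfl⟩
    exact hpL i
  · rw [finrank_span_eq_card hp, hcard, hpr]

theorem IsSubbundleAt.exists_frame {L : ∀ p, Submodule ℝ (E (ι p))} {p₀ : P}
    (h : IsSubbundleAt EM F ι L p₀) (hι : Continuous ι) :
    ∃ s : Fin (finrank ℝ (L p₀)) → Cₛ^∞⟮𝓘(ℝ, EM); F, E⟯,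
      (LinearIndependent ℝ fun i => s i (ι p₀)) ∧
      (∀ i, ∀ᶠ p in 𝓝 p₀, s i (ι p) ∈ L p) ∧
      ∀ᶠ p in 𝓝 p₀, Submodule.span ℝ (Set.range fun i => s i (ι p)) = L p := by
  have := fun m => finiteDimensional_fibre F (E := E) m
  let b := finBasis ℝ (L p₀)
  choose s hs hsL using fun i => h.hasSections (b i) (b i).2
  have hli : LinearIndependent ℝ fun i => s i (ι p₀) := by
    simp only [hs]
    exact b.linearIndependent.map' (L p₀).subtype (Submodule.ker_subtype _)
  exact ⟨s, hli, hsL, eventually_span_eq hι hli hsL (by simp) h.rank_const⟩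

/-- A section along `ι` that takes values in a subbundle of `E` coincides along `ι` with a section
of this subbundle. -/
theorem IsSubbundleAt.exists_section_mem {L : ∀ m, Submodule ℝ (E m)} {p₀ : P}
    (h : IsSubbundleAt EM F id L (ι p₀)) (hι : Continuous ι) {U : Cₛ^∞⟮𝓘(ℝ, EM); F, E⟯}
    (hU : ∀ᶠ p in 𝓝 p₀, U (ι p) ∈ L (ι p)) :
    ∃ U' : Cₛ^∞⟮𝓘(ℝ, EM); F, E⟯, (∀ m, U' m ∈ L m) ∧ ∀ᶠ p in 𝓝 p₀, U' (ι p) = U (ι p) := by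
  obtain ⟨s, hli, hsL, hspan⟩ := h.exists_frame continuous_id
  obtain ⟨c, hc, hcU⟩ := (exists_coefficient_functions s hli).2 U
  obtain ⟨χ, hχ, hsupp, hone⟩ := exists_bump (EM := EM) (Filter.eventually_all.2 hsL)
  refine ⟨∑ i, mulSection (fun m => χ m * c i m) (hχ.mul (hc i)) (s i), fun m => ?_, ?_⟩
  · simp only [sum_section_apply, mulSection_apply, mul_smul]
    rw [← Finset.smul_sum]
    by_cases hm : χ m = 0
    · simp [hm]
    · exact (L m).smul_mem _ (Submodule.sum_mem _ fun i _ => (L m).smul_mem _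
        (hsupp (subset_tsupport _ hm) i))
  · filter_upwards [hι.continuousAt.eventually hcU, hι.continuousAt.eventually hspan,
      hι.continuousAt.eventually hone, hU] with p h₁ h₂ h₃ h₄
    simp only [sum_section_apply, mulSection_apply, h₃, one_mul]
    refine (h₁ ?_).symm
    exact h₂.ge h₄

/-- A section with values in a sum of two families of constant rank splits smoothly. -/
theorem HasSectionsAt.exists_split {L L' : ∀ p, Submodule ℝ (E (ι p))} {p₀ : P}
    (h : HasSectionsAt EM F ι L p₀) (h' : HasSectionsAt EM F ι L' p₀) (hι : Continuous ι)
    (hrank : ∀ᶠ p in 𝓝 p₀, finrank ℝ ↥(L p ⊔ L' p) = finrank ℝ ↥(L p₀ ⊔ L' p₀))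
    {U : Cₛ^∞⟮𝓘(ℝ, EM); F, E⟯} (hU : ∀ᶠ p in 𝓝 p₀, U (ι p) ∈ L p ⊔ L' p) :
    ∃ U₁ U₂ : Cₛ^∞⟮𝓘(ℝ, EM); F, E⟯, (∀ᶠ p in 𝓝 p₀, U₁ (ι p) ∈ L p) ∧
      (∀ᶠ p in 𝓝 p₀, U₂ (ι p) ∈ L' p) ∧ ∀ᶠ p in 𝓝 p₀, U (ι p) = U₁ (ι p) + U₂ (ι p) := by
  classical
  have := fun m => finiteDimensional_fibre F (E := E) m
  obtain ⟨b, hbS, hbspan, hbli⟩ :=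
    exists_linearIndependent ℝ ((L p₀ : Set (E (ι p₀))) ∪ L' p₀)
  have : Fintype b := hbli.setFinite.fintype
  have hspan : Submodule.span ℝ b = L p₀ ⊔ L' p₀ := by
    rw [hbspan, Submodule.span_union, Submodule.span_eq, Submodule.span_eq]
  have hsec : ∀ x : b, ∃ s : Cₛ^∞⟮𝓘(ℝ, EM); F, E⟯, s (ι p₀) = x ∧
      if (x : E (ι p₀)) ∈ L p₀ then ∀ᶠ p in 𝓝 p₀, s (ι p) ∈ L p
      else ∀ᶠ p in 𝓝 p₀, s (ι p) ∈ L' p := by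
    intro x
    by_cases hx : (x : E (ι p₀)) ∈ L p₀
    · simpa only [hx, if_true] using h x hx
    · simpa only [hx, if_false] using h' x ((hbS x.2).resolve_left hx)
  choose s hs hsL using hsec
  have hli : LinearIndependent ℝ fun x => s x (ι p₀) := by
    simpa only [hs] using hbli
  have hmem : ∀ x, ∀ᶠ p in 𝓝 p₀, s x (ι p) ∈ L p ⊔ L' p := by
    intro x
    have := hsL x
    split_ifs at this
    · exact this.mono fun p hp => Submodule.mem_sup_left hp
    · exact this.mono fun p hp => Submodule.mem_sup_right hp
  have hsp := eventually_span_eq (L := fun p => L p ⊔ L' p) hι hli hmem (by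
    rw [← hspan, finrank_span_set_eq_card hbli, Set.toFinset_card]) hrank
  obtain ⟨c, hc, hcU⟩ := (exists_coefficient_functions s hli).2 U
  refine ⟨∑ x ∈ Finset.univ.filter fun x : b => (x : E (ι p₀)) ∈ L p₀, mulSection (c x) (hc x) (s x),
    ∑ x ∈ Finset.univ.filter fun x : b => ¬ (x : E (ι p₀)) ∈ L p₀, mulSection (c x) (hc x) (s x), ?_, ?_, ?_⟩
  · filter_upwards [Filter.eventually_all.2 fun x : {x : b // (x : E (ι p₀)) ∈ L p₀} =>
      (show ∀ᶠ p in 𝓝 p₀, s x (ι p) ∈ L p by simpa only [x.2, if_true] using hsL x.1)] with p hp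
    simp only [sum_section_apply, mulSection_apply]
    exact Submodule.sum_mem _ fun x hx => (L p).smul_mem _ (hp ⟨x, (Finset.mem_filter.1 hx).2⟩)
  · filter_upwards [Filter.eventually_all.2 fun x : {x : b // ¬ (x : E (ι p₀)) ∈ L p₀} =>
      (show ∀ᶠ p in 𝓝 p₀, s x (ι p) ∈ L' p by simpa only [x.2, if_false] using hsL x.1)] with p hp
    simp only [sum_section_apply, mulSection_apply]
    exact Submodule.sum_mem _ fun x hx => (L' p).smul_mem _ (hp ⟨x, (Finset.mem_filter.1 hx).2⟩)
  · filter_upwards [hι.continuousAt.eventually hcU, hsp, hU] with p h₁ h₂ h₃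
    simp only [sum_section_apply, mulSection_apply]
    rw [Finset.sum_filter_add_sum_filter_not]
    refine h₁ ?_
    rwa [h₂]

variable (𝒞 : CourantAlgebroid EM M F E)

/-- A vector orthogonal to the values of independent sections extends to a section orthogonal to
these sections. -/
theorem exists_section_orthogonal {n : Type*} [Fintype n] {s : n → Cₛ^∞⟮𝓘(ℝ, EM); F, E⟯} {m₀ : M}
    (hli : LinearIndependent ℝ fun i => s i m₀) {e : E m₀}
    (he : ∀ i, 𝒞.form m₀ (s i m₀) e = 0) :
    ∃ X : Cₛ^∞⟮𝓘(ℝ, EM); F, E⟯, X m₀ = e ∧ ∀ᶠ m in 𝓝 m₀, ∀ i, 𝒞.form m (s i m) (X m) = 0 := by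
  classical
  have := fun m => finiteDimensional_fibre F (E := E) m
  obtain ⟨θ, hθ⟩ := exists_dual_family hli
  have ht : ∀ j, ∃ t : Cₛ^∞⟮𝓘(ℝ, EM); F, E⟯, ∀ i, 𝒞.form m₀ (s i m₀) (t m₀) =
      (1 : Matrix n n ℝ) j i := by
    intro j
    obtain ⟨t, ht⟩ := exists_section_eq (EM := EM) (F := F)
      (((𝒞.form m₀).toDual (𝒞.form_nondegenerate m₀)).symm (θ j))
    refine ⟨t, fun i => ?_⟩
    rw [ht, ← hθ i j, (𝒞.form_symm m₀).eq, LinearMap.BilinForm.apply_toDual_symm_apply]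
  choose t ht using ht
  let A : M → Matrix n n ℝ := fun m => Matrix.of fun i j => 𝒞.form m (s i m) (t j m)
  have hA : ∀ m, ∀ i j, ContMDiffAt 𝓘(ℝ, EM) 𝓘(ℝ, ℝ) ∞ (fun y => A y i j) m := fun m i j =>
    (𝒞.form_smooth (s i) (t j)).contMDiffAt
  have hA₀ : A m₀ = 1 := by
    ext i j
    simpa [A, Matrix.one_apply, eq_comm] using ht j i
  have hdet : ∀ᶠ m in 𝓝 m₀, (A m).det ≠ 0 := by
    refine (contMDiffAt_det (hA m₀)).continuousAt.eventually_ne ?_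
    simp [hA₀]
  obtain ⟨x, hx⟩ := exists_section_eq (EM := EM) (F := F) e
  have hc : ∀ j, ∃ c : M → ℝ, ContMDiff 𝓘(ℝ, EM) 𝓘(ℝ, ℝ) ∞ c ∧ ∀ᶠ m in 𝓝 m₀,
      c m = (A m)⁻¹.mulVec (fun i => 𝒞.form m (s i m) (x m)) j := fun j => by
    refine exists_smooth_function_eventuallyEq ?_
    filter_upwards [hdet] with m hm
    exact contMDiffAt_finsetSum fun i _ => (contMDiffAt_matrix_inv (hA m) hm j i).mul
      (𝒞.form_smooth (s i) x).contMDiffAt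
  choose c hc hc' using hc
  refine ⟨x - ∑ j, mulSection (c j) (hc j) (t j), ?_, ?_⟩
  · have : ∀ j, c j m₀ = 0 := fun j => by
      rw [(hc' j).self_of_nhds, hx]
      simp [he, Matrix.mulVec, dotProduct]
    rw [ContMDiffSection.coe_sub, Pi.sub_apply, sum_section_apply]
    simp [this, hx]
  · filter_upwards [hdet, Filter.eventually_all.2 hc'] with m hm hcm i
    rw [ContMDiffSection.coe_sub, Pi.sub_apply, sum_section_apply]
    simp only [mulSection_apply, map_sub, map_sum, map_smul, smul_eq_mul]
    have h₁ : ∑ j, c j m * 𝒞.form m (s i m) (t j m) =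
        (A m).mulVec ((A m)⁻¹.mulVec fun i => 𝒞.form m (s i m) (x m)) i := by
      simp only [Matrix.mulVec, dotProduct, A, Matrix.of_apply]
      refine Finset.sum_congr rfl fun j _ => ?_
      rw [hcm j, mul_comm]
      rfl
    rw [h₁, Matrix.mulVec_mulVec, Matrix.mul_nonsing_inv _ (isUnit_iff_ne_zero.2 hm),
      Matrix.one_mulVec, sub_self]

theorem IsSubbundleAt.orthogonal {L : ∀ p, Submodule ℝ (E (ι p))} {p₀ : P}
    (h : IsSubbundleAt EM F ι L p₀) (hι : Continuous ι) :
    IsSubbundleAt EM F ι (fun p => (𝒞.form (ι p)).orthogonal (L p)) p₀ := by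
  have := fun m => finiteDimensional_fibre F (E := E) m
  obtain ⟨s, hli, hsL, hspan⟩ := h.exists_frame hι
  refine ⟨fun e he => ?_, ?_⟩
  · obtain ⟨X, hX, hX'⟩ := exists_section_orthogonal 𝒞 hli
      (fun i => form_eq_zero_of_mem_orthogonal he ((hsL i).self_of_nhds))
    refine ⟨X, hX, ?_⟩
    filter_upwards [hspan, hι.continuousAt.eventually hX'] with p hp hp'
    rw [← hp]
    intro y hy
    have : Submodule.span ℝ (Set.range fun i => s i (ι p)) ≤
        LinearMap.ker ((𝒞.form (ι p)).flip (X (ι p))) := by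
      rw [Submodule.span_le]
      rintro _ ⟨i, rfl⟩
      exact hp' i
    exact this hy
  · filter_upwards [h.rank_const] with p hp
    rw [LinearMap.BilinForm.finrank_orthogonal (𝒞.form_nondegenerate _),
      LinearMap.BilinForm.finrank_orthogonal (𝒞.form_nondegenerate _), hp,
      finrank_fibre F (E := E), finrank_fibre F (E := E)]

end Families

/-! ### Directional derivatives -/

section DirDeriv

variable {EM : Type*} [NormedAddCommGroup EM] [NormedSpace ℝ EM]
  {M : Type*} [TopologicalSpace M] [ChartedSpace EM M]

theorem dirDeriv_congr {f g : M → ℝ} {m : M} (h : ∀ᶠ x in 𝓝 m, f x = g x)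
    (X : TangentSpace 𝓘(ℝ, EM) m) : dirDeriv f m X = dirDeriv g m X := by
  rw [dirDeriv, dirDeriv, Filter.EventuallyEq.mfderiv_eq (f₁ := f) (f := g) h]
  rfl

theorem dirDeriv_mul {f g : M → ℝ} {m : M} (hf : MDifferentiableAt 𝓘(ℝ, EM) 𝓘(ℝ, ℝ) f m)
    (hg : MDifferentiableAt 𝓘(ℝ, EM) 𝓘(ℝ, ℝ) g m) (X : TangentSpace 𝓘(ℝ, EM) m) :
    dirDeriv (fun x => f x * g x) m X = f m * dirDeriv g m X + g m * dirDeriv f m X := by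
  have := (hf.hasMFDerivAt.mul hg.hasMFDerivAt).mfderiv
  exact congrArg (fun L => L X) this

theorem dirDeriv_add {f g : M → ℝ} {m : M} (hf : MDifferentiableAt 𝓘(ℝ, EM) 𝓘(ℝ, ℝ) f m)
    (hg : MDifferentiableAt 𝓘(ℝ, EM) 𝓘(ℝ, ℝ) g m) (X : TangentSpace 𝓘(ℝ, EM) m) :
    dirDeriv (fun x => f x + g x) m X = dirDeriv f m X + dirDeriv g m X := by
  have := (hf.hasMFDerivAt.add hg.hasMFDerivAt).mfderiv
  exact congrArg (fun L => L X) this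

theorem dirDeriv_sum {n : Type*} (t : Finset n) {f : n → M → ℝ} {m : M}
    (hf : ∀ i, MDifferentiableAt 𝓘(ℝ, EM) 𝓘(ℝ, ℝ) (f i) m) (X : TangentSpace 𝓘(ℝ, EM) m) :
    dirDeriv (fun x => ∑ i ∈ t, f i x) m X = ∑ i ∈ t, dirDeriv (f i) m X := by
  classical
  have hs : ∀ t : Finset n, MDifferentiableAt 𝓘(ℝ, EM) 𝓘(ℝ, ℝ) (fun x => ∑ i ∈ t, f i x) m ∧
      dirDeriv (fun x => ∑ i ∈ t, f i x) m X = ∑ i ∈ t, dirDeriv (f i) m X := by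
    intro t
    induction t using Finset.induction_on with
    | empty =>
      simp only [Finset.sum_empty]
      have h := (hasMFDerivAt_const (I := 𝓘(ℝ, EM)) (I' := 𝓘(ℝ, ℝ)) (0 : ℝ) m).mfderiv
      exact ⟨mdifferentiableAt_const, congrArg (fun L => L X) h⟩
    | insert i t hi ih =>
      simp only [Finset.sum_insert hi]
      exact ⟨(hf i).add ih.1, by rw [dirDeriv_add (hf i) ih.1, ih.2]⟩
  exact (hs t).2

variable [IsManifold 𝓘(ℝ, EM) ∞ M]

/-- A map whose derivative vanishes near a point is constant near this point. -/
theorem eventually_eq_of_mfderiv_eq_zero {W : Type*} [NormedAddCommGroup W] [NormedSpace ℝ W]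
    {f : M → W} {m₀ : M}
    (hf : ∀ᶠ m in 𝓝 m₀, HasMFDerivAt 𝓘(ℝ, EM) 𝓘(ℝ, W) f m (0 : EM →L[ℝ] W)) :
    ∀ᶠ m in 𝓝 m₀, f m = f m₀ := by
  set c := chartAt EM m₀
  have hc₀ : m₀ ∈ c.source := mem_chart_source EM m₀
  have hsymm : Filter.Tendsto c.symm (𝓝 (c m₀)) (𝓝 m₀) := by
    have := c.continuousAt_symm (c.map_source hc₀)
    rwa [ContinuousAt, c.left_inv hc₀] at this
  have key : ∀ᶠ y in 𝓝 (c m₀), HasFDerivAt (f ∘ c.symm) (0 : EM →L[ℝ] W) y := by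
    filter_upwards [hsymm.eventually hf, c.open_target.mem_nhds (c.map_source hc₀)] with y hy hyt
    have h₁ : MDifferentiableAt 𝓘(ℝ, EM) 𝓘(ℝ, EM) c.symm y :=
      (contMDiffAt_symm_of_mem_maximalAtlas (I := 𝓘(ℝ, EM)) (n := ∞)
        (IsManifold.chart_mem_maximalAtlas m₀) hyt).mdifferentiableAt (by simp)
    exact (hy.comp y h₁.hasMFDerivAt).hasFDerivAt.congr_fderiv (by ext; rfl)
  obtain ⟨r, hr, hball⟩ := Metric.eventually_nhds_iff_ball.1 key
  filter_upwards [c.open_source.mem_nhds hc₀,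
    (c.continuousAt hc₀).eventually (Metric.ball_mem_nhds _ hr)] with m hm hmb
  have := (convex_ball (c m₀) r).is_const_of_fderivWithin_eq_zero (𝕜 := ℝ) (f := f ∘ c.symm)
    (fun y hy => (hball y hy).differentiableAt.differentiableWithinAt)
    (fun y hy => by
      rw [fderivWithin_of_isOpen Metric.isOpen_ball hy, (hball y hy).fderiv])
    hmb (Metric.mem_ball_self hr)
  simpa [c.left_inv hm, c.left_inv hc₀] using this

theorem eventually_eq_of_dirDeriv_eq_zero {f : M → ℝ} {m₀ : M}
    (hf : ∀ᶠ m in 𝓝 m₀, MDifferentiableAt 𝓘(ℝ, EM) 𝓘(ℝ, ℝ) f m)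
    (hd : ∀ᶠ m in 𝓝 m₀, ∀ X : TangentSpace 𝓘(ℝ, EM) m, dirDeriv f m X = 0) :
    ∀ᶠ m in 𝓝 m₀, f m = f m₀ := by
  refine eventually_eq_of_mfderiv_eq_zero (EM := EM) ?_
  filter_upwards [hf, hd] with m hm hmd
  have h : mfderiv 𝓘(ℝ, EM) 𝓘(ℝ, ℝ) f m = 0 := by
    ext X
    exact hmd X
  have h' := hm.hasMFDerivAt
  rw [h] at h'
  exact h'

end DirDeriv

/-! ### Left derivatives on a Lie group -/

section LeftDerivative

variable {EG : Type*} [NormedAddCommGroup EG] [NormedSpace ℝ EG]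
  {G : Type*} [TopologicalSpace G] [ChartedSpace EG G] [Group G] [LieGroup 𝓘(ℝ, EG) ∞ G]

theorem mdifferentiableAt_comp_mul_left {f : G → ℝ} {g : G}
    (hf : MDifferentiableAt 𝓘(ℝ, EG) 𝓘(ℝ, ℝ) f g) :
    MDifferentiableAt 𝓘(ℝ, EG) 𝓘(ℝ, ℝ) (fun h => f (g * h)) 1 := by
  have h₁ : MDifferentiableAt 𝓘(ℝ, EG) 𝓘(ℝ, EG) (fun h : G => g * h) 1 :=
    (contMDiff_mul_left (I := 𝓘(ℝ, EG)) (n := ∞)).mdifferentiableAt (by simp)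
  exact MDifferentiableAt.comp (1 : G) (by simpa using hf) h₁

theorem eventually_eq_of_left_deriv_eq_zero {f : G → ℝ} {g₀ : G}
    (hf : ∀ᶠ g in 𝓝 g₀, MDifferentiableAt 𝓘(ℝ, EG) 𝓘(ℝ, ℝ) f g)
    (hd : ∀ᶠ g in 𝓝 g₀, ∀ X : GroupLieAlgebra 𝓘(ℝ, EG) G,
      dirDeriv (fun h => f (g * h)) 1 X = 0) :
    ∀ᶠ g in 𝓝 g₀, f g = f g₀ := by
  have : IsManifold 𝓘(ℝ, EG) ∞ G := ContMDiffMul.toIsManifold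
  refine eventually_eq_of_dirDeriv_eq_zero hf ?_
  filter_upwards [hf, hd] with g hg hgd X
  have h₁ : MDifferentiableAt 𝓘(ℝ, EG) 𝓘(ℝ, EG) (fun h : G => g⁻¹ * h) g :=
    (contMDiff_mul_left (I := 𝓘(ℝ, EG)) (n := ∞)).mdifferentiableAt (by simp)
  have h₂ := mfderiv_comp_of_eq (mdifferentiableAt_comp_mul_left hg) h₁ (inv_mul_cancel g)
  have h₃ : (fun h => f (g * h)) ∘ (fun h => g⁻¹ * h) = f := by
    funext h
    simp
  rw [h₃] at h₂
  have h₄ : ∀ k : G, k = 1 → ∀ Y : TangentSpace 𝓘(ℝ, EG) k,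
      dirDeriv (fun h => f (g * h)) k Y = 0 := by
    rintro _ rfl Y
    exact hgd Y
  rw [dirDeriv, h₂]
  exact h₄ _ (inv_mul_cancel g) _

variable {V : Type*} [AddCommGroup V] [Module ℝ V] [FiniteDimensional ℝ V]
  {n : Type*} [Fintype n]

/-- If the derivatives of a moving frame lie in the space spanned by the frame, then this space is
constant. -/
theorem eventually_span_eq_of_left_deriv {f : n → G → V} {g₀ : G}
    (hf : ∀ i (φ : Module.Dual ℝ V), ContMDiff 𝓘(ℝ, EG) 𝓘(ℝ, ℝ) ∞ fun g => φ (f i g))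
    (hli : LinearIndependent ℝ fun i => f i g₀)
    (hd : ∀ᶠ g in 𝓝 g₀, (LinearIndependent ℝ fun i => f i g) →
      ∀ i (X : GroupLieAlgebra 𝓘(ℝ, EG) G), ∃ v ∈ Submodule.span ℝ (Set.range fun i => f i g),
        ∀ φ : Module.Dual ℝ V, dirDeriv (fun h => φ (f i (g * h))) 1 X = φ v) :
    ∀ᶠ g in 𝓝 g₀, (LinearIndependent ℝ fun i => f i g) ∧
      Submodule.span ℝ (Set.range fun i => f i g) =
        Submodule.span ℝ (Set.range fun i => f i g₀) := by
  classical
  set W₀ := Submodule.span ℝ (Set.range fun i => f i g₀) with hW₀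
  obtain ⟨θ, hθ⟩ := exists_dual_family hli
  let A : G → Matrix n n ℝ := fun g => Matrix.of fun j i => θ j (f i g)
  have hA : ∀ g, ∀ j i, ContMDiffAt 𝓘(ℝ, EG) 𝓘(ℝ, ℝ) ∞ (fun y => A y j i) g :=
    fun g j i => (hf i (θ j)).contMDiffAt
  have hA₀ : A g₀ = 1 := by
    ext j i
    exact hθ i j
  have hdet : ∀ᶠ g in 𝓝 g₀, (A g).det ≠ 0 := by
    refine (contMDiffAt_det (hA g₀)).continuousAt.eventually_ne ?_
    simp [hA₀]
  have hli' : ∀ g, (A g).det ≠ 0 → LinearIndependent ℝ fun i => f i g := by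
    intro g hg
    rw [Fintype.linearIndependent_iff]
    intro a ha
    have h₁ : (A g).mulVec a = 0 := by
      ext j
      have := congrArg (θ j) ha
      simpa [A, Matrix.mulVec, dotProduct, mul_comm] using this
    exact congrFun (Matrix.eq_zero_of_mulVec_eq_zero hg h₁)
  have key : ∀ ψ : Module.Dual ℝ V, (∀ v ∈ W₀, ψ v = 0) →
      ∀ᶠ g in 𝓝 g₀, ∀ i, ψ (f i g) = 0 := by
    intro ψ hψ
    let y : n → G → ℝ := fun j g => ∑ i, ψ (f i g) * (A g)⁻¹ i j
    have hy : ∀ g, (A g).det ≠ 0 → ∀ j, MDifferentiableAt 𝓘(ℝ, EG) 𝓘(ℝ, ℝ) (y j) g :=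
      fun g hg j => (contMDiffAt_finsetSum (n := ∞) fun i _ => (hf i ψ).contMDiffAt.mul
        (contMDiffAt_matrix_inv (hA g) hg i j)).mdifferentiableAt (by simp)
    have hyA : ∀ g, (A g).det ≠ 0 → ∀ i, ψ (f i g) = ∑ j, y j g * A g j i := by
      intro g hg i
      have h₁ : Matrix.vecMul (Matrix.vecMul (fun i => ψ (f i g)) (A g)⁻¹) (A g) =
          fun i => ψ (f i g) := by
        rw [Matrix.vecMul_vecMul, Matrix.nonsing_inv_mul _ (isUnit_iff_ne_zero.2 hg),
          Matrix.vecMul_one]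
      exact (congrFun h₁ i).symm
    have hy₀ : ∀ j, y j g₀ = 0 := fun j => Finset.sum_eq_zero fun i _ => by
      rw [hψ _ (Submodule.subset_span ⟨i, rfl⟩), zero_mul]
    have hyc : ∀ j, ∀ᶠ g in 𝓝 g₀, y j g = y j g₀ := by
      intro j
      refine eventually_eq_of_left_deriv_eq_zero (hdet.mono fun g hg => hy g hg j) ?_
      filter_upwards [hdet.eventually_nhds, hd] with g hg hgd X
      have hg' := hg.self_of_nhds
      suffices h : Matrix.vecMul (fun j => dirDeriv (fun h => y j (g * h)) 1 X) (A g) = 0 from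
        congrFun (Matrix.eq_zero_of_vecMul_eq_zero hg' h) j
      ext i
      obtain ⟨v, hv, hvd⟩ := hgd (hli' g hg') i X
      have hcont : Filter.Tendsto (fun h : G => g * h) (𝓝 1) (𝓝 g) := by
        have : ContinuousAt (fun h : G => g * h) 1 :=
          (contMDiff_mul_left (I := 𝓘(ℝ, EG)) (n := ∞)).continuous.continuousAt
        simpa [ContinuousAt] using this
      have hyd : ∀ j, MDifferentiableAt 𝓘(ℝ, EG) 𝓘(ℝ, ℝ) (fun h => y j (g * h)) 1 := fun j =>
        mdifferentiableAt_comp_mul_left (hy g hg' j)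
      have hAd : ∀ j, MDifferentiableAt 𝓘(ℝ, EG) 𝓘(ℝ, ℝ) (fun h => A (g * h) j i) 1 := fun j =>
        mdifferentiableAt_comp_mul_left ((hA g j i).mdifferentiableAt (by simp))
      have h₁ : dirDeriv (fun h => ψ (f i (g * h))) 1 X =
          ∑ j, (y j g * θ j v + A g j i * dirDeriv (fun h => y j (g * h)) 1 X) := by
        rw [dirDeriv_congr (g := fun h => ∑ j, y j (g * h) * A (g * h) j i)
          ((hcont.eventually hg).mono fun h hh => hyA _ hh i),
          dirDeriv_sum (f := fun j h => y j (g * h) * A (g * h) j i) _ fun j => (hyd j).mul (hAd j)]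
        refine Finset.sum_congr rfl fun j _ => ?_
        rw [dirDeriv_mul (hyd j) (hAd j), mul_one, ← hvd (θ j)]
        rfl
      have h₂ : Submodule.span ℝ (Set.range fun i => f i g) ≤
          LinearMap.ker (ψ - ∑ j, y j g • θ j) := by
        rw [Submodule.span_le]
        rintro _ ⟨i, rfl⟩
        simp [hyA g hg' i, A]
      have h₃ : ψ v = ∑ j, y j g * θ j v := by
        have := h₂ hv
        simpa [sub_eq_zero] using this
      rw [hvd ψ, h₃, Finset.sum_add_distrib, left_eq_add] at h₁
      simpa [Matrix.vecMul, dotProduct, mul_comm] using h₁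
    filter_upwards [hdet, Filter.eventually_all.2 hyc] with g hg hgy i
    rw [hyA g hg i]
    exact Finset.sum_eq_zero fun j _ => by rw [hgy j, hy₀ j, zero_mul]
  let b := Module.finBasis ℝ (V ⧸ W₀)
  filter_upwards [hdet, Filter.eventually_all.2 fun k => key (b.coord k ∘ₗ W₀.mkQ)
    fun v hv => by
      rw [LinearMap.comp_apply, Submodule.mkQ_apply, (Submodule.Quotient.mk_eq_zero W₀).2 hv,
        map_zero]] with g hg hgk
  refine ⟨hli' g hg, Submodule.eq_of_le_of_finrank_eq (Submodule.span_le.2 ?_) ?_⟩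
  · rintro _ ⟨i, rfl⟩
    refine (Submodule.Quotient.mk_eq_zero W₀).1 (b.ext_elem fun k => ?_)
    simpa using hgk k i
  · rw [hW₀, finrank_span_eq_card (hli' g hg), finrank_span_eq_card hli]

end LeftDerivative

/-! ### The action of the group on sections -/

namespace ExtendedAction

section Translate

variable {EG : Type*} [NormedAddCommGroup EG] [NormedSpace ℝ EG]
  {G : Type*} [TopologicalSpace G] [ChartedSpace EG G] [Group G]
  {EM : Type*} [NormedAddCommGroup EM] [NormedSpace ℝ EM]
  {M : Type*} [TopologicalSpace M] [ChartedSpace EM M] [IsManifold 𝓘(ℝ, EM) ∞ M]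
  {F : Type*} [NormedAddCommGroup F] [NormedSpace ℝ F]
  {E : M → Type*} [∀ m, AddCommGroup (E m)] [∀ m, Module ℝ (E m)]
  [TopologicalSpace (TotalSpace F E)] [∀ m, TopologicalSpace (E m)]
  [FiberBundle F E] [VectorBundle ℝ F E] [ContMDiffVectorBundle ∞ F E 𝓘(ℝ, EM)]
  [MulAction G M]
  {𝒞 : CourantAlgebroid EM M F E}
  {𝔞 : Type*} [AddCommGroup 𝔞] [Module ℝ 𝔞] {𝒜 : ExactCourantAlgebra EG G 𝔞}
  (ρ : ExtendedAction 𝒞 𝒜)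

theorem act_inv_act {g : G} {m m' : M} (h : g • m = m') (h' : g⁻¹ • m' = m) (v : E m) :
    ρ.act g⁻¹ h' (ρ.act g h v) = v := by
  have key : ∀ (k : G) (hk : k • m = m), k = 1 → ρ.act k hk v = v := by
    rintro _ hk rfl
    exact ρ.act_one hk v
  rw [← ρ.act_mul g⁻¹ g h h' (by rw [inv_mul_cancel, one_smul])]
  exact key _ _ (inv_mul_cancel g)

theorem act_injective {g : G} {m m' : M} (h : g • m = m') : Function.Injective (ρ.act g h) :=
  Function.LeftInverse.injective (ρ.act_inv_act h (by rw [← h, inv_smul_smul]))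

/-- The translate `(g · s)(m) = g · s(g⁻¹ m)` of the section `s`. -/
def translate (s : ∀ m, E m) (g : G) (m : M) : E m :=
  ρ.act g (smul_inv_smul g m) (s (g⁻¹ • m))

theorem act_eq_translate (s : ∀ m, E m) {g : G} {m m' : M} (h : g • m = m') :
    ρ.act g h (s m) = ρ.translate s g m' := by
  have key : ∀ (m₁ : M) (h₁ : g • m₁ = m'), m₁ = m → ρ.act g h₁ (s m₁) = ρ.act g h (s m) := by
    rintro _ h₁ rfl
    rfl
  exact (key _ _ (by rw [← h, inv_smul_smul])).symm

theorem translate_mul (s : ∀ m, E m) (g h : G) (m : M) :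
    ρ.translate s (g * h) m =
      ρ.act g (smul_inv_smul g m) (ρ.translate s h (g⁻¹ • m)) := by
  rw [← ρ.act_eq_translate s (m := h⁻¹ • g⁻¹ • m) (by simp [mul_smul]), translate]
  exact ρ.act_mul _ _ _ _ _ _

theorem translate_one (s : ∀ m, E m) (m : M) : ρ.translate s 1 m = s m := by
  rw [← ρ.act_eq_translate s (one_smul G m), ρ.act_one]

theorem left_deriv_translate (a : 𝔞) (s : Cₛ^∞⟮𝓘(ℝ, EM); F, E⟯) (g : G) (m : M)
    (φ : Module.Dual ℝ (E m)) :
    dirDeriv (EM := EG) (fun h : G => φ (ρ.translate s (g * h) m)) 1 (𝒜.proj a) =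
      φ (ρ.translate (𝒞.bracket (ρ.rho a) s) g m) := by
  simp only [ρ.translate_mul s g]
  exact ρ.act_deriv a s (g⁻¹ • m) (φ ∘ₗ ρ.act g (smul_inv_smul g m))

variable [LieGroup 𝓘(ℝ, EG) ∞ G] [ContMDiffSMul 𝓘(ℝ, EG) 𝓘(ℝ, EM) ∞ G M] [FiniteDimensional ℝ F]

theorem contMDiff_translate (s : Cₛ^∞⟮𝓘(ℝ, EM); F, E⟯) (m : M) (φ : Module.Dual ℝ (E m)) :
    ContMDiff 𝓘(ℝ, EG) 𝓘(ℝ, ℝ) ∞ fun g : G => φ (ρ.translate s g m) := by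
  have h₁ : ContMDiff 𝓘(ℝ, EG) 𝓘(ℝ, EM) ∞ fun g : G => g⁻¹ • m :=
    (contMDiff_inv 𝓘(ℝ, EG) ∞).smul contMDiff_const
  have h₂ : ContMDiff 𝓘(ℝ, EG) (𝓘(ℝ, EM).prod 𝓘(ℝ, F)) ∞
      fun g : G => TotalSpace.mk' F (g⁻¹ • m) (s (g⁻¹ • m)) := s.contMDiff.comp h₁
  have h₃ := ρ.act_smooth.comp (contMDiff_id.prodMk h₂)
  have h₄ : ((fun x : G × TotalSpace F E =>
      TotalSpace.mk' F (x.1 • x.2.proj) (ρ.act x.1 rfl x.2.snd)) ∘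
      fun g : G => (id g, TotalSpace.mk' F (g⁻¹ • m) (s (g⁻¹ • m)))) =
      fun g : G => TotalSpace.mk' F m (ρ.translate s g m) := by
    funext g
    have key : ∀ (m' : M) (h : g • g⁻¹ • m = m'),
        TotalSpace.mk' F (g • g⁻¹ • m) (ρ.act g rfl (s (g⁻¹ • m))) =
          TotalSpace.mk' F m' (ρ.act g h (s (g⁻¹ • m))) := by
      rintro _ rfl
      rfl
    exact key m (smul_inv_smul g m)
  rw [h₄] at h₃
  set e := (trivializationAt F E m).continuousLinearEquivAt ℝ m
    (mem_baseSet_trivializationAt F E m) with he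
  intro g
  have h₅ := ((contMDiffAt_totalSpace (F := F)).1 (h₃ g)).2
  have h₆ := ((φ ∘ₗ (e.symm : F →ₗ[ℝ] E m)).toContinuousLinearMap.contMDiff
    (n := ∞)).contMDiffAt.comp g h₅
  refine h₆.congr_of_eventuallyEq (Filter.Eventually.of_forall fun h => ?_)
  have h₇ : e.symm (e (ρ.translate s h m)) = ρ.translate s h m := e.symm_apply_apply _
  exact (congrArg φ h₇).symm

theorem eventually_translate_eq (s : Cₛ^∞⟮𝓘(ℝ, EM); F, E⟯) {g₀ : G} {m : M}
    (φ : Module.Dual ℝ (E m))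
    (h : ∀ᶠ g in 𝓝 g₀, ∀ a, φ (ρ.translate (𝒞.bracket (ρ.rho a) s) g m) = 0) :
    ∀ᶠ g in 𝓝 g₀, φ (ρ.translate s g m) = φ (ρ.translate s g₀ m) := by
  refine eventually_eq_of_left_deriv_eq_zero (Filter.Eventually.of_forall fun g =>
    (ρ.contMDiff_translate s m φ).mdifferentiableAt (by simp)) ?_
  filter_upwards [h] with g hg X
  obtain ⟨a, rfl⟩ := 𝒜.proj_surjective X
  rw [ρ.left_deriv_translate, hg]

variable [ConnectedSpace G] {P : Type*} [TopologicalSpace P] [MulAction G P] {ι : P → M}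

/-- A subbundle along an orbit-invariant map is preserved by the action if its sections are
preserved by the infinitesimal action. -/
theorem act_mem [ContinuousSMul G P] (hι : ∀ (g : G) (p : P), ι (g • p) = g • ι p)
    {L : ∀ p, Submodule ℝ (E (ι p))} {r : ℕ} (hr : ∀ p, Module.finrank ℝ (L p) = r)
    (hL : ∀ p, ∀ e ∈ L p, ∃ s : Cₛ^∞⟮𝓘(ℝ, EM); F, E⟯, s (ι p) = e ∧
      ∀ᶠ p' in 𝓝 p, s (ι p') ∈ L p' ∧ ∀ a, 𝒞.bracket (ρ.rho a) s (ι p') ∈ L p')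
    {g : G} {p p' : P} (hp : g • p = p') (h : g • ι p = ι p') {v : E (ι p)} (hv : v ∈ L p) :
    ρ.act g h v ∈ L p' := by
  have := fun m => finiteDimensional_fibre F (E := E) m
  have : IsTopologicalGroup G := topologicalGroup_of_lieGroup 𝓘(ℝ, EG) ∞
  have hbase : ∀ g : G, g • ι (g⁻¹ • p') = ι p' := fun g => by rw [← hι, smul_inv_smul]
  let W : G → Submodule ℝ (E (ι p')) := fun g => (L (g⁻¹ • p')).map (ρ.act g (hbase g))
  have hWr : ∀ g, Module.finrank ℝ (W g) = r := fun g => by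
    rw [← hr (g⁻¹ • p')]
    exact (Submodule.equivMapOfInjective _ (ρ.act_injective (hbase g)) _).finrank_eq.symm
  have hW : IsLocallyConstant W := by
    rw [IsLocallyConstant.iff_eventually_eq]
    intro g₀
    have hcont : Filter.Tendsto (fun g : G => g⁻¹ • p') (𝓝 g₀) (𝓝 (g₀⁻¹ • p')) :=
      (continuous_inv.smul continuous_const).tendsto g₀
    let b := Module.finBasis ℝ (L (g₀⁻¹ • p'))
    choose s hs hsL using fun i => hL (g₀⁻¹ • p') (b i) (b i).2
    have hli : LinearIndependent ℝ fun i => ρ.translate (s i) g₀ (ι p') := by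
      simp only [← ρ.act_eq_translate _ (hbase g₀), hs]
      exact (b.linearIndependent.map' (L (g₀⁻¹ • p')).subtype (Submodule.ker_subtype _)).map' _
        (LinearMap.ker_eq_bot.2 (ρ.act_injective _))
    have hspan : ∀ g, (∀ i, s i (ι (g⁻¹ • p')) ∈ L (g⁻¹ • p')) →
        (LinearIndependent ℝ fun i => ρ.translate (s i) g (ι p')) →
        Submodule.span ℝ (Set.range fun i => ρ.translate (s i) g (ι p')) = W g := by
      intro g hg hgl
      refine Submodule.eq_of_le_of_finrank_eq (Submodule.span_le.2 ?_) ?_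
      · rintro _ ⟨i, rfl⟩
        simp only [← ρ.act_eq_translate _ (hbase g)]
        exact Submodule.mem_map_of_mem (hg i)
      · rw [finrank_span_eq_card hgl, hWr, Fintype.card_fin, hr]
    have key := eventually_span_eq_of_left_deriv (f := fun i g => ρ.translate (s i) g (ι p'))
      (g₀ := g₀) (fun i φ => ρ.contMDiff_translate (s i) (ι p') φ) hli (by
        filter_upwards [hcont.eventually (Filter.eventually_all.2 hsL)] with g hg hgl i X
        obtain ⟨a, rfl⟩ := 𝒜.proj_surjective X
        refine ⟨ρ.translate (𝒞.bracket (ρ.rho a) (s i)) g (ι p'), ?_, fun φ =>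
          ρ.left_deriv_translate a (s i) g (ι p') φ⟩
        rw [hspan g (fun i => (hg i).1) hgl, ← ρ.act_eq_translate _ (hbase g)]
        exact Submodule.mem_map_of_mem ((hg i).2 a))
    filter_upwards [key, hcont.eventually (Filter.eventually_all.2 hsL)] with g hg hgs
    rw [← hspan g (fun i => (hgs i).1) hg.1, hg.2,
      hspan g₀ (fun i => (hsL i).self_of_nhds.1) hli]
  have h₁ : W g = W 1 := hW.apply_eq_of_preconnectedSpace g 1
  have hp' : g⁻¹ • p' = p := by rw [← hp, inv_smul_smul]
  have h₂ : ρ.act g h v ∈ W g := by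
    have key : ∀ (q : P) (hq : g • ι q = ι p'), q = p →
        ρ.act g h v ∈ (L q).map (ρ.act g hq) := by
      rintro _ hq rfl
      exact Submodule.mem_map_of_mem hv
    exact key _ _ hp'
  rw [h₁] at h₂
  have key : ∀ (q : P) (hq : (1 : G) • ι q = ι p'), q = p' →
      (L q).map (ρ.act 1 hq) ≤ L p' := by
    rintro _ hq rfl
    rintro _ ⟨w, hw, rfl⟩
    rwa [ρ.act_one]
  exact key _ _ (by rw [inv_one, one_smul]) h₂

end Translate

end ExtendedAction

/-! ### Free actions -/

section Free

variable {EG : Type*} [NormedAddCommGroup EG] [NormedSpace ℝ EG] [FiniteDimensional ℝ EG]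
  {G : Type*} [TopologicalSpace G] [ChartedSpace EG G] [Group G] [LieGroup 𝓘(ℝ, EG) ∞ G]
  {EP : Type*} [NormedAddCommGroup EP] [NormedSpace ℝ EP]
  {P : Type*} [TopologicalSpace P] [ChartedSpace EP P] [IsManifold 𝓘(ℝ, EP) ∞ P]
  [MulAction G P] [ContMDiffSMul 𝓘(ℝ, EG) 𝓘(ℝ, EP) ∞ G P]

omit [FiniteDimensional ℝ EG] [LieGroup 𝓘(ℝ, EG) ∞ G] [IsManifold 𝓘(ℝ, EP) ∞ P] in
theorem contMDiff_smul_const (p : P) : ContMDiff 𝓘(ℝ, EG) 𝓘(ℝ, EP) ∞ fun g : G => g • p :=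
  contMDiff_id.smul contMDiff_const

omit [FiniteDimensional ℝ EG] [IsManifold 𝓘(ℝ, EP) ∞ P] in
theorem mfderiv_smul_const_mulInvariantVectorField {p : P} {Y : GroupLieAlgebra 𝓘(ℝ, EG) G}
    (hY : mfderiv 𝓘(ℝ, EG) 𝓘(ℝ, EP) (fun g : G => g • p) 1 Y = 0) (g : G) :
    mfderiv 𝓘(ℝ, EG) 𝓘(ℝ, EP) (fun g : G => g • p) g (mulInvariantVectorField Y g) = 0 := by
  have h₁ : MDifferentiableAt 𝓘(ℝ, EG) 𝓘(ℝ, EG) (fun h : G => g * h) 1 :=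
    (contMDiff_mul_left (I := 𝓘(ℝ, EG)) (n := ∞)).mdifferentiableAt (by simp)
  have h₂ : MDifferentiableAt 𝓘(ℝ, EG) 𝓘(ℝ, EP) (fun h : G => h • p) (g * 1) :=
    (contMDiff_smul_const p).mdifferentiableAt (by simp)
  have h₅ : MDifferentiableAt 𝓘(ℝ, EP) 𝓘(ℝ, EP) (fun q : P => g • q) ((1 : G) • p) :=
    (ContMDiffSMul.contMDiff_const_smul (I := 𝓘(ℝ, EG)) (n := ∞) g).mdifferentiableAt (by simp)
  have h₃ := mfderiv_comp (1 : G) h₂ h₁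
  have h₄ : (fun h : G => h • p) ∘ (fun h : G => g * h) =
      (fun q : P => g • q) ∘ fun h : G => h • p := by
    funext h
    simp [mul_smul]
  have h₆ := mfderiv_comp (1 : G) h₅
    ((contMDiff_smul_const (EG := EG) p).mdifferentiableAt (n := ∞) (by simp))
  rw [h₄, h₆] at h₃
  have h₇ := congrArg (fun L => L Y) h₃
  have h₈ := congrArg (mfderiv 𝓘(ℝ, EP) 𝓘(ℝ, EP) (fun q : P => g • q) ((1 : G) • p)) hY
  rw [map_zero] at h₈
  have key : ∀ (k : G) (v : EG), k = g →
      mfderiv 𝓘(ℝ, EG) 𝓘(ℝ, EP) (fun g : G => g • p) k v = 0 →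
      mfderiv 𝓘(ℝ, EG) 𝓘(ℝ, EP) (fun g : G => g • p) g v = 0 := by
    rintro _ v rfl h
    exact h
  exact key _ _ (mul_one g) (h₇.symm.trans h₈)

theorem eq_zero_of_mfderiv_smul_const_eq_zero {p : P} (hp : ∀ g : G, g • p = p → g = 1)
    {Y : GroupLieAlgebra 𝓘(ℝ, EG) G}
    (hY : mfderiv 𝓘(ℝ, EG) 𝓘(ℝ, EP) (fun g : G => g • p) 1 Y = 0) : Y = 0 := by
  have : LieGroup 𝓘(ℝ, EG) (minSmoothness ℝ 3) G :=
    LieGroup.of_le (n := ∞) (by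
      rw [minSmoothness_of_isRCLikeNormedField]
      exact WithTop.coe_le_coe.2 le_top)
  have : IsManifold 𝓘(ℝ, EG) ∞ G := ContMDiffMul.toIsManifold
  have : IsManifold 𝓘(ℝ, EG) 1 G := IsManifold.of_le (n := ∞) (by simp)
  obtain ⟨γ, hγ₀, hγ⟩ := exists_isMIntegralCurveAt_of_contMDiffAt_boundaryless
    (I := 𝓘(ℝ, EG)) (v := mulInvariantVectorField Y) (x₀ := (1 : G)) 0
    ((contMDiffAt_mulInvariantVectorField (I := 𝓘(ℝ, EG)) Y (g := (1 : G))).of_le (by simp))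
  have hcont : ContinuousAt (fun t => γ t • p) 0 :=
    (contMDiff_smul_const (EG := EG) (EP := EP) p).continuous.continuousAt.comp hγ.continuousAt
  set c := chartAt EP (γ 0 • p)
  have hc₀ : γ 0 • p ∈ c.source := mem_chart_source EP _
  have h₁ : ∀ᶠ t in 𝓝 (0 : ℝ), HasMFDerivAt 𝓘(ℝ, ℝ) 𝓘(ℝ, EP) (fun t => c (γ t • p)) t
      (0 : ℝ →L[ℝ] EP) := by
    filter_upwards [hγ, hcont.eventually (c.open_source.mem_nhds hc₀)] with t ht hts
    have h₂ : MDifferentiableAt 𝓘(ℝ, EP) 𝓘(ℝ, EP) c (γ t • p) :=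
      (contMDiffAt_of_mem_maximalAtlas (I := 𝓘(ℝ, EP)) (n := ∞)
        (IsManifold.chart_mem_maximalAtlas _) hts).mdifferentiableAt (by simp)
    have h₃ : MDifferentiableAt 𝓘(ℝ, EG) 𝓘(ℝ, EP) (fun g : G => g • p) (γ t) :=
      (contMDiff_smul_const p).mdifferentiableAt (n := ∞) (by simp)
    have h₄ := h₂.hasMFDerivAt.comp t (h₃.hasMFDerivAt.comp t ht)
    refine (show (0 : ℝ →L[ℝ] EP) = _ from ContinuousLinearMap.ext_ring ?_) ▸ h₄
    have h₅ := mfderiv_smul_const_mulInvariantVectorField hY (γ t)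
    have h₆ := congrArg (mfderiv 𝓘(ℝ, EP) 𝓘(ℝ, EP) c (γ t • p)) h₅
    rw [map_zero] at h₆
    have h₇ : mfderiv 𝓘(ℝ, EP) 𝓘(ℝ, EP) c (γ t • p)
        (mfderiv 𝓘(ℝ, EG) 𝓘(ℝ, EP) (fun g : G => g • p) (γ t)
          ((1 : ℝ) • mulInvariantVectorField Y (γ t))) = 0 := by
      rw [one_smul]
      exact h₆
    exact h₇.symm
  have h₂ : ∀ᶠ t in 𝓝 (0 : ℝ), γ t = γ 0 := by
    filter_upwards [eventually_eq_of_mfderiv_eq_zero h₁,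
      hcont.eventually (c.open_source.mem_nhds hc₀)] with t ht hts
    have h₃ : γ t • p = γ 0 • p := c.injOn hts hc₀ ht
    rw [hγ₀, one_smul] at h₃
    rw [hγ₀, hp _ h₃]
  have h₃ : HasMFDerivAt 𝓘(ℝ, ℝ) 𝓘(ℝ, EG) γ 0 (0 : ℝ →L[ℝ] EG) :=
    (hasMFDerivAt_const (γ 0) (0 : ℝ)).congr_of_eventuallyEq h₂
  have h₄ := hasMFDerivAt_unique h₃ hγ.self_of_nhds
  have h₅ : (0 : EG) = (1 : ℝ) • mulInvariantVectorField Y (γ 0) := congrArg (fun L => L 1) h₄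
  rw [one_smul] at h₅
  have key : ∀ g : G, g = 1 → (0 : EG) = mulInvariantVectorField (I := 𝓘(ℝ, EG)) Y g → Y = 0 := by
    rintro _ rfl h
    have h₆ : HasMFDerivAt 𝓘(ℝ, EG) 𝓘(ℝ, EG) (fun h : G => 1 * h) 1
        (ContinuousLinearMap.id ℝ EG) :=
      (hasMFDerivAt_id (1 : G)).congr_of_eventuallyEq (Filter.Eventually.of_forall one_mul)
    exact (congrArg (fun L => L Y) h₆.mfderiv).symm.trans h.symm
  exact key _ hγ₀ h₅

theorem eq_zero_of_infinitesimalAction_eq_zero {p : P} (hp : ∀ g : G, g • p = p → g = 1)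
    {X : GroupLieAlgebra 𝓘(ℝ, EG) G}
    (hX : infinitesimalAction (EM := EP) X p = 0) : X = 0 := by
  have hinv : ∀ g : G, MDifferentiableAt 𝓘(ℝ, EG) 𝓘(ℝ, EG) (fun h : G => h⁻¹) g := fun g =>
    (contMDiff_inv 𝓘(ℝ, EG) ∞).mdifferentiableAt (by simp)
  have h₁ := mfderiv_comp (1 : G) ((contMDiff_smul_const (EG := EG) (EP := EP)
    p).mdifferentiableAt (n := ∞) (x := (1 : G)⁻¹) (by simp)) (hinv 1)
  have h₂ := congrArg (fun L => L X) h₁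
  have h₃ := h₂.symm.trans hX
  have key : ∀ (k : G) (v : EG), k = 1 →
      mfderiv 𝓘(ℝ, EG) 𝓘(ℝ, EP) (fun g : G => g • p) k v = 0 → v = 0 := by
    rintro _ v rfl h
    exact eq_zero_of_mfderiv_smul_const_eq_zero hp h
  have h₄ := key _ _ inv_one h₃
  have h₅ := mfderiv_comp (1 : G) (hinv (1 : G)⁻¹) (hinv 1)
  have h₆ : (fun h : G => h⁻¹) ∘ (fun h : G => h⁻¹) = id := by
    funext h
    simp
  rw [h₆, mfderiv_id] at h₅
  have h₇ := congrArg (mfderiv 𝓘(ℝ, EG) 𝓘(ℝ, EG) (fun h : G => h⁻¹) (1 : G)⁻¹) h₄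
  exact ((congrArg (fun L => L X) h₅).trans h₇).trans (map_zero _)

end Free

/-! ### Brackets of sections along a leaf -/

namespace CourantAlgebroid

variable {EM : Type*} [NormedAddCommGroup EM] [NormedSpace ℝ EM]
  {M : Type*} [TopologicalSpace M] [ChartedSpace EM M] [IsManifold 𝓘(ℝ, EM) ∞ M]
  {F : Type*} [NormedAddCommGroup F] [NormedSpace ℝ F]
  {E : M → Type*} [∀ m, AddCommGroup (E m)] [∀ m, Module ℝ (E m)]
  [TopologicalSpace (TotalSpace F E)] [∀ m, TopologicalSpace (E m)]
  [FiberBundle F E] [VectorBundle ℝ F E] [ContMDiffVectorBundle ∞ F E 𝓘(ℝ, EM)]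
  (𝒞 : CourantAlgebroid EM M F E)

theorem form_comm (m : M) (x y : E m) : 𝒞.form m x y = 𝒞.form m y x :=
  (𝒞.form_symm m).eq x y

/-- The symmetric part of the bracket is `𝒟⟨·, ·⟩`. -/
theorem form_bracket_add_bracket (U V : Cₛ^∞⟮𝓘(ℝ, EM); F, E⟯) (m : M) (v : E m) :
    𝒞.form m (𝒞.bracket U V m) v + 𝒞.form m (𝒞.bracket V U m) v =
      dirDeriv (fun x => 𝒞.form x (U x) (V x)) m (𝒞.anchor m v) := by
  have hd : ∀ A B : Cₛ^∞⟮𝓘(ℝ, EM); F, E⟯,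
      MDifferentiableAt 𝓘(ℝ, EM) 𝓘(ℝ, ℝ) (fun x => 𝒞.form x (A x) (B x)) m := fun A B =>
    (𝒞.form_smooth A B).mdifferentiableAt (by simp)
  have h₁ := 𝒞.bracket_self (U + V) m v
  have h₂ := 𝒞.bracket_self U m v
  have h₃ := 𝒞.bracket_self V m v
  have h₄ : dirDeriv (fun x => 𝒞.form x ((U + V) x) ((U + V) x)) m (𝒞.anchor m v) =
      dirDeriv (fun x => 𝒞.form x (U x) (U x)) m (𝒞.anchor m v) +
      dirDeriv (fun x => 𝒞.form x (V x) (V x)) m (𝒞.anchor m v) +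
      (dirDeriv (fun x => 𝒞.form x (U x) (V x)) m (𝒞.anchor m v) +
      dirDeriv (fun x => 𝒞.form x (U x) (V x)) m (𝒞.anchor m v)) := by
    rw [← dirDeriv_add (hd U U) (hd V V), ← dirDeriv_add (hd U V) (hd U V),
      ← dirDeriv_add (f := fun x => 𝒞.form x (U x) (U x) + 𝒞.form x (V x) (V x))
        (g := fun x => 𝒞.form x (U x) (V x) + 𝒞.form x (U x) (V x))
        ((hd U U).add (hd V V)) ((hd U V).add (hd U V))]
    refine dirDeriv_congr (Filter.Eventually.of_forall fun x => ?_) _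
    simp only [ContMDiffSection.coe_add, Pi.add_apply, map_add, LinearMap.add_apply]
    rw [𝒞.form_comm x (V x) (U x)]
    ring
  rw [h₄] at h₁
  simp only [map_add, LinearMap.add_apply, ContMDiffSection.coe_add, Pi.add_apply] at h₁
  linarith

end CourantAlgebroid

namespace ExtendedAction

variable {EG : Type*} [NormedAddCommGroup EG] [NormedSpace ℝ EG]
  {G : Type*} [TopologicalSpace G] [ChartedSpace EG G] [Group G]
  {EM : Type*} [NormedAddCommGroup EM] [NormedSpace ℝ EM]
  {M : Type*} [TopologicalSpace M] [ChartedSpace EM M] [IsManifold 𝓘(ℝ, EM) ∞ M]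
  {F : Type*} [NormedAddCommGroup F] [NormedSpace ℝ F]
  {E : M → Type*} [∀ m, AddCommGroup (E m)] [∀ m, Module ℝ (E m)]
  [TopologicalSpace (TotalSpace F E)] [∀ m, TopologicalSpace (E m)]
  [FiberBundle F E] [VectorBundle ℝ F E] [ContMDiffVectorBundle ∞ F E 𝓘(ℝ, EM)]
  [MulAction G M]
  {𝒞 : CourantAlgebroid EM M F E}
  {𝔞 : Type*} [AddCommGroup 𝔞] [Module ℝ 𝔞] {𝒜 : ExactCourantAlgebra EG G 𝔞}
  (ρ : ExtendedAction 𝒞 𝒜)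

theorem rho_mem_K (a : 𝔞) (m : M) : ρ.rho a m ∈ ρ.K m := ⟨a, rfl⟩

theorem mem_Kperp_iff {m : M} {x : E m} :
    x ∈ ρ.Kperp m ↔ ∀ a, 𝒞.form m (ρ.rho a m) x = 0 := by
  constructor
  · intro h a
    exact h _ (ρ.rho_mem_K a m)
  · rintro h _ ⟨a, rfl⟩
    exact h a

theorem rhoH_le_K (m : M) : ρ.rhoH m ≤ ρ.K m := by
  rintro _ ⟨h, -, rfl⟩
  exact ρ.rho_mem_K h m

/-- The distribution `K ∩ K^⊥`. -/
def nullK (m : M) : Submodule ℝ (E m) := ρ.K m ⊓ ρ.Kperp m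

theorem nullK_le_Ktilde (m : M) : ρ.nullK m ≤ ρ.Ktilde m :=
  inf_le_inf_left _ le_sup_left

theorem Ktilde_le_K (m : M) : ρ.Ktilde m ≤ ρ.K m := inf_le_left

theorem rhoH_le_ker (m : M) : ρ.rhoH m ≤ LinearMap.ker (𝒞.anchor m) := by
  rintro _ ⟨h, hh, rfl⟩
  rw [LinearMap.mem_ker]
  have h₁ : 𝒜.proj h = 0 := hh
  have h₂ := ρ.anchor_rho h m
  rw [h₁] at h₂
  exact h₂.trans (map_zero _)

theorem rhoH_le_Ktilde (h𝒞 : 𝒞.IsExact) (m : M) : ρ.rhoH m ≤ ρ.Ktilde m :=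
  le_inf (ρ.rhoH_le_K m) (((ρ.rhoH_le_ker m).trans (h𝒞 m).exact_middle.ge).trans le_sup_right)

section Leaf

variable {EP : Type*} [NormedAddCommGroup EP] [NormedSpace ℝ EP]
  {P : Type*} [TopologicalSpace P] [ChartedSpace EP P] {ι : P → M}

variable (ι) in
/-- Near `p`, the section `k` takes values in `K ∩ K^⊥` along `ι`. -/
def IsNullNear (k : Cₛ^∞⟮𝓘(ℝ, EM); F, E⟯) (p : P) : Prop :=
  ∀ᶠ p' in 𝓝 p, k (ι p') ∈ ρ.nullK (ι p')

variable (ι) in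
/-- Near `p`, the section `U` takes values in `K^⊥` along `ι`, and its class modulo `K ∩ K^⊥` is
invariant under the infinitesimal action. -/
def IsInvariantNear (U : Cₛ^∞⟮𝓘(ℝ, EM); F, E⟯) (p : P) : Prop :=
  ∀ᶠ p' in 𝓝 p, U (ι p') ∈ ρ.Kperp (ι p') ∧
    ∀ a, 𝒞.bracket (ρ.rho a) U (ι p') ∈ ρ.nullK (ι p')

variable {ρ} (hleaf : IsIntegralSubmanifold ρ.bigDistribution (EP := EP) ι)
include hleaf

theorem dirDeriv_form_eq_zero {A B : Cₛ^∞⟮𝓘(ℝ, EM); F, E⟯} {p : P}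
    (h : ∀ᶠ p' in 𝓝 p, 𝒞.form (ι p') (A (ι p')) (B (ι p')) = 0) {v : E (ι p)}
    (hv : v ∈ ρ.K (ι p) ⊔ ρ.Kperp (ι p)) :
    dirDeriv (fun m => 𝒞.form m (A m) (B m)) (ι p) (𝒞.anchor (ι p) v) = 0 :=
  dirDeriv_eq_zero_of_eventually_const hleaf.smooth (𝒞.form_smooth A B) h (by
    rw [hleaf.tangent]
    exact Submodule.mem_map_of_mem hv)

/-- `⟨[A, B], C⟩ = -⟨B, [A, C]⟩` when `⟨B, C⟩` vanishes on the leaf and `π(A)` is tangent. -/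
theorem form_bracket_eq_neg {A B C : Cₛ^∞⟮𝓘(ℝ, EM); F, E⟯} {p : P}
    (h : ∀ᶠ p' in 𝓝 p, 𝒞.form (ι p') (B (ι p')) (C (ι p')) = 0)
    (hA : A (ι p) ∈ ρ.K (ι p) ⊔ ρ.Kperp (ι p)) :
    𝒞.form (ι p) (𝒞.bracket A B (ι p)) (C (ι p)) =
      - 𝒞.form (ι p) (B (ι p)) (𝒞.bracket A C (ι p)) := by
  have := 𝒞.form_bracket A B C (ι p)
  rw [dirDeriv_form_eq_zero hleaf h hA] at this
  linarith

/-- `⟨[A, B], v⟩ = -⟨[B, A], v⟩` when `⟨A, B⟩` vanishes on the leaf and `π(v)` is tangent. -/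
theorem form_bracket_swap {A B : Cₛ^∞⟮𝓘(ℝ, EM); F, E⟯} {p : P}
    (h : ∀ᶠ p' in 𝓝 p, 𝒞.form (ι p') (A (ι p')) (B (ι p')) = 0) {v : E (ι p)}
    (hv : v ∈ ρ.K (ι p) ⊔ ρ.Kperp (ι p)) :
    𝒞.form (ι p) (𝒞.bracket A B (ι p)) v = - 𝒞.form (ι p) (𝒞.bracket B A (ι p)) v := by
  have := 𝒞.form_bracket_add_bracket A B (ι p) v
  rw [dirDeriv_form_eq_zero hleaf h hv] at this
  linarith

omit hleaf in
theorem form_K_Kperp {m : M} {x y : E m} (hx : x ∈ ρ.K m) (hy : y ∈ ρ.Kperp m) :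
    𝒞.form m x y = 0 := hy x hx

omit hleaf in
theorem form_Kperp_K {m : M} {x y : E m} (hx : x ∈ ρ.Kperp m) (hy : y ∈ ρ.K m) :
    𝒞.form m x y = 0 := by
  rw [𝒞.form_comm]
  exact hx y hy

theorem bracket_rho_mem_Kperp {X : Cₛ^∞⟮𝓘(ℝ, EM); F, E⟯} {p : P}
    (hX : ∀ᶠ p' in 𝓝 p, X (ι p') ∈ ρ.Kperp (ι p')) (a : 𝔞) :
    𝒞.bracket (ρ.rho a) X (ι p) ∈ ρ.Kperp (ι p) := by
  rw [mem_Kperp_iff]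
  intro b
  rw [𝒞.form_comm, form_bracket_eq_neg hleaf (hX.mono fun p' hp' =>
    form_Kperp_K hp' (ρ.rho_mem_K b _)) (Submodule.mem_sup_left (ρ.rho_mem_K a _)),
    ← ρ.rho_bracket, form_Kperp_K hX.self_of_nhds (ρ.rho_mem_K _ _), neg_zero]

variable [FiniteDimensional ℝ F]

omit hleaf [ChartedSpace EP P] in
theorem mem_nullK_of_forall {p : P} (hK : HasSectionsAt EM F ι (fun p => ρ.Kperp (ι p)) p)
    {x : E (ι p)} (h₁ : x ∈ ρ.Kperp (ι p))
    (h₂ : ∀ X : Cₛ^∞⟮𝓘(ℝ, EM); F, E⟯, (∀ᶠ p' in 𝓝 p, X (ι p') ∈ ρ.Kperp (ι p')) →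
      𝒞.form (ι p) x (X (ι p)) = 0) : x ∈ ρ.nullK (ι p) := by
  have := finiteDimensional_fibre F (E := E) (ι p)
  refine ⟨?_, h₁⟩
  rw [← orthogonal_orthogonal_eq (𝒞.form_symm _) (𝒞.form_nondegenerate _) (ρ.K (ι p))]
  intro y hy
  obtain ⟨X, rfl, hX⟩ := hK y hy
  exact (𝒞.form_comm _ _ _).trans (h₂ X hX)

variable {p : P} (hK : ∀ᶠ p' in 𝓝 p, HasSectionsAt EM F ι (fun p => ρ.Kperp (ι p)) p')
include hK

theorem IsNullNear.bracket_rho_mem {k : Cₛ^∞⟮𝓘(ℝ, EM); F, E⟯} (hk : ρ.IsNullNear ι k p) (a : 𝔞) :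
    𝒞.bracket (ρ.rho a) k (ι p) ∈ ρ.nullK (ι p) := by
  refine mem_nullK_of_forall hK.self_of_nhds
    (bracket_rho_mem_Kperp hleaf (hk.mono fun p' hp' => hp'.2) a) fun X hX => ?_
  rw [form_bracket_eq_neg hleaf ((hk.and hX).mono fun p' hp' => form_K_Kperp hp'.1.1 hp'.2)
    (Submodule.mem_sup_left (ρ.rho_mem_K a _)),
    form_K_Kperp hk.self_of_nhds.1 (bracket_rho_mem_Kperp hleaf hX a), neg_zero]

theorem IsNullNear.isInvariantNear {k : Cₛ^∞⟮𝓘(ℝ, EM); F, E⟯} (hk : ρ.IsNullNear ι k p) :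
    ρ.IsInvariantNear ι k p := by
  filter_upwards [hk.eventually_nhds, hK.eventually_nhds] with p' hp' hKp'
  exact ⟨hp'.self_of_nhds.2, fun a => IsNullNear.bracket_rho_mem hleaf hKp' hp' a⟩

omit hK [FiniteDimensional ℝ F] in
theorem IsInvariantNear.bracket_mem_Kperp {U W : Cₛ^∞⟮𝓘(ℝ, EM); F, E⟯}
    (hU : ρ.IsInvariantNear ι U p) (hW : ρ.IsInvariantNear ι W p) :
    𝒞.bracket U W (ι p) ∈ ρ.Kperp (ι p) := by
  rw [mem_Kperp_iff]
  intro b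
  rw [𝒞.form_comm, form_bracket_eq_neg hleaf (hW.mono fun p' hp' =>
    form_Kperp_K hp'.1 (ρ.rho_mem_K b _)) (Submodule.mem_sup_right hU.self_of_nhds.1),
    𝒞.form_comm, form_bracket_swap hleaf (hU.mono fun p' hp' =>
    form_Kperp_K hp'.1 (ρ.rho_mem_K b _)) (Submodule.mem_sup_right hW.self_of_nhds.1),
    form_K_Kperp (hU.self_of_nhds.2 b).1 hW.self_of_nhds.1]
  simp

theorem IsInvariantNear.bracket_null_mem {W k : Cₛ^∞⟮𝓘(ℝ, EM); F, E⟯}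
    (hW : ρ.IsInvariantNear ι W p) (hk : ρ.IsNullNear ι k p) :
    𝒞.bracket W k (ι p) ∈ ρ.nullK (ι p) := by
  refine mem_nullK_of_forall hK.self_of_nhds
    (hW.bracket_mem_Kperp hleaf (hk.isInvariantNear hleaf hK)) fun X hX => ?_
  have hWm : W (ι p) ∈ ρ.K (ι p) ⊔ ρ.Kperp (ι p) := Submodule.mem_sup_right hW.self_of_nhds.1
  rw [form_bracket_eq_neg hleaf ((hk.and hX).mono fun p' hp' => form_K_Kperp hp'.1.1 hp'.2) hWm]
  obtain ⟨a, ha⟩ := hk.self_of_nhds.1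
  rw [← ha]
  change - 𝒞.form (ι p) (ρ.rho a (ι p)) _ = 0
  rw [← form_bracket_eq_neg hleaf (hX.mono fun p' hp' =>
    form_K_Kperp (ρ.rho_mem_K a _) hp') hWm, form_bracket_swap hleaf (hW.mono fun p' hp' =>
    form_Kperp_K hp'.1 (ρ.rho_mem_K a _)) (Submodule.mem_sup_right hX.self_of_nhds),
    form_K_Kperp (hW.self_of_nhds.2 a).1 hX.self_of_nhds, neg_zero]

theorem IsInvariantNear.null_bracket_mem {W k : Cₛ^∞⟮𝓘(ℝ, EM); F, E⟯}
    (hW : ρ.IsInvariantNear ι W p) (hk : ρ.IsNullNear ι k p) :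
    𝒞.bracket k W (ι p) ∈ ρ.nullK (ι p) := by
  refine mem_nullK_of_forall hK.self_of_nhds
    ((hk.isInvariantNear hleaf hK).bracket_mem_Kperp hleaf hW) fun X hX => ?_
  rw [form_bracket_swap hleaf ((hk.and hW).mono fun p' hp' => form_K_Kperp hp'.1.1 hp'.2.1)
    (Submodule.mem_sup_right hX.self_of_nhds),
    form_K_Kperp (hW.bracket_null_mem hleaf hK hk).1 hX.self_of_nhds, neg_zero]

/-- The bracket of invariant sections is invariant. -/
theorem IsInvariantNear.bracket {U W : Cₛ^∞⟮𝓘(ℝ, EM); F, E⟯}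
    (hU : ρ.IsInvariantNear ι U p) (hW : ρ.IsInvariantNear ι W p) :
    ρ.IsInvariantNear ι (𝒞.bracket U W) p := by
  filter_upwards [hU.eventually_nhds, hW.eventually_nhds, hK.eventually_nhds] with p' hU hW hK
  refine ⟨IsInvariantNear.bracket_mem_Kperp hleaf hU hW, fun a => ?_⟩
  rw [𝒞.leibniz]
  exact add_mem
    (IsInvariantNear.null_bracket_mem hleaf hK hW (hU.mono fun p' hp' => hp'.2 a))
    (IsInvariantNear.bracket_null_mem hleaf hK hU (hW.mono fun p' hp' => hp'.2 a))

/-- Modulo `K ∩ K^⊥`, the bracket of invariant sections depends only on their classes. -/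
theorem IsInvariantNear.bracket_sub_bracket_mem {U W U' W' : Cₛ^∞⟮𝓘(ℝ, EM); F, E⟯}
    (hU : ρ.IsInvariantNear ι U p) (hW : ρ.IsInvariantNear ι W p)
    (hU' : ρ.IsNullNear ι (U' - U) p) (hW' : ρ.IsNullNear ι (W' - W) p) :
    𝒞.bracket U' W' (ι p) - 𝒞.bracket U W (ι p) ∈ ρ.nullK (ι p) := by
  have h : 𝒞.bracket U' W' - 𝒞.bracket U W = 𝒞.bracket (U' - U) W +
      (𝒞.bracket U (W' - W) + 𝒞.bracket (U' - U) (W' - W)) := by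
    simp only [map_sub, LinearMap.sub_apply]
    abel
  have h' := congrArg (fun s : Cₛ^∞⟮𝓘(ℝ, EM); F, E⟯ => s (ι p)) h
  simp only [ContMDiffSection.coe_sub, ContMDiffSection.coe_add, Pi.sub_apply, Pi.add_apply] at h'
  rw [h']
  exact add_mem (hW.null_bracket_mem hleaf hK hU') (add_mem (hU.bracket_null_mem hleaf hK hW')
    ((hU'.isInvariantNear hleaf hK).bracket_null_mem hleaf hK hW'))

end Leaf

end ExtendedAction

/-! ### The distributions on a leaf with free action -/

section Leaf

open Module

variable {EG : Type*} [NormedAddCommGroup EG] [NormedSpace ℝ EG] [FiniteDimensional ℝ EG]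
  {G : Type*} [TopologicalSpace G] [ChartedSpace EG G] [Group G] [LieGroup 𝓘(ℝ, EG) ∞ G]
  {EM : Type*} [NormedAddCommGroup EM] [NormedSpace ℝ EM] [FiniteDimensional ℝ EM]
  {M : Type*} [TopologicalSpace M] [ChartedSpace EM M] [IsManifold 𝓘(ℝ, EM) ∞ M] [T2Space M]
  [MulAction G M] [ContMDiffSMul 𝓘(ℝ, EG) 𝓘(ℝ, EM) ∞ G M]
  {F : Type*} [NormedAddCommGroup F] [NormedSpace ℝ F] [FiniteDimensional ℝ F]
  {E : M → Type*} [∀ m, AddCommGroup (E m)] [∀ m, Module ℝ (E m)]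
  [TopologicalSpace (TotalSpace F E)] [∀ m, TopologicalSpace (E m)]
  [FiberBundle F E] [VectorBundle ℝ F E] [ContMDiffVectorBundle ∞ F E 𝓘(ℝ, EM)]
  {𝒞 : CourantAlgebroid EM M F E}
  {𝔞 : Type*} [AddCommGroup 𝔞] [Module ℝ 𝔞] {𝒜 : ExactCourantAlgebra EG G 𝔞}
  {ρ : ExtendedAction 𝒞 𝒜}
  {EP : Type*} [NormedAddCommGroup EP] [NormedSpace ℝ EP] [FiniteDimensional ℝ EP]
  {P : Type*} [TopologicalSpace P] [ChartedSpace EP P] [IsManifold 𝓘(ℝ, EP) ∞ P]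
  [MulAction G P] [ContMDiffSMul 𝓘(ℝ, EG) 𝓘(ℝ, EP) ∞ G P] {ι : P → M}

theorem ExtendedAction.orthogonal_K_sup_Kperp (ρ : ExtendedAction 𝒞 𝒜) (m : M) :
    (𝒞.form m).orthogonal (ρ.K m ⊔ ρ.Kperp m) = ρ.nullK m := by
  have := finiteDimensional_fibre F (E := E) m
  rw [orthogonal_sup_eq, ExtendedAction.Kperp,
    orthogonal_orthogonal_eq (𝒞.form_symm _) (𝒞.form_nondegenerate _), inf_comm]
  rfl

/-- The action of `G` on the integral submanifold `P` is free and `ρ(𝔥)` has constant rank along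
`P`, the Courant algebroid `E` and its reduction along `P` being exact. -/
structure IsReducible {EG : Type*} [NormedAddCommGroup EG] [NormedSpace ℝ EG]
    {G : Type*} [TopologicalSpace G] [ChartedSpace EG G] [Group G]
    {EM : Type*} [NormedAddCommGroup EM] [NormedSpace ℝ EM]
    {M : Type*} [TopologicalSpace M] [ChartedSpace EM M] [IsManifold 𝓘(ℝ, EM) ∞ M]
    [MulAction G M]
    {F : Type*} [NormedAddCommGroup F] [NormedSpace ℝ F]
    {E : M → Type*} [∀ m, AddCommGroup (E m)] [∀ m, Module ℝ (E m)]
    [TopologicalSpace (TotalSpace F E)] [∀ m, TopologicalSpace (E m)]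
    [FiberBundle F E] [VectorBundle ℝ F E] [ContMDiffVectorBundle ∞ F E 𝓘(ℝ, EM)]
    {𝒞 : CourantAlgebroid EM M F E}
    {𝔞 : Type*} [AddCommGroup 𝔞] [Module ℝ 𝔞] {𝒜 : ExactCourantAlgebra EG G 𝔞}
    (ρ : ExtendedAction 𝒞 𝒜)
    (EP : Type*) [NormedAddCommGroup EP] [NormedSpace ℝ EP]
    {P : Type*} [TopologicalSpace P] [ChartedSpace EP P] [MulAction G P] (ι : P → M) : Prop where
  exact : 𝒞.IsExact
  leaf : IsIntegralSubmanifold ρ.bigDistribution (EP := EP) ι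
  equivariant : ∀ (g : G) (p : P), ι (g • p) = g • ι p
  free : ∀ (g : G) (p : P), g • p = p → g = 1
  rank_rhoH : ∃ r : ℕ, ∀ p : P, finrank ℝ (ρ.rhoH (ι p)) = r
  reducedExact : ρ.IsReducedExact ι

namespace IsReducible

variable (h : IsReducible ρ EP ι)
include h

theorem infinitesimalAction_eq (X : GroupLieAlgebra 𝓘(ℝ, EG) G) (p : P) :
    (infinitesimalAction X (ι p) : EM) =
      mfderiv 𝓘(ℝ, EP) 𝓘(ℝ, EM) ι p (infinitesimalAction (EM := EP) X p : EP) := by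
  have h₁ : MDifferentiableAt 𝓘(ℝ, EG) 𝓘(ℝ, EP) (fun g : G => g⁻¹ • p) 1 :=
    ((contMDiff_inv 𝓘(ℝ, EG) ∞).smul contMDiff_const).mdifferentiableAt (by simp)
  have h₂ : MDifferentiableAt 𝓘(ℝ, EP) 𝓘(ℝ, EM) ι ((1 : G)⁻¹ • p) :=
    h.leaf.smooth.mdifferentiableAt (by simp)
  have h₃ := mfderiv_comp (1 : G) h₂ h₁
  have h₄ : ι ∘ (fun g : G => g⁻¹ • p) = fun g : G => g⁻¹ • ι p := by
    funext g
    exact h.equivariant g⁻¹ p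
  rw [h₄] at h₃
  have key : ∀ (q : P) (v : EP), q = p →
      (mfderiv 𝓘(ℝ, EP) 𝓘(ℝ, EM) ι q v : EM) = mfderiv 𝓘(ℝ, EP) 𝓘(ℝ, EM) ι p v := by
    rintro _ v rfl
    rfl
  exact (congrArg (fun L => L X) h₃).trans (key _ _ (by rw [inv_one, one_smul]))

theorem eq_zero_of_infinitesimalAction {X : GroupLieAlgebra 𝓘(ℝ, EG) G} {p : P}
    (hX : infinitesimalAction (EM := EM) X (ι p) = 0) : X = 0 := by
  have h₁ := h.infinitesimalAction_eq X p
  rw [hX] at h₁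
  refine eq_zero_of_infinitesimalAction_eq_zero (EP := EP) (fun g => h.free g p) ?_
  exact mfderiv_injective_of_isImmersion h.leaf.immersion h.leaf.smooth p
    (h₁.symm.trans (map_zero _).symm)

theorem K_inf_ker (p : P) :
    ρ.K (ι p) ⊓ LinearMap.ker (𝒞.anchor (ι p)) = ρ.rhoH (ι p) := by
  refine le_antisymm ?_ (le_inf (ρ.rhoH_le_K _) (ρ.rhoH_le_ker _))
  rintro _ ⟨⟨a, rfl⟩, ha⟩
  refine Submodule.mem_map_of_mem (h.eq_zero_of_infinitesimalAction (p := p) ?_)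
  exact (ρ.anchor_rho a (ι p)).symm.trans ha

theorem Ktilde_eq (p : P) : ρ.Ktilde (ι p) = ρ.nullK (ι p) ⊔ ρ.rhoH (ι p) := by
  have := finiteDimensional_fibre F (E := E) (ι p)
  rw [← h.K_inf_ker p]
  exact tildeK_eq (𝒞.form_symm _) (𝒞.form_nondegenerate _) (h.exact _) (h.reducedExact p)

theorem orthogonal_Ktilde (p : P) :
    (𝒞.form (ι p)).orthogonal (ρ.Ktilde (ι p)) = ρ.Kperp (ι p) ⊔ ρ.rhoH (ι p) := by
  have := finiteDimensional_fibre F (E := E) (ι p)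
  rw [← h.K_inf_ker p]
  exact orthogonal_tildeK (𝒞.form_symm _) (𝒞.form_nondegenerate _) (h.exact _)

theorem orthogonal_Ktilde_le (p : P) :
    (𝒞.form (ι p)).orthogonal (ρ.Ktilde (ι p)) ≤ ρ.K (ι p) ⊔ ρ.Kperp (ι p) := by
  rw [h.orthogonal_Ktilde p, sup_comm]
  exact sup_le_sup_right (ρ.rhoH_le_K _) _

theorem Ktilde_le_orthogonal (p : P) :
    ρ.Ktilde (ι p) ≤ (𝒞.form (ι p)).orthogonal (ρ.Ktilde (ι p)) := by
  have := finiteDimensional_fibre F (E := E) (ι p)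
  exact tildeK_le_orthogonal (𝒞.form_symm _) (h.exact _) (h.reducedExact p)

theorem finrank_map_anchor_K (p : P) :
    finrank ℝ ((ρ.K (ι p)).map (𝒞.anchor (ι p))) = finrank ℝ EG := by
  let L : EG →ₗ[ℝ] TangentSpace 𝓘(ℝ, EM) (ι p) :=
    (mfderiv 𝓘(ℝ, EG) 𝓘(ℝ, EM) (fun g : G => g⁻¹ • ι p) 1).toLinearMap
  have hL : Function.Injective L := by
    rw [← LinearMap.ker_eq_bot, LinearMap.ker_eq_bot']
    intro X hX
    exact h.eq_zero_of_infinitesimalAction hX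
  rw [← LinearMap.finrank_range_of_inj hL]
  suffices hrange : (ρ.K (ι p)).map (𝒞.anchor (ι p)) = LinearMap.range L by rw [hrange]
  ext x
  constructor
  · rintro ⟨_, ⟨a, rfl⟩, rfl⟩
    exact ⟨𝒜.proj a, (ρ.anchor_rho a (ι p)).symm⟩
  · rintro ⟨X, rfl⟩
    obtain ⟨a, rfl⟩ := 𝒜.proj_surjective X
    exact ⟨ρ.rho a (ι p), ρ.rho_mem_K a _, ρ.anchor_rho a (ι p)⟩

theorem finrank_bigDistribution (p : P) :
    finrank ℝ ((ρ.K (ι p) ⊔ ρ.Kperp (ι p)).map (𝒞.anchor (ι p))) = finrank ℝ EP := by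
  have h₁ := h.leaf.tangent p
  rw [ExtendedAction.bigDistribution] at h₁
  rw [← h₁]
  exact LinearMap.finrank_range_of_inj
    (mfderiv_injective_of_isImmersion h.leaf.immersion h.leaf.smooth p)

theorem exists_rank_K : ∃ r : ℕ, ∀ p : P, finrank ℝ (ρ.K (ι p)) = r := by
  obtain ⟨r, hr⟩ := h.rank_rhoH
  refine ⟨finrank ℝ EG + r, fun p => ?_⟩
  have := finiteDimensional_fibre F (E := E) (ι p)
  have h₁ := ((𝒞.anchor (ι p)).domRestrict (ρ.K (ι p))).finrank_range_add_finrank_ker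
  rw [LinearMap.range_domRestrict, h.finrank_map_anchor_K] at h₁
  rw [← h₁, ← hr p, ← h.K_inf_ker p, LinearMap.ker_domRestrict,
    ← Submodule.finrank_map_subtype_eq, Submodule.map_comap_subtype]

theorem exists_rank_Kperp : ∃ r : ℕ, ∀ p : P, finrank ℝ (ρ.Kperp (ι p)) = r := by
  obtain ⟨r, hr⟩ := h.exists_rank_K
  refine ⟨finrank ℝ F - r, fun p => ?_⟩
  have := finiteDimensional_fibre F (E := E) (ι p)
  have h₁ := finrank_orthogonal_add (𝒞.form_nondegenerate (ι p)) (ρ.K (ι p))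
  rw [hr, finrank_fibre F] at h₁
  exact Nat.eq_sub_of_add_eq h₁

theorem finrank_redFibre (p : P) :
    finrank ℝ (ρ.RedFibre (ι p)) = 2 * (finrank ℝ EP - finrank ℝ EG) := by
  have := finiteDimensional_fibre F (E := E) (ι p)
  rw [(h.reducedExact p).finrank_eq (redForm_isSymm _)
    (redForm_nondegenerate _ (𝒞.form_nondegenerate _))]
  have h₁ := finrank_redTangent_add (β := 𝒞.form (ι p)) (α := 𝒞.anchor (ι p)) (K := ρ.K (ι p))
  rw [h.finrank_map_anchor_K] at h₁
  rw [Nat.eq_sub_of_add_eq (h₁.trans (h.finrank_bigDistribution p))]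

theorem exists_rank_nullK : ∃ r : ℕ, ∀ p : P, finrank ℝ (ρ.nullK (ι p)) = r := by
  obtain ⟨r, hr⟩ := h.exists_rank_Kperp
  refine ⟨r - 2 * (finrank ℝ EP - finrank ℝ EG), fun p => ?_⟩
  have := finiteDimensional_fibre F (E := E) (ι p)
  have h₁ := finrank_redSpace_add (β := 𝒞.form (ι p)) (K := ρ.K (ι p))
  rw [h.finrank_redFibre p] at h₁
  exact Nat.eq_sub_of_add_eq' (h₁.trans (hr p))

theorem exists_rank_Ktilde : ∃ r : ℕ, ∀ p : P, finrank ℝ (ρ.Ktilde (ι p)) = r := by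
  obtain ⟨r, hr⟩ := h.exists_rank_Kperp
  obtain ⟨k, hk⟩ := h.exists_rank_nullK
  refine ⟨(finrank ℝ F + k - r) / 2, fun p => ?_⟩
  have := finiteDimensional_fibre F (E := E) (ι p)
  have h₁ := Submodule.finrank_sup_add_finrank_inf_eq (ρ.Kperp (ι p)) (ρ.Ktilde (ι p))
  have h₂ : ρ.Kperp (ι p) ⊓ ρ.Ktilde (ι p) = ρ.nullK (ι p) :=
    le_antisymm (fun x hx => ⟨ρ.Ktilde_le_K _ hx.2, hx.1⟩)
      (fun x hx => ⟨hx.2, ρ.nullK_le_Ktilde _ hx⟩)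
  have h₃ : ρ.Kperp (ι p) ⊔ ρ.Ktilde (ι p) =
      (𝒞.form (ι p)).orthogonal (ρ.Ktilde (ι p)) := by
    have h₅ : ρ.nullK (ι p) ≤ ρ.Kperp (ι p) := inf_le_right
    rw [h.orthogonal_Ktilde, h.Ktilde_eq, ← sup_assoc, sup_eq_left.2 h₅]
  have h₄ := finrank_orthogonal_add (𝒞.form_nondegenerate (ι p)) (ρ.Ktilde (ι p))
  rw [h₂, h₃, hr, hk] at h₁
  rw [finrank_fibre F] at h₄
  omega

theorem isSubbundleAt_K (p : P) : IsSubbundleAt EM F ι (fun p => ρ.K (ι p)) p := by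
  obtain ⟨r, hr⟩ := h.exists_rank_K
  refine ⟨?_, Filter.Eventually.of_forall fun p' => by rw [hr, hr]⟩
  rintro _ ⟨a, rfl⟩
  exact ⟨ρ.rho a, rfl, Filter.Eventually.of_forall fun p' => ρ.rho_mem_K a _⟩

theorem isSubbundleAt_Kperp (p : P) : IsSubbundleAt EM F ι (fun p => ρ.Kperp (ι p)) p :=
  (h.isSubbundleAt_K p).orthogonal 𝒞 h.leaf.smooth.continuous

theorem isSubbundleAt_nullK (p : P) : IsSubbundleAt EM F ι (fun p => ρ.nullK (ι p)) p := by
  have := fun m => finiteDimensional_fibre F (E := E) m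
  obtain ⟨r, hr⟩ := h.exists_rank_nullK
  have h₁ : IsSubbundleAt EM F ι (fun p => ρ.K (ι p) ⊔ ρ.Kperp (ι p)) p := by
    refine ⟨(h.isSubbundleAt_K p).hasSections.sup (h.isSubbundleAt_Kperp p).hasSections,
      Filter.Eventually.of_forall fun p' => ?_⟩
    have h₂ := fun q : P => finrank_orthogonal_add (𝒞.form_nondegenerate (ι q))
      (ρ.K (ι q) ⊔ ρ.Kperp (ι q))
    have h₃ := h₂ p
    have h₄ := h₂ p'
    rw [ρ.orthogonal_K_sup_Kperp, hr, finrank_fibre F] at h₃ h₄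
    omega
  have h₂ := h₁.orthogonal 𝒞 h.leaf.smooth.continuous
  simpa only [ρ.orthogonal_K_sup_Kperp] using h₂

theorem isSubbundleAt_rhoH (p : P) : IsSubbundleAt EM F ι (fun p => ρ.rhoH (ι p)) p := by
  obtain ⟨r, hr⟩ := h.rank_rhoH
  refine ⟨?_, Filter.Eventually.of_forall fun p' => by rw [hr, hr]⟩
  rintro _ ⟨a, ha, rfl⟩
  exact ⟨ρ.rho a, rfl, Filter.Eventually.of_forall fun p' => Submodule.mem_map_of_mem ha⟩

theorem isSubbundleAt_Ktilde (p : P) : IsSubbundleAt EM F ι (fun p => ρ.Ktilde (ι p)) p := by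
  obtain ⟨r, hr⟩ := h.exists_rank_Ktilde
  refine ⟨?_, Filter.Eventually.of_forall fun p' => by rw [hr, hr]⟩
  have := (h.isSubbundleAt_nullK p).hasSections.sup (h.isSubbundleAt_rhoH p).hasSections
  simpa only [← h.Ktilde_eq] using this

/-- The symbol `⟨[A, B], C⟩` of sections of `K̃^⊥` vanishes if one of them takes values in `ρ(𝔥)`. -/
theorem form_bracket_rhoH {B C η : Cₛ^∞⟮𝓘(ℝ, EM); F, E⟯} {p : P}
    (hB : ∀ᶠ p' in 𝓝 p, B (ι p') ∈ (𝒞.form (ι p')).orthogonal (ρ.Ktilde (ι p')))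
    (hC : ∀ᶠ p' in 𝓝 p, C (ι p') ∈ (𝒞.form (ι p')).orthogonal (ρ.Ktilde (ι p')))
    (hη : ∀ᶠ p' in 𝓝 p, η (ι p') ∈ ρ.rhoH (ι p')) :
    𝒞.form (ι p) (𝒞.bracket B η (ι p)) (C (ι p)) = 0 ∧
      𝒞.form (ι p) (𝒞.bracket η B (ι p)) (C (ι p)) = 0 := by
  have hzero : ∀ (θ A : Cₛ^∞⟮𝓘(ℝ, EM); F, E⟯), (∀ᶠ p' in 𝓝 p, θ (ι p') ∈ ρ.rhoH (ι p')) →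
      (∀ᶠ p' in 𝓝 p, A (ι p') ∈ (𝒞.form (ι p')).orthogonal (ρ.Ktilde (ι p'))) →
      ∀ᶠ p' in 𝓝 p, 𝒞.form (ι p') (θ (ι p')) (A (ι p')) = 0 := fun θ A hθ hA => by
    filter_upwards [hθ, hA] with p' h₁ h₂
    exact h₂ _ (ρ.rhoH_le_Ktilde h.exact _ h₁)
  have hzero' : ∀ (θ A : Cₛ^∞⟮𝓘(ℝ, EM); F, E⟯), (∀ᶠ p' in 𝓝 p, θ (ι p') ∈ ρ.rhoH (ι p')) →
      (∀ᶠ p' in 𝓝 p, A (ι p') ∈ (𝒞.form (ι p')).orthogonal (ρ.Ktilde (ι p'))) →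
      ∀ᶠ p' in 𝓝 p, 𝒞.form (ι p') (A (ι p')) (θ (ι p')) = 0 := fun θ A hθ hA =>
    (hzero θ A hθ hA).mono fun p' hp' => (𝒞.form_comm _ _ _).trans hp'
  have hBt := h.orthogonal_Ktilde_le p hB.self_of_nhds
  have hCt := h.orthogonal_Ktilde_le p hC.self_of_nhds
  have h₁ : 𝒞.form (ι p) (𝒞.bracket B η (ι p)) (C (ι p)) = 0 := by
    rw [ExtendedAction.form_bracket_eq_neg h.leaf (hzero η C hη hC) hBt]
    obtain ⟨a, ha, ha'⟩ := hη.self_of_nhds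
    have haη : ∀ᶠ p' in 𝓝 p, ρ.rho a (ι p') ∈ ρ.rhoH (ι p') :=
      Filter.Eventually.of_forall fun p' => Submodule.mem_map_of_mem ha
    rw [← ha']
    change - 𝒞.form (ι p) (ρ.rho a (ι p)) _ = 0
    rw [← ExtendedAction.form_bracket_eq_neg h.leaf (hzero _ C haη hC) hBt,
      ExtendedAction.form_bracket_swap h.leaf (hzero' _ B haη hB) hCt, ρ.rho_trivial a ha]
    simp
  refine ⟨h₁, ?_⟩
  rw [ExtendedAction.form_bracket_swap h.leaf (hzero η B hη hB) hCt, h₁, neg_zero]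

end IsReducible

end Leaf

/-! ### Dirac structures -/

namespace CourantAlgebroid

variable {EM : Type*} [NormedAddCommGroup EM] [NormedSpace ℝ EM] [FiniteDimensional ℝ EM]
  {M : Type*} [TopologicalSpace M] [ChartedSpace EM M] [IsManifold 𝓘(ℝ, EM) ∞ M] [T2Space M]
  {F : Type*} [NormedAddCommGroup F] [NormedSpace ℝ F] [FiniteDimensional ℝ F]
  {E : M → Type*} [∀ m, AddCommGroup (E m)] [∀ m, Module ℝ (E m)]
  [TopologicalSpace (TotalSpace F E)] [∀ m, TopologicalSpace (E m)]
  [FiberBundle F E] [VectorBundle ℝ F E] [ContMDiffVectorBundle ∞ F E 𝓘(ℝ, EM)]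
  {𝒞 : CourantAlgebroid EM M F E} {D : ∀ m, Submodule ℝ (E m)}
  (hD : 𝒞.toBracketBundle.IsDirac D)
include hD

theorem orthogonal_dirac (h𝒞 : 𝒞.IsExact) (m : M) : (𝒞.form m).orthogonal (D m) = D m := by
  have := finiteDimensional_fibre F (E := E) m
  exact IsMaximalIsotropic.orthogonal_eq (𝒞.form_symm m) (𝒞.form_nondegenerate m)
    ((h𝒞 m).orthogonal_ker (𝒞.form_symm m)) (hD.maximal_isotropic m)

theorem isSubbundleAt_dirac (m : M) : IsSubbundleAt EM F id D m := by
  refine ⟨fun e he => ?_, hD.rank_locally_constant m⟩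
  obtain ⟨u, hu, huD, rfl⟩ := hD.exists_local_section m e he
  obtain ⟨S, hS⟩ := exists_section_eventuallyEq (EM := EM) (F := F) hu
  refine ⟨S, hS.self_of_nhds, ?_⟩
  filter_upwards [hS, huD] with m' h₁ h₂
  exact h₁ ▸ h₂

theorem exists_dirac_section {m : M} {e : E m} (he : e ∈ D m) :
    ∃ S : Cₛ^∞⟮𝓘(ℝ, EM); F, E⟯, S m = e ∧ ∀ m, S m ∈ D m := by
  obtain ⟨S, rfl, hS⟩ := (isSubbundleAt_dirac hD m).hasSections e he
  obtain ⟨S', hS', h⟩ := (isSubbundleAt_dirac hD m).exists_section_mem continuous_id hS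
  exact ⟨S', h.self_of_nhds, hS'⟩

theorem bracket_mem_dirac {U W : Cₛ^∞⟮𝓘(ℝ, EM); F, E⟯} (hU : ∀ m, U m ∈ D m)
    (hW : ∀ m, W m ∈ D m) (m : M) : 𝒞.bracket U W m ∈ D m := by
  obtain ⟨z, ⟨U', W', hU', hW', hz⟩, hzD⟩ := hD.integrable U W
    (fun b => ⟨Filter.Eventually.of_forall fun m' => U.contMDiff.contMDiffAt, hU b⟩)
    (fun b => ⟨Filter.Eventually.of_forall fun m' => W.contMDiff.contMDiffAt, hW b⟩)
  obtain rfl : U' = U := ContMDiffSection.ext hU'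
  obtain rfl : W' = W := ContMDiffSection.ext hW'
  rw [hz m]
  exact (hzD m).2

end CourantAlgebroid

/-! ### Invariance of the distributions -/

section Leaf

open Module

variable {EG : Type*} [NormedAddCommGroup EG] [NormedSpace ℝ EG] [FiniteDimensional ℝ EG]
  {G : Type*} [TopologicalSpace G] [ChartedSpace EG G] [Group G] [LieGroup 𝓘(ℝ, EG) ∞ G]
  [ConnectedSpace G]
  {EM : Type*} [NormedAddCommGroup EM] [NormedSpace ℝ EM] [FiniteDimensional ℝ EM]
  {M : Type*} [TopologicalSpace M] [ChartedSpace EM M] [IsManifold 𝓘(ℝ, EM) ∞ M] [T2Space M]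
  [MulAction G M] [ContMDiffSMul 𝓘(ℝ, EG) 𝓘(ℝ, EM) ∞ G M]
  {F : Type*} [NormedAddCommGroup F] [NormedSpace ℝ F] [FiniteDimensional ℝ F]
  {E : M → Type*} [∀ m, AddCommGroup (E m)] [∀ m, Module ℝ (E m)]
  [TopologicalSpace (TotalSpace F E)] [∀ m, TopologicalSpace (E m)]
  [FiberBundle F E] [VectorBundle ℝ F E] [ContMDiffVectorBundle ∞ F E 𝓘(ℝ, EM)]
  {𝒞 : CourantAlgebroid EM M F E}
  {𝔞 : Type*} [AddCommGroup 𝔞] [Module ℝ 𝔞] {𝒜 : ExactCourantAlgebra EG G 𝔞}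
  {ρ : ExtendedAction 𝒞 𝒜}
  {EP : Type*} [NormedAddCommGroup EP] [NormedSpace ℝ EP] [FiniteDimensional ℝ EP]
  {P : Type*} [TopologicalSpace P] [ChartedSpace EP P] [IsManifold 𝓘(ℝ, EP) ∞ P]
  [MulAction G P] [ContMDiffSMul 𝓘(ℝ, EG) 𝓘(ℝ, EP) ∞ G P] {ι : P → M}

namespace IsReducible

variable (h : IsReducible ρ EP ι) {g : G} {p p' : P} (hp : g • p = p') (hm : g • ι p = ι p')
include h hp

theorem act_mem_K {v : E (ι p)} (hv : v ∈ ρ.K (ι p)) : ρ.act g hm v ∈ ρ.K (ι p') := by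
  have : ContinuousSMul G P := ContMDiffSMul.continuousSMul (I := 𝓘(ℝ, EG)) (I' := 𝓘(ℝ, EP)) ∞
  obtain ⟨r, hr⟩ := h.exists_rank_K
  refine ρ.act_mem h.equivariant (L := fun p => ρ.K (ι p)) hr ?_ hp hm hv
  rintro p _ ⟨b, rfl⟩
  refine ⟨ρ.rho b, rfl, Filter.Eventually.of_forall fun p' => ⟨ρ.rho_mem_K b _, fun a => ?_⟩⟩
  rw [← ρ.rho_bracket]
  exact ρ.rho_mem_K _ _

theorem act_mem_rhoH {v : E (ι p)} (hv : v ∈ ρ.rhoH (ι p)) : ρ.act g hm v ∈ ρ.rhoH (ι p') := by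
  have : ContinuousSMul G P := ContMDiffSMul.continuousSMul (I := 𝓘(ℝ, EG)) (I' := 𝓘(ℝ, EP)) ∞
  obtain ⟨r, hr⟩ := h.rank_rhoH
  refine ρ.act_mem h.equivariant (L := fun p => ρ.rhoH (ι p)) hr ?_ hp hm hv
  rintro p _ ⟨b, hb, rfl⟩
  refine ⟨ρ.rho b, rfl, Filter.Eventually.of_forall fun p' =>
    ⟨Submodule.mem_map_of_mem hb, fun a => ?_⟩⟩
  rw [← ρ.rho_bracket]
  refine Submodule.mem_map_of_mem (f := ρ.rhoAt (ι p')) ?_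
  have hb' : 𝒜.proj b = 0 := hb
  rw [LinearMap.mem_ker, 𝒜.proj_bracket, hb', GroupLieAlgebra.bracket_def]
  have h₀ : mulInvariantVectorField (0 : GroupLieAlgebra 𝓘(ℝ, EG) G) = 0 := by
    funext g
    exact map_zero _
  rw [h₀]
  simp

theorem act_mem_Kperp {v : E (ι p)} (hv : v ∈ ρ.Kperp (ι p)) :
    ρ.act g hm v ∈ ρ.Kperp (ι p') := by
  have : ContinuousSMul G P := ContMDiffSMul.continuousSMul (I := 𝓘(ℝ, EG)) (I' := 𝓘(ℝ, EP)) ∞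
  obtain ⟨r, hr⟩ := h.exists_rank_Kperp
  refine ρ.act_mem h.equivariant (L := fun p => ρ.Kperp (ι p)) hr ?_ hp hm hv
  intro p e he
  obtain ⟨X, rfl, hX⟩ := (h.isSubbundleAt_Kperp p).hasSections e he
  refine ⟨X, rfl, ?_⟩
  filter_upwards [hX.eventually_nhds] with p' hp'
  exact ⟨hp'.self_of_nhds, ExtendedAction.bracket_rho_mem_Kperp h.leaf hp'⟩

theorem act_mem_nullK {v : E (ι p)} (hv : v ∈ ρ.nullK (ι p)) : ρ.act g hm v ∈ ρ.nullK (ι p') :=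
  ⟨h.act_mem_K hp hm hv.1, h.act_mem_Kperp hp hm hv.2⟩

theorem act_mem_Ktilde {v : E (ι p)} (hv : v ∈ ρ.Ktilde (ι p)) :
    ρ.act g hm v ∈ ρ.Ktilde (ι p') := by
  rw [h.Ktilde_eq] at hv ⊢
  obtain ⟨a, ha, b, hb, rfl⟩ := Submodule.mem_sup.1 hv
  rw [map_add]
  exact Submodule.add_mem_sup (h.act_mem_nullK hp hm ha) (h.act_mem_rhoH hp hm hb)

theorem act_mem_orthogonal_Ktilde {v : E (ι p)}
    (hv : v ∈ (𝒞.form (ι p)).orthogonal (ρ.Ktilde (ι p))) :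
    ρ.act g hm v ∈ (𝒞.form (ι p')).orthogonal (ρ.Ktilde (ι p')) := by
  rw [h.orthogonal_Ktilde] at hv ⊢
  obtain ⟨a, ha, b, hb, rfl⟩ := Submodule.mem_sup.1 hv
  rw [map_add]
  exact Submodule.add_mem_sup (h.act_mem_Kperp hp hm ha) (h.act_mem_rhoH hp hm hb)

theorem act_mem_dirac {D : ∀ m, Submodule ℝ (E m)} (hD : 𝒞.toBracketBundle.IsDirac D)
    (hρD : ρ.Preserves D) {v : E (ι p)} (hv : v ∈ D (ι p)) : ρ.act g hm v ∈ D (ι p') := by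
  have : ContinuousSMul G P := ContMDiffSMul.continuousSMul (I := 𝓘(ℝ, EG)) (I' := 𝓘(ℝ, EP)) ∞
  refine ρ.act_mem h.equivariant (L := fun p => D (ι p)) (r := finrank ℝ F / 2) (fun p => ?_) ?_
    hp hm hv
  · have := finiteDimensional_fibre F (E := E) (ι p)
    have h₁ := two_mul_finrank_of_orthogonal_eq (𝒞.form_nondegenerate (ι p))
      (CourantAlgebroid.orthogonal_dirac hD h.exact (ι p))
    rw [finrank_fibre F] at h₁
    omega
  · intro p e he
    obtain ⟨S, rfl, hS⟩ := CourantAlgebroid.exists_dirac_section hD he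
    exact ⟨S, rfl, Filter.Eventually.of_forall fun p' => ⟨hS _, fun a => hρD a S hS _⟩⟩

end IsReducible

/-! ### Representatives of elements of the reduced bundle -/

namespace ExtendedAction

omit [ContMDiffSMul 𝓘(ℝ, EG) 𝓘(ℝ, EP) ∞ G P] in
theorem representsAt_iff (hι : ∀ (g : G) (p : P), ι (g • p) = g • ι p)
    {u : ∀ b, ρ.RedBundle hι b} {p : P} {b : MulAction.orbitRel.Quotient G P}
    (hb : (Quotient.mk'' p : MulAction.orbitRel.Quotient G P) = b) {e : E (ι p)} :
    ρ.RepresentsAt hι u p e ↔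
      Represents (𝒞.form (ι p)) (ρ.K (ι p)) e (ρ.evalAt hι b p hb (u b)) := by
  subst hb
  rfl

theorem mk_eq_of_smul_eq {g : G} {p p' : P} (hp : g • p = p') :
    (Quotient.mk'' p' : MulAction.orbitRel.Quotient G P) = Quotient.mk'' p :=
  Quotient.sound' (MulAction.orbitRel_apply.2 ⟨g, hp⟩)

end ExtendedAction

namespace IsReducible

variable (h : IsReducible ρ EP ι)
include h

theorem represents_act {b : MulAction.orbitRel.Quotient G P} (s : ρ.RedBundle h.equivariant b)
    {p p' : P} (hb : (Quotient.mk'' p : MulAction.orbitRel.Quotient G P) = b)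
    (hb' : (Quotient.mk'' p' : MulAction.orbitRel.Quotient G P) = b) {g : G}
    (hp : g • p = p') (hm : g • ι p = ι p') {e : E (ι p)}
    (he : Represents (𝒞.form (ι p)) (ρ.K (ι p)) e (ρ.evalAt h.equivariant b p hb s)) :
    Represents (𝒞.form (ι p')) (ρ.K (ι p')) (ρ.act g hm e)
      (ρ.evalAt h.equivariant b p' hb' s) := by
  obtain ⟨v, hv, hgv⟩ := s.2 ⟨p, hb⟩ ⟨p', hb'⟩ g hp
  refine Represents.of_sub_mem hgv ?_
  rw [← map_sub]
  exact h.act_mem_nullK hp hm (Represents.sub_mem_inf he hv)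

theorem representsAt_act {u : ∀ b, ρ.RedBundle h.equivariant b} {g : G} {p p' : P}
    (hp : g • p = p') (hm : g • ι p = ι p') {e : E (ι p)}
    (he : ρ.RepresentsAt h.equivariant u p e) :
    ρ.RepresentsAt h.equivariant u p' (ρ.act g hm e) :=
  (ExtendedAction.representsAt_iff h.equivariant (ExtendedAction.mk_eq_of_smul_eq hp)).2
    (h.represents_act _ rfl (ExtendedAction.mk_eq_of_smul_eq hp) hp hm he)

theorem evalAt_injective {b : MulAction.orbitRel.Quotient G P} {p : P}
    (hb : (Quotient.mk'' p : MulAction.orbitRel.Quotient G P) = b) :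
    Function.Injective (ρ.evalAt h.equivariant b p hb) := by
  refine (injective_iff_map_eq_zero _).2 fun s hs => ?_
  refine Subtype.ext (funext fun ⟨p', hp'⟩ => ?_)
  obtain ⟨g, hg⟩ := MulAction.orbitRel_apply.1 (Quotient.exact' (hp'.trans hb.symm))
  have hm : g • ι p = ι p' := by rw [← h.equivariant]; exact congrArg ι hg
  have h₁ := h.represents_act s hb hp' hg hm (e := 0) (by rw [hs]; exact Represents.zero _ _)
  rw [map_zero] at h₁
  exact h₁.eq (Represents.zero _ _)

theorem evalAt_surjective {b : MulAction.orbitRel.Quotient G P} {p : P}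
    (hb : (Quotient.mk'' p : MulAction.orbitRel.Quotient G P) = b) :
    Function.Surjective (ρ.evalAt h.equivariant b p hb) := by
  intro c
  obtain ⟨v, hv⟩ := exists_represents c
  have hg : ∀ q : {q : P // (Quotient.mk'' q : MulAction.orbitRel.Quotient G P) = b},
      ∃ g : G, g • p = q.1 := fun q =>
    MulAction.orbitRel_apply.1 (Quotient.exact' (q.2.trans hb.symm))
  choose g hg using hg
  have hm : ∀ q, g q • ι p = ι q.1 := fun q => by rw [← h.equivariant, hg]
  have hunique : ∀ (k l : G) (q : P), k • p = q → l • p = q → k = l := fun k l q hk hl => by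
    have := h.free (l⁻¹ * k) p (by rw [mul_smul, hk, ← hl, inv_smul_smul])
    rw [inv_mul_eq_one] at this
    exact this.symm
  have hact : ∀ (k l : G) (q : P) (hk : k • ι p = ι q) (hl : l • ι p = ι q), k = l →
      ρ.act k hk v = ρ.act l hl v := by
    rintro k _ q hk hl rfl
    rfl
  have hmem : ∀ q, ρ.act (g q) (hm q) v ∈ ρ.Kperp (ι q.1) := fun q =>
    h.act_mem_Kperp (hg q) (hm q) hv.mem
  refine ⟨⟨fun q => (redKernel (𝒞.form (ι q.1)) (ρ.K (ι q.1))).mkQ ⟨ρ.act (g q) (hm q) v, hmem q⟩,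
    fun q q' k hk => ⟨ρ.act (g q) (hm q) v, represents_mk _, ?_⟩⟩, ?_⟩
  · have hk' : k • ι q.1 = ι q'.1 := by rw [← h.equivariant, hk]
    rw [← ρ.act_mul k (g q) (hm q) hk' (by rw [mul_smul, hm, hk']),
      hact _ (g q') _ _ (hm q') (hunique _ _ q'.1 (by rw [mul_smul, hg, hk]) (hg q'))]
    exact represents_mk _
  · have h₁ : ρ.act (g ⟨p, hb⟩) (hm ⟨p, hb⟩) v = v := by
      rw [hact _ 1 p _ (one_smul _ _) (h.free _ _ (hg ⟨p, hb⟩)), ρ.act_one]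
    have h₂ := represents_mk (hmem ⟨p, hb⟩)
    refine Represents.eq h₂ ?_
    dsimp only
    rw [h₁]
    exact hv

/-- A section that represents a section of the reduced bundle is invariant. -/
theorem isInvariantNear_of_representsAt {u : ∀ b, ρ.RedBundle h.equivariant b} {p : P}
    {U : Cₛ^∞⟮𝓘(ℝ, EM); F, E⟯}
    (hU : ∀ᶠ p' in 𝓝 p, ρ.RepresentsAt h.equivariant u p' (U (ι p'))) :
    ρ.IsInvariantNear ι U p := by
  have : ContinuousSMul G P := ContMDiffSMul.continuousSMul (I := 𝓘(ℝ, EG)) (I' := 𝓘(ℝ, EP)) ∞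
  have : IsTopologicalGroup G := topologicalGroup_of_lieGroup 𝓘(ℝ, EG) ∞
  filter_upwards [hU.eventually_nhds] with p' hp'
  refine ⟨hp'.self_of_nhds.mem, fun a => ?_⟩
  by_contra hn
  obtain ⟨φ, hφ, hφ'⟩ := Submodule.exists_dual_map_eq_bot_of_notMem hn inferInstance
  have hφ₀ : ∀ x ∈ ρ.nullK (ι p'), φ x = 0 := fun x hx => by
    have := Submodule.mem_map_of_mem (f := φ) hx
    rwa [hφ', Submodule.mem_bot] at this
  have hcont : Filter.Tendsto (fun g : G => g⁻¹ • p') (𝓝 1) (𝓝 p') := by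
    have : ContinuousAt (fun g : G => g⁻¹ • p') 1 :=
      (continuous_inv.smul continuous_const).continuousAt
    simpa [ContinuousAt] using this
  have hconst : ∀ᶠ g in 𝓝 (1 : G), φ (ρ.translate U (1 * g) (ι p')) = φ (U (ι p')) := by
    filter_upwards [hcont.eventually hp'] with g hg
    have hm : g • ι (g⁻¹ • p') = ι p' := by rw [← h.equivariant, smul_inv_smul]
    have h₁ := h.representsAt_act (smul_inv_smul g p') hm hg
    have h₂ := hφ₀ _ (h₁.sub_mem_inf hp'.self_of_nhds)
    rw [map_sub, sub_eq_zero] at h₂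
    rw [one_mul, ← ρ.act_eq_translate U hm]
    exact h₂
  have h₁ := ρ.left_deriv_translate a U 1 (ι p') φ
  rw [ρ.translate_one] at h₁
  refine hφ (h₁.symm.trans ?_)
  rw [dirDeriv_congr hconst]
  exact congrArg (fun L => L (𝒜.proj a)) (hasMFDerivAt_const (I := 𝓘(ℝ, EG)) (I' := 𝓘(ℝ, ℝ))
    (φ (U (ι p'))) (1 : G)).mfderiv

end IsReducible

end Leaf

/-! ### The bracket of sections of the reduced bundle -/

theorem mem_of_forall_dual {V : Type*} [AddCommGroup V] [Module ℝ V] {W : Submodule ℝ V} {x : V}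
    (hx : ∀ φ : Module.Dual ℝ V, (∀ y ∈ W, φ y = 0) → φ x = 0) : x ∈ W := by
  by_contra hn
  obtain ⟨φ, hφ, hφ'⟩ := Submodule.exists_dual_map_eq_bot_of_notMem hn inferInstance
  refine hφ (hx φ fun y hy => ?_)
  have := Submodule.mem_map_of_mem (f := φ) hy
  rwa [hφ', Submodule.mem_bot] at this

section Leaf

open Module

variable {EG : Type*} [NormedAddCommGroup EG] [NormedSpace ℝ EG] [FiniteDimensional ℝ EG]
  {G : Type*} [TopologicalSpace G] [ChartedSpace EG G] [Group G] [LieGroup 𝓘(ℝ, EG) ∞ G]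
  [ConnectedSpace G]
  {EM : Type*} [NormedAddCommGroup EM] [NormedSpace ℝ EM] [FiniteDimensional ℝ EM]
  {M : Type*} [TopologicalSpace M] [ChartedSpace EM M] [IsManifold 𝓘(ℝ, EM) ∞ M] [T2Space M]
  [MulAction G M] [ContMDiffSMul 𝓘(ℝ, EG) 𝓘(ℝ, EM) ∞ G M]
  {F : Type*} [NormedAddCommGroup F] [NormedSpace ℝ F] [FiniteDimensional ℝ F]
  {E : M → Type*} [∀ m, AddCommGroup (E m)] [∀ m, Module ℝ (E m)]
  [TopologicalSpace (TotalSpace F E)] [∀ m, TopologicalSpace (E m)]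
  [FiberBundle F E] [VectorBundle ℝ F E] [ContMDiffVectorBundle ∞ F E 𝓘(ℝ, EM)]
  {𝒞 : CourantAlgebroid EM M F E}
  {𝔞 : Type*} [AddCommGroup 𝔞] [Module ℝ 𝔞] {𝒜 : ExactCourantAlgebra EG G 𝔞}
  {ρ : ExtendedAction 𝒞 𝒜}
  {EP : Type*} [NormedAddCommGroup EP] [NormedSpace ℝ EP] [FiniteDimensional ℝ EP]
  {P : Type*} [TopologicalSpace P] [ChartedSpace EP P] [IsManifold 𝓘(ℝ, EP) ∞ P]
  [MulAction G P] [ContMDiffSMul 𝓘(ℝ, EG) 𝓘(ℝ, EP) ∞ G P] {ι : P → M}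

namespace IsReducible

variable (h : IsReducible ρ EP ι)
include h

theorem exists_section_represents {u : ∀ b, ρ.RedBundle h.equivariant b} {p : P}
    (hu : (ρ.reducedCourant h.equivariant (EP := EP)).SmoothNear u (Quotient.mk'' p)) :
    ∃ U : Cₛ^∞⟮𝓘(ℝ, EM); F, E⟯,
      ∀ᶠ p' in 𝓝 p, ρ.RepresentsAt h.equivariant u p' (U (ι p')) := by
  obtain ⟨v, hv⟩ := hu p rfl
  obtain ⟨U, hU⟩ := exists_section_extension h.leaf.immersion h.leaf.smooth
    (hv.mono fun p' hp' => hp'.1)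
  refine ⟨U, ?_⟩
  filter_upwards [hv, hU] with p' h₁ h₂
  rw [h₂]
  exact h₁.2

theorem isNullNear_sub {u : ∀ b, ρ.RedBundle h.equivariant b} {p : P}
    {U U' : Cₛ^∞⟮𝓘(ℝ, EM); F, E⟯}
    (hU : ∀ᶠ p' in 𝓝 p, ρ.RepresentsAt h.equivariant u p' (U (ι p')))
    (hU' : ∀ᶠ p' in 𝓝 p, ρ.RepresentsAt h.equivariant u p' (U' (ι p'))) :
    ρ.IsNullNear ι (U' - U) p := by
  filter_upwards [hU, hU'] with p' h₁ h₂
  exact h₂.sub_mem_inf h₁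

theorem eventually_hasSectionsAt_Kperp (p : P) :
    ∀ᶠ p' in 𝓝 p, HasSectionsAt EM F ι (fun p => ρ.Kperp (ι p)) p' :=
  Filter.Eventually.of_forall fun p' => (h.isSubbundleAt_Kperp p').hasSections

theorem bracket_sub_bracket_mem {u w : ∀ b, ρ.RedBundle h.equivariant b} {p : P}
    {U U' W W' : Cₛ^∞⟮𝓘(ℝ, EM); F, E⟯}
    (hU : ∀ᶠ p' in 𝓝 p, ρ.RepresentsAt h.equivariant u p' (U (ι p')))
    (hU' : ∀ᶠ p' in 𝓝 p, ρ.RepresentsAt h.equivariant u p' (U' (ι p')))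
    (hW : ∀ᶠ p' in 𝓝 p, ρ.RepresentsAt h.equivariant w p' (W (ι p')))
    (hW' : ∀ᶠ p' in 𝓝 p, ρ.RepresentsAt h.equivariant w p' (W' (ι p'))) :
    𝒞.bracket U' W' (ι p) - 𝒞.bracket U W (ι p) ∈ ρ.nullK (ι p) :=
  ExtendedAction.IsInvariantNear.bracket_sub_bracket_mem h.leaf
    (h.eventually_hasSectionsAt_Kperp p) (h.isInvariantNear_of_representsAt hU)
    (h.isInvariantNear_of_representsAt hW) (h.isNullNear_sub hU hU') (h.isNullNear_sub hW hW')

/-- The brackets of local representatives form a section of the reduced bundle. -/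
theorem exists_bracket_section {u w : ∀ b, ρ.RedBundle h.equivariant b}
    (hu : ∀ b, (ρ.reducedCourant h.equivariant (EP := EP)).SmoothNear u b)
    (hw : ∀ b, (ρ.reducedCourant h.equivariant (EP := EP)).SmoothNear w b) :
    ∃ z : ∀ b, ρ.RedBundle h.equivariant b, ∀ (p : P) (U W : Cₛ^∞⟮𝓘(ℝ, EM); F, E⟯),
      (∀ᶠ p' in 𝓝 p, ρ.RepresentsAt h.equivariant u p' (U (ι p'))) →
      (∀ᶠ p' in 𝓝 p, ρ.RepresentsAt h.equivariant w p' (W (ι p'))) →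
      ρ.RepresentsAt h.equivariant z p (𝒞.bracket U W (ι p)) := by
  have : ContinuousSMul G P := ContMDiffSMul.continuousSMul (I := 𝓘(ℝ, EG)) (I' := 𝓘(ℝ, EP)) ∞
  have : IsTopologicalGroup G := topologicalGroup_of_lieGroup 𝓘(ℝ, EG) ∞
  choose U hU using fun p : P => h.exists_section_represents (hu (Quotient.mk'' p))
  choose W hW using fun p : P => h.exists_section_represents (hw (Quotient.mk'' p))
  let Z : P → Cₛ^∞⟮𝓘(ℝ, EM); F, E⟯ := fun p => 𝒞.bracket (U p) (W p)
  have hZ : ∀ p, ρ.IsInvariantNear ι (Z p) p := fun p =>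
    ExtendedAction.IsInvariantNear.bracket h.leaf (h.eventually_hasSectionsAt_Kperp p)
      (h.isInvariantNear_of_representsAt (hU p)) (h.isInvariantNear_of_representsAt (hW p))
  have key : ∀ (q : P) (φ : Module.Dual ℝ (E (ι q))), (∀ y ∈ ρ.nullK (ι q), φ y = 0) →
      ∀ g : G, φ (ρ.translate (Z (g⁻¹ • q)) g (ι q)) = φ (Z q (ι q)) := by
    intro q φ hφ g
    have hloc : IsLocallyConstant fun g : G => φ (ρ.translate (Z (g⁻¹ • q)) g (ι q)) := by
      rw [IsLocallyConstant.iff_eventually_eq]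
      intro g₀
      have hcont : Filter.Tendsto (fun g : G => g⁻¹ • q) (𝓝 g₀) (𝓝 (g₀⁻¹ • q)) :=
        (continuous_inv.smul continuous_const).tendsto g₀
      have hm : ∀ g : G, g • ι (g⁻¹ • q) = ι q := fun g => by
        rw [← h.equivariant, smul_inv_smul]
      have h₁ := ρ.eventually_translate_eq (Z (g₀⁻¹ • q)) (g₀ := g₀) φ (by
        filter_upwards [hcont.eventually (hZ (g₀⁻¹ • q))] with g hg a
        rw [← ρ.act_eq_translate _ (hm g)]
        exact hφ _ (h.act_mem_nullK (smul_inv_smul g q) (hm g) (hg.2 a)))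
      filter_upwards [h₁, hcont.eventually (hU (g₀⁻¹ • q)).eventually_nhds,
        hcont.eventually (hW (g₀⁻¹ • q)).eventually_nhds] with g h₂ h₃ h₄
      rw [← h₂, ← sub_eq_zero, ← map_sub, ← ρ.act_eq_translate _ (hm g),
        ← ρ.act_eq_translate _ (hm g), ← map_sub]
      exact hφ _ (h.act_mem_nullK (smul_inv_smul g q) (hm g)
        (h.bracket_sub_bracket_mem h₃ (hU _) h₄ (hW _)))
    have h₁ := hloc.apply_eq_of_preconnectedSpace g 1
    simpa only [inv_one, one_smul, ρ.translate_one] using h₁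
  have hmem : ∀ p, Z p (ι p) ∈ (𝒞.form (ι p)).orthogonal (ρ.K (ι p)) := fun p =>
    (hZ p).self_of_nhds.1
  choose z hz using fun b : MulAction.orbitRel.Quotient G P =>
    h.evalAt_surjective (p := b.out) b.out_eq'
      ((redKernel (𝒞.form (ι b.out)) (ρ.K (ι b.out))).mkQ ⟨Z b.out (ι b.out), hmem b.out⟩)
  refine ⟨z, fun p U' W' hU' hW' => ?_⟩
  have h₁ : ρ.RepresentsAt h.equivariant z p (Z p (ι p)) := by
    set b : MulAction.orbitRel.Quotient G P := Quotient.mk'' p with hb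
    obtain ⟨g, hg⟩ := MulAction.orbitRel_apply.1 (Quotient.exact' (hb.symm.trans b.out_eq'.symm))
    have hg' : g • b.out = p := hg
    have hm : g • ι b.out = ι p := by rw [← h.equivariant, hg']
    have h₂ := represents_mk (hmem b.out)
    rw [← hz b] at h₂
    refine (h.represents_act (z b) b.out_eq' rfl hg hm h₂).of_sub_mem ?_
    refine mem_of_forall_dual fun φ hφ => ?_
    have hgp : g⁻¹ • p = b.out := by rw [← hg', inv_smul_smul]
    have h₃ := key p φ hφ g
    rw [hgp, ← ρ.act_eq_translate _ hm] at h₃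
    rw [map_sub, h₃, sub_self]
  exact h₁.of_sub_mem (h.bracket_sub_bracket_mem (hU p) hU' (hW p) hW')

theorem smoothNear_of_represents {z : ∀ b, ρ.RedBundle h.equivariant b}
    (hz : ∀ p : P, ∃ Z : Cₛ^∞⟮𝓘(ℝ, EM); F, E⟯,
      ∀ᶠ p' in 𝓝 p, ρ.RepresentsAt h.equivariant z p' (Z (ι p')))
    (b : MulAction.orbitRel.Quotient G P) :
    (ρ.reducedCourant h.equivariant (EP := EP)).SmoothNear z b := by
  intro p _
  obtain ⟨Z, hZ⟩ := hz p
  refine ⟨fun p => Z (ι p), hZ.mono fun p' hp' => ⟨?_, hp'⟩⟩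
  exact (Z.contMDiff.comp h.leaf.smooth).contMDiffAt

end IsReducible

end Leaf

/-! ### The reduced Dirac structure -/

/-- A bounded lower semicontinuous function with values in `ℕ` is locally constant on a dense
set. -/
theorem frequently_eventually_eq {X : Type*} [TopologicalSpace X] {f : X → ℕ} {n : ℕ}
    (hn : ∀ x, f x ≤ n) (hf : ∀ x, ∀ᶠ y in 𝓝 x, f x ≤ f y) (x : X) :
    ∃ᶠ y in 𝓝 x, ∀ᶠ z in 𝓝 y, f z = f y := by
  rw [Filter.frequently_iff]
  intro U hU
  obtain ⟨V, hVU, hV, hxV⟩ := mem_nhds_iff.1 hU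
  obtain ⟨y, hyV, hy⟩ := (measure fun z => n - f z).wf.has_min V ⟨x, hxV⟩
  refine ⟨y, hVU hyV, ?_⟩
  filter_upwards [hV.mem_nhds hyV, hf y] with z hz hz'
  have h₁ : ¬ n - f z < n - f y := hy z hz
  have h₂ := hn z
  omega

section Leaf

open Module

variable {EG : Type*} [NormedAddCommGroup EG] [NormedSpace ℝ EG] [FiniteDimensional ℝ EG]
  {G : Type*} [TopologicalSpace G] [ChartedSpace EG G] [Group G] [LieGroup 𝓘(ℝ, EG) ∞ G]
  [ConnectedSpace G]
  {EM : Type*} [NormedAddCommGroup EM] [NormedSpace ℝ EM] [FiniteDimensional ℝ EM]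
  {M : Type*} [TopologicalSpace M] [ChartedSpace EM M] [IsManifold 𝓘(ℝ, EM) ∞ M] [T2Space M]
  [MulAction G M] [ContMDiffSMul 𝓘(ℝ, EG) 𝓘(ℝ, EM) ∞ G M]
  {F : Type*} [NormedAddCommGroup F] [NormedSpace ℝ F] [FiniteDimensional ℝ F]
  {E : M → Type*} [∀ m, AddCommGroup (E m)] [∀ m, Module ℝ (E m)]
  [TopologicalSpace (TotalSpace F E)] [∀ m, TopologicalSpace (E m)]
  [FiberBundle F E] [VectorBundle ℝ F E] [ContMDiffVectorBundle ∞ F E 𝓘(ℝ, EM)]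
  {𝒞 : CourantAlgebroid EM M F E}
  {𝔞 : Type*} [AddCommGroup 𝔞] [Module ℝ 𝔞] {𝒜 : ExactCourantAlgebra EG G 𝔞}
  {ρ : ExtendedAction 𝒞 𝒜}
  {EP : Type*} [NormedAddCommGroup EP] [NormedSpace ℝ EP] [FiniteDimensional ℝ EP]
  {P : Type*} [TopologicalSpace P] [ChartedSpace EP P] [IsManifold 𝓘(ℝ, EP) ∞ P]
  [MulAction G P] [ContMDiffSMul 𝓘(ℝ, EG) 𝓘(ℝ, EP) ∞ G P] {ι : P → M}

/-- The distribution `D ∩ K̃^⊥ + K̃`. -/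
def ExtendedAction.reduction (ρ : ExtendedAction 𝒞 𝒜) (D : ∀ m, Submodule ℝ (E m)) (m : M) :
    Submodule ℝ (E m) :=
  D m ⊓ (𝒞.form m).orthogonal (ρ.Ktilde m) ⊔ ρ.Ktilde m

namespace IsReducible

variable (h : IsReducible ρ EP ι) {D : ∀ m, Submodule ℝ (E m)}
  (hD : 𝒞.toBracketBundle.IsDirac D)
include h

theorem mem_redSubspace_iff {p : P} {e : E (ι p)} {c : ρ.RedFibre (ι p)}
    (he : Represents (𝒞.form (ι p)) (ρ.K (ι p)) e c) :
    c ∈ redSubspace (𝒞.form (ι p)) (𝒞.anchor (ι p)) (ρ.K (ι p)) (D (ι p)) ↔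
      e ∈ ρ.reduction D (ι p) := by
  have := finiteDimensional_fibre F (E := E) (ι p)
  exact Represents.mem_redSubspace_iff (𝒞.form_symm _) (𝒞.form_nondegenerate _) (h.exact _)
    (h.reducedExact p) he

theorem reduction_le (p : P) :
    ρ.reduction D (ι p) ≤ (𝒞.form (ι p)).orthogonal (ρ.Ktilde (ι p)) :=
  sup_le inf_le_right (h.Ktilde_le_orthogonal p)

theorem exists_mem_Kperp_add {p : P} {y : E (ι p)} (hy : y ∈ ρ.reduction D (ι p)) :
    ∃ x ∈ ρ.Kperp (ι p) ⊓ ρ.reduction D (ι p), ∃ t ∈ ρ.Ktilde (ι p), y = x + t := by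
  have h₁ := h.reduction_le p hy
  rw [h.orthogonal_Ktilde] at h₁
  obtain ⟨x, hx, t, ht, rfl⟩ := Submodule.mem_sup.1 h₁
  have ht' := ρ.rhoH_le_Ktilde h.exact _ ht
  refine ⟨x, ⟨hx, ?_⟩, t, ht', rfl⟩
  have h₂ : t ∈ ρ.reduction D (ι p) := Submodule.mem_sup_right ht'
  have h₃ := sub_mem hy h₂
  rwa [add_sub_cancel_right] at h₃

include hD

theorem orthogonal_reduction (p : P) :
    (𝒞.form (ι p)).orthogonal (ρ.reduction D (ι p)) = ρ.reduction D (ι p) := by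
  have := finiteDimensional_fibre F (E := E) (ι p)
  exact CourantReduction.orthogonal_reduction (𝒞.form_symm _) (𝒞.form_nondegenerate _)
    (h.exact _) (h.reducedExact p) (CourantAlgebroid.orthogonal_dirac hD h.exact _)

theorem two_mul_finrank_reduction (p : P) :
    2 * finrank ℝ (ρ.reduction D (ι p)) = finrank ℝ F := by
  have := finiteDimensional_fibre F (E := E) (ι p)
  rw [two_mul_finrank_of_orthogonal_eq (𝒞.form_nondegenerate _) (h.orthogonal_reduction hD p),
    finrank_fibre F]

theorem orthogonal_dirac_sup_Ktilde (m : M) :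
    (𝒞.form m).orthogonal (D m ⊔ ρ.Ktilde m) =
      D m ⊓ (𝒞.form m).orthogonal (ρ.Ktilde m) := by
  rw [orthogonal_sup_eq, CourantAlgebroid.orthogonal_dirac hD h.exact]

theorem hasSectionsAt_dirac (p : P) : HasSectionsAt EM F ι (fun p => D (ι p)) p := by
  intro e he
  obtain ⟨S, hS, hSD⟩ := CourantAlgebroid.exists_dirac_section hD he
  exact ⟨S, hS, Filter.Eventually.of_forall fun p' => hSD _⟩

/-- Where `D + K̃` has locally constant rank, the intersection `D ∩ K̃^⊥` is a subbundle. -/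
theorem isSubbundleAt_dirac_inf {p : P}
    (hp : ∀ᶠ p' in 𝓝 p, finrank ℝ ↥(D (ι p') ⊔ ρ.Ktilde (ι p')) =
      finrank ℝ ↥(D (ι p) ⊔ ρ.Ktilde (ι p))) :
    IsSubbundleAt EM F ι
      (fun p => D (ι p) ⊓ (𝒞.form (ι p)).orthogonal (ρ.Ktilde (ι p))) p := by
  have h₁ : IsSubbundleAt EM F ι (fun p => D (ι p) ⊔ ρ.Ktilde (ι p)) p :=
    ⟨(h.hasSectionsAt_dirac hD p).sup (h.isSubbundleAt_Ktilde p).hasSections, hp⟩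
  have h₂ := h₁.orthogonal 𝒞 h.leaf.smooth.continuous
  simpa only [h.orthogonal_dirac_sup_Ktilde hD] using h₂

/-- A section of `D ∩ K̃^⊥ + K̃` splits, up to a section of `ρ(𝔥)`, into sections of `D` and of
`K ∩ K^⊥`. -/
theorem exists_decomposition {p : P}
    (hA : IsSubbundleAt EM F ι
      (fun p => D (ι p) ⊓ (𝒞.form (ι p)).orthogonal (ρ.Ktilde (ι p))) p)
    {U : Cₛ^∞⟮𝓘(ℝ, EM); F, E⟯} (hU : ∀ᶠ p' in 𝓝 p, U (ι p') ∈ ρ.reduction D (ι p')) :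
    ∃ d k : Cₛ^∞⟮𝓘(ℝ, EM); F, E⟯, (∀ m, d m ∈ D m) ∧
      (∀ᶠ p' in 𝓝 p, d (ι p') ∈ (𝒞.form (ι p')).orthogonal (ρ.Ktilde (ι p'))) ∧
      ρ.IsNullNear ι k p ∧ ∀ᶠ p' in 𝓝 p, (U - d - k) (ι p') ∈ ρ.rhoH (ι p') := by
  have hc := h.leaf.smooth.continuous
  obtain ⟨d₁, k₁, hd₁, hk₁, hdk⟩ := hA.hasSections.exists_split
    (h.isSubbundleAt_Ktilde p).hasSections hc (Filter.Eventually.of_forall fun p' => by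
      have h₁ := h.two_mul_finrank_reduction hD p
      have h₂ := h.two_mul_finrank_reduction hD p'
      rw [ExtendedAction.reduction] at h₁ h₂
      omega) hU
  obtain ⟨r, hr⟩ := h.exists_rank_Ktilde
  obtain ⟨k, η, hk, hη, hkη⟩ := (h.isSubbundleAt_nullK p).hasSections.exists_split
    (h.isSubbundleAt_rhoH p).hasSections hc (Filter.Eventually.of_forall fun p' => by
      rw [← h.Ktilde_eq, ← h.Ktilde_eq, hr, hr]) (U := k₁) (hk₁.mono fun p' hp' => by
      rwa [← h.Ktilde_eq])
  obtain ⟨d, hd, hdd⟩ := (CourantAlgebroid.isSubbundleAt_dirac hD (ι p)).exists_section_mem hc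
    (hd₁.mono fun p' hp' => hp'.1)
  refine ⟨d, k, hd, ?_, hk, ?_⟩
  · filter_upwards [hd₁, hdd] with p' h₁ h₂
    rw [h₂]
    exact h₁.2
  · filter_upwards [hdk, hkη, hη, hdd] with p' h₁ h₂ h₃ h₄
    simp only [ContMDiffSection.coe_sub, Pi.sub_apply]
    rw [h₁, h₂, h₄, add_sub_cancel_left, add_sub_cancel_left]
    exact h₃

theorem form_bracket_eq_zero {p : P}
    (hp : ∀ᶠ p' in 𝓝 p, finrank ℝ ↥(D (ι p') ⊔ ρ.Ktilde (ι p')) =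
      finrank ℝ ↥(D (ι p) ⊔ ρ.Ktilde (ι p)))
    {U W : Cₛ^∞⟮𝓘(ℝ, EM); F, E⟯} (hU : ρ.IsInvariantNear ι U p) (hW : ρ.IsInvariantNear ι W p)
    (hU' : ∀ᶠ p' in 𝓝 p, U (ι p') ∈ ρ.reduction D (ι p'))
    (hW' : ∀ᶠ p' in 𝓝 p, W (ι p') ∈ ρ.reduction D (ι p'))
    {y : E (ι p)} (hy : y ∈ ρ.reduction D (ι p)) :
    𝒞.form (ι p) (𝒞.bracket U W (ι p)) y = 0 := by
  have hK := h.eventually_hasSectionsAt_Kperp p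
  have hA := h.isSubbundleAt_dirac_inf hD hp
  have hc := h.leaf.smooth.continuous
  obtain ⟨x, hx, t, ht, rfl⟩ := Submodule.mem_sup.1 hy
  rw [map_add, ExtendedAction.form_Kperp_K (hU.bracket_mem_Kperp h.leaf hW)
    (ρ.Ktilde_le_K _ ht), add_zero]
  obtain ⟨c₁, rfl, hc₁⟩ := hA.hasSections x hx
  obtain ⟨c, hcD, hcc⟩ := (CourantAlgebroid.isSubbundleAt_dirac hD (ι p)).exists_section_mem hc
    (hc₁.mono fun p' hp' => hp'.1)
  have hcK : ∀ᶠ p' in 𝓝 p, c (ι p') ∈ (𝒞.form (ι p')).orthogonal (ρ.Ktilde (ι p')) := by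
    filter_upwards [hc₁, hcc] with p' h₁ h₂
    rw [h₂]
    exact h₁.2
  rw [← hcc.self_of_nhds]
  obtain ⟨d, k, hd, hdK, hk, hη⟩ := h.exists_decomposition hD hA hU'
  obtain ⟨d', k', hd', hdK', hk', hη'⟩ := h.exists_decomposition hD hA hW'
  have hnull : ∀ z ∈ ρ.nullK (ι p), 𝒞.form (ι p) z (c (ι p)) = 0 := fun z hz =>
    hcK.self_of_nhds z (ρ.nullK_le_Ktilde _ hz)
  have hkK' : ∀ᶠ p' in 𝓝 p, k' (ι p') ∈ (𝒞.form (ι p')).orthogonal (ρ.Ktilde (ι p')) :=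
    hk'.mono fun p' hp' => h.Ktilde_le_orthogonal p' (ρ.nullK_le_Ktilde _ hp')
  have hWK : ∀ᶠ p' in 𝓝 p, W (ι p') ∈ (𝒞.form (ι p')).orthogonal (ρ.Ktilde (ι p')) :=
    hW'.mono fun p' hp' => h.reduction_le p' hp'
  have h₁ : 𝒞.bracket U W = 𝒞.bracket d d' + 𝒞.bracket U k' - 𝒞.bracket k k' -
      𝒞.bracket (U - d - k) k' + 𝒞.bracket d (W - d' - k') + 𝒞.bracket k W +
      𝒞.bracket (U - d - k) W := by
    simp only [map_sub, LinearMap.sub_apply]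
    abel
  let ℓ : Cₛ^∞⟮𝓘(ℝ, EM); F, E⟯ → ℝ := fun s => 𝒞.form (ι p) (s (ι p)) (c (ι p))
  have hadd : ∀ s t, ℓ (s + t) = ℓ s + ℓ t := fun s t => by
    simp only [ℓ, ContMDiffSection.coe_add, Pi.add_apply, map_add, LinearMap.add_apply]
  have hsub : ∀ s t, ℓ (s - t) = ℓ s - ℓ t := fun s t => by
    simp only [ℓ, ContMDiffSection.coe_sub, Pi.sub_apply, map_sub, LinearMap.sub_apply]
  have e₁ : ℓ (𝒞.bracket d d') = 0 := (hD.maximal_isotropic (ι p)).1 _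
    (CourantAlgebroid.bracket_mem_dirac hD hd hd' _) _ (hcD _)
  have e₂ : ℓ (𝒞.bracket U k') = 0 := hnull _ (hU.bracket_null_mem h.leaf hK hk')
  have e₃ : ℓ (𝒞.bracket k k') = 0 :=
    hnull _ ((hk.isInvariantNear h.leaf hK).bracket_null_mem h.leaf hK hk')
  have e₄ : ℓ (𝒞.bracket (U - d - k) k') = 0 := (h.form_bracket_rhoH hkK' hcK hη).2
  have e₅ : ℓ (𝒞.bracket d (W - d' - k')) = 0 := (h.form_bracket_rhoH hdK hcK hη').1
  have e₆ : ℓ (𝒞.bracket k W) = 0 := hnull _ (hW.null_bracket_mem h.leaf hK hk)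
  have e₇ : ℓ (𝒞.bracket (U - d - k) W) = 0 := (h.form_bracket_rhoH hWK hcK hη).2
  change ℓ (𝒞.bracket U W) = 0
  rw [h₁, hadd, hadd, hadd, hsub, hsub, hadd, e₁, e₂, e₃, e₄, e₅, e₆, e₇]
  simp

end IsReducible

end Leaf

section Leaf

open Module

variable {EG : Type*} [NormedAddCommGroup EG] [NormedSpace ℝ EG] [FiniteDimensional ℝ EG]
  {G : Type*} [TopologicalSpace G] [ChartedSpace EG G] [Group G] [LieGroup 𝓘(ℝ, EG) ∞ G]
  [ConnectedSpace G]
  {EM : Type*} [NormedAddCommGroup EM] [NormedSpace ℝ EM] [FiniteDimensional ℝ EM]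
  {M : Type*} [TopologicalSpace M] [ChartedSpace EM M] [IsManifold 𝓘(ℝ, EM) ∞ M] [T2Space M]
  [MulAction G M] [ContMDiffSMul 𝓘(ℝ, EG) 𝓘(ℝ, EM) ∞ G M]
  {F : Type*} [NormedAddCommGroup F] [NormedSpace ℝ F] [FiniteDimensional ℝ F]
  {E : M → Type*} [∀ m, AddCommGroup (E m)] [∀ m, Module ℝ (E m)]
  [TopologicalSpace (TotalSpace F E)] [∀ m, TopologicalSpace (E m)]
  [FiberBundle F E] [VectorBundle ℝ F E] [ContMDiffVectorBundle ∞ F E 𝓘(ℝ, EM)]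
  {𝒞 : CourantAlgebroid EM M F E}
  {𝔞 : Type*} [AddCommGroup 𝔞] [Module ℝ 𝔞] {𝒜 : ExactCourantAlgebra EG G 𝔞}
  {ρ : ExtendedAction 𝒞 𝒜}
  {EP : Type*} [NormedAddCommGroup EP] [NormedSpace ℝ EP] [FiniteDimensional ℝ EP]
  {P : Type*} [TopologicalSpace P] [ChartedSpace EP P] [IsManifold 𝓘(ℝ, EP) ∞ P]
  [MulAction G P] [ContMDiffSMul 𝓘(ℝ, EG) 𝓘(ℝ, EP) ∞ G P] {ι : P → M}

namespace IsReducible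

variable (h : IsReducible ρ EP ι) {D : ∀ m, Submodule ℝ (E m)}
  (hD : 𝒞.toBracketBundle.IsDirac D) (hρD : ρ.Preserves D)
include h

theorem continuous_form (U W : Cₛ^∞⟮𝓘(ℝ, EM); F, E⟯) :
    Continuous fun p : P => 𝒞.form (ι p) (U (ι p)) (W (ι p)) :=
  (𝒞.form_smooth U W).continuous.comp h.leaf.smooth.continuous

theorem form_bracket_eq_zero_of_eventually (hD : 𝒞.toBracketBundle.IsDirac D) {p : P}
    {U W Y : Cₛ^∞⟮𝓘(ℝ, EM); F, E⟯} (hU : ρ.IsInvariantNear ι U p) (hW : ρ.IsInvariantNear ι W p)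
    (hU' : ∀ᶠ p' in 𝓝 p, U (ι p') ∈ ρ.reduction D (ι p'))
    (hW' : ∀ᶠ p' in 𝓝 p, W (ι p') ∈ ρ.reduction D (ι p'))
    (hY : ∀ᶠ p' in 𝓝 p, Y (ι p') ∈ ρ.reduction D (ι p')) :
    𝒞.form (ι p) (𝒞.bracket U W (ι p)) (Y (ι p)) = 0 := by
  have := fun m => finiteDimensional_fibre F (E := E) m
  by_contra hne
  have h₁ := (h.continuous_form (𝒞.bracket U W) Y).continuousAt.eventually_ne hne
  have h₂ := frequently_eventually_eq (n := finrank ℝ F)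
    (f := fun p : P => finrank ℝ ↥(D (ι p) ⊔ ρ.Ktilde (ι p)))
    (fun p' => (Submodule.finrank_le _).trans (finrank_fibre F _).le)
    (fun p' => ((h.hasSectionsAt_dirac hD p').sup
      (h.isSubbundleAt_Ktilde p').hasSections).finrank_le h.leaf.smooth.continuous) p
  obtain ⟨q, hq, hq₁, hq₂, hq₃, hq₄, hq₅, hq₆⟩ := (h₂.and_eventually (h₁.and
    (hU.eventually_nhds.and (hW.eventually_nhds.and (hU'.eventually_nhds.and
      (hW'.eventually_nhds.and hY)))))).exists
  exact hq₁ (h.form_bracket_eq_zero hD hq hq₂ hq₃ hq₄ hq₅ hq₆)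

include hD hρD

theorem act_mem_reduction {g : G} {p p' : P} (hp : g • p = p') (hm : g • ι p = ι p')
    {v : E (ι p)} (hv : v ∈ ρ.reduction D (ι p)) : ρ.act g hm v ∈ ρ.reduction D (ι p') := by
  obtain ⟨a, ha, b, hb, rfl⟩ := Submodule.mem_sup.1 hv
  rw [map_add]
  exact Submodule.add_mem_sup ⟨h.act_mem_dirac hp hm hD hρD ha.1,
    h.act_mem_orthogonal_Ktilde hp hm ha.2⟩ (h.act_mem_Ktilde hp hm hb)

theorem mem_redDirac_iff {b : MulAction.orbitRel.Quotient G P} {s : ρ.RedBundle h.equivariant b}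
    {p : P} (hb : (Quotient.mk'' p : MulAction.orbitRel.Quotient G P) = b) {e : E (ι p)}
    (he : Represents (𝒞.form (ι p)) (ρ.K (ι p)) e (ρ.evalAt h.equivariant b p hb s)) :
    s ∈ ρ.redDirac h.equivariant D b ↔ e ∈ ρ.reduction D (ι p) := by
  rw [ExtendedAction.redDirac, Submodule.mem_iInf]
  constructor
  · intro hs
    exact (h.mem_redSubspace_iff he).1 (hs ⟨p, hb⟩)
  · rintro hs ⟨p', hb'⟩
    obtain ⟨g, hg⟩ := MulAction.orbitRel_apply.1 (Quotient.exact' (hb'.trans hb.symm))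
    have hm : g • ι p = ι p' := by rw [← h.equivariant]; exact congrArg ι hg
    exact (h.mem_redSubspace_iff (h.represents_act s hb hb' hg hm he)).2
      (h.act_mem_reduction hD hρD hg hm hs)

theorem mem_redDirac_iff_representsAt {u : ∀ b, ρ.RedBundle h.equivariant b} {p : P}
    {e : E (ι p)} (he : ρ.RepresentsAt h.equivariant u p e) :
    u (Quotient.mk'' p) ∈ ρ.redDirac h.equivariant D (Quotient.mk'' p) ↔
      e ∈ ρ.reduction D (ι p) :=
  h.mem_redDirac_iff hD hρD rfl he

theorem mem_redDirac_iff_evalAt {b : MulAction.orbitRel.Quotient G P}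
    {s : ρ.RedBundle h.equivariant b} {p : P}
    (hb : (Quotient.mk'' p : MulAction.orbitRel.Quotient G P) = b) :
    s ∈ ρ.redDirac h.equivariant D b ↔
      ρ.evalAt h.equivariant b p hb s ∈
        redSubspace (𝒞.form (ι p)) (𝒞.anchor (ι p)) (ρ.K (ι p)) (D (ι p)) := by
  obtain ⟨e, he⟩ := exists_represents (ρ.evalAt h.equivariant b p hb s)
  rw [h.mem_redDirac_iff hD hρD hb he, h.mem_redSubspace_iff he]

theorem isMaximalIsotropic_redDirac (b : MulAction.orbitRel.Quotient G P) :
    IsMaximalIsotropic (V := ρ.RedBundle h.equivariant b)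
      ((ρ.reducedCourant h.equivariant (EP := EP)).form b)
      (ρ.redDirac h.equivariant D b) := by
  have := finiteDimensional_fibre F (E := E) (ι b.out)
  have horth := orthogonal_redSubspace (𝒞.form_symm _) (𝒞.form_nondegenerate _)
    (h.exact (ι b.out)) (h.reducedExact b.out)
    (CourantAlgebroid.orthogonal_dirac hD h.exact (ι b.out))
  have hsymm := redForm_isSymm (K := ρ.K (ι b.out)) (𝒞.form_symm (ι b.out))
  refine isMaximalIsotropic_of_orthogonal_eq (V := ρ.RedBundle h.equivariant b)
    ⟨fun x y => hsymm.eq (ρ.evalAt h.equivariant b b.out b.out_eq' x)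
      (ρ.evalAt h.equivariant b b.out b.out_eq' y)⟩ ?_
  ext x
  rw [h.mem_redDirac_iff_evalAt hD hρD b.out_eq', ← horth]
  constructor
  · intro hx c hc
    obtain ⟨y, rfl⟩ := h.evalAt_surjective (p := b.out) b.out_eq' c
    exact hx y ((h.mem_redDirac_iff_evalAt hD hρD b.out_eq').2 hc)
  · intro hx y hy
    exact hx _ ((h.mem_redDirac_iff_evalAt hD hρD b.out_eq').1 hy)

/-- If the reduction of a Dirac structure is a smooth subbundle, it is a Dirac structure. -/
theorem isDirac_redDirac
    (hsub : (ρ.reducedCourant h.equivariant (EP := EP)).IsSmoothSubbundle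
      (ρ.redDirac h.equivariant D)) :
    (ρ.reducedCourant h.equivariant (EP := EP)).IsDirac (ρ.redDirac h.equivariant D) := by
  refine ⟨hsub, h.isMaximalIsotropic_redDirac hD hρD, fun u w hu hw => ?_⟩
  have hu' := fun b => (hu b).1
  have hw' := fun b => (hw b).1
  obtain ⟨z, hz⟩ := h.exists_bracket_section hu' hw'
  choose U hU using fun p : P => h.exists_section_represents (hu' (Quotient.mk'' p))
  choose W hW using fun p : P => h.exists_section_represents (hw' (Quotient.mk'' p))
  refine ⟨z, fun p => ⟨⟨U p, W p, hU p, hW p⟩, fun U W hU hW => hz p U W hU hW⟩, fun b => ⟨?_, ?_⟩⟩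
  · refine h.smoothNear_of_represents (fun p => ⟨𝒞.bracket (U p) (W p), ?_⟩) b
    filter_upwards [(hU p).eventually_nhds, (hW p).eventually_nhds] with p' h₁ h₂
    exact hz p' _ _ h₁ h₂
  obtain ⟨p, rfl⟩ := Quotient.mk''_surjective b
  have hUi := h.isInvariantNear_of_representsAt (hU p)
  have hWi := h.isInvariantNear_of_representsAt (hW p)
  have hmem := hUi.bracket_mem_Kperp h.leaf hWi
  rw [h.mem_redDirac_iff_representsAt hD hρD (hz p _ _ (hU p) (hW p)),
    ← h.orthogonal_reduction hD, mem_orthogonal_symm (𝒞.form_symm _)]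
  intro y hy
  obtain ⟨x, ⟨hxK, hx⟩, t, ht, rfl⟩ := h.exists_mem_Kperp_add hy
  rw [map_add, ExtendedAction.form_Kperp_K hmem (ρ.Ktilde_le_K _ ht), add_zero]
  obtain ⟨s, hs⟩ := h.evalAt_surjective (p := p) rfl
    ((redKernel (𝒞.form (ι p)) (ρ.K (ι p))).mkQ ⟨x, hxK⟩)
  have hsx : Represents (𝒞.form (ι p)) (ρ.K (ι p)) x (ρ.evalAt h.equivariant _ p rfl s) := by
    rw [hs]
    exact represents_mk _
  obtain ⟨v, hv, hvD, hvs⟩ := hsub.exists_local_section _ s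
    ((h.mem_redDirac_iff hD hρD rfl hsx).2 hx)
  obtain ⟨Y, hY⟩ := h.exists_section_represents hv
  have hq : Filter.Tendsto (Quotient.mk'' : P → MulAction.orbitRel.Quotient G P) (𝓝 p)
      (𝓝 (Quotient.mk'' p)) := continuous_quotient_mk'.tendsto p
  have hYx : Y (ι p) - x ∈ ρ.nullK (ι p) := by
    have h₁ : ρ.RepresentsAt h.equivariant v p x := by
      rw [ExtendedAction.RepresentsAt, hvs]
      exact hsx
    exact hY.self_of_nhds.sub_mem_inf h₁
  have h₁ := h.form_bracket_eq_zero_of_eventually hD hUi hWi (Y := Y)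
    ((hU p).mono fun p' hp' => (h.mem_redDirac_iff_representsAt hD hρD hp').1 (hu _).2)
    ((hW p).mono fun p' hp' => (h.mem_redDirac_iff_representsAt hD hρD hp').1 (hw _).2) (by
      filter_upwards [hY, hq.eventually hvD] with p' h₁ h₂
      exact (h.mem_redDirac_iff_representsAt hD hρD h₁).1 h₂)
  have h₂ := ExtendedAction.form_Kperp_K hmem hYx.1
  rw [map_sub, h₁, zero_sub, neg_eq_zero] at h₂
  exact h₂

end IsReducible

end Leaf

/-! ### Slices for free and proper actions -/

section Implicit

variable {E₁ E₂ E₃ : Type*} [NormedAddCommGroup E₁] [NormedSpace ℝ E₁] [CompleteSpace E₁]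
  [NormedAddCommGroup E₂] [NormedSpace ℝ E₂] [CompleteSpace E₂]
  [NormedAddCommGroup E₃] [NormedSpace ℝ E₃] [CompleteSpace E₃]

/-- The implicit function theorem, with smoothness of the implicit function on a neighbourhood. -/
theorem exists_smooth_implicitFunction {f : E₁ × E₂ → E₃} {u : E₁ × E₂}
    (hf : ∀ᶠ v in 𝓝 u, ContDiffAt ℝ ∞ f v)
    (hinv : (fderiv ℝ f u ∘L .inr ℝ E₁ E₂).IsInvertible) :
    ∃ ψ : E₁ → E₂, ψ u.1 = u.2 ∧ (∀ᶠ x in 𝓝 u.1, ContDiffAt ℝ ∞ ψ x) ∧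
      ∀ᶠ v in 𝓝 u, f v = f u ↔ ψ v.1 = v.2 := by
  have hn : (∞ : WithTop ℕ∞) ≠ 0 := by simp
  have cdf := hf.self_of_nhds
  have hψ := cdf.contDiffAt_implicitFunction hn hinv
  have hψu := cdf.implicitFunction_apply_self hn hinv
  have hiff := cdf.eventually_apply_eq_iff_implicitFunction hn hinv
  refine ⟨cdf.implicitFunction hn hinv, hψu, ?_, hiff⟩
  have hopen : ∀ᶠ v in 𝓝 u, (fderiv ℝ f v ∘L .inr ℝ E₁ E₂).IsInvertible := by
    have h₁ : ContinuousAt (fun v => fderiv ℝ f v ∘L .inr ℝ E₁ E₂) u :=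
      ((cdf.fderiv_right (m := 0) (by simp)).continuousAt).clm_comp continuousAt_const
    obtain ⟨e, he⟩ := hinv
    have h₂ := ContinuousLinearEquiv.nhds e
    rw [he] at h₂
    exact h₁.eventually h₂
  have htend : Filter.Tendsto (fun x => (x, cdf.implicitFunction hn hinv x)) (𝓝 u.1) (𝓝 u) := by
    have h₁ : ContinuousAt (fun x => (x, cdf.implicitFunction hn hinv x)) u.1 :=
      continuousAt_id.prodMk hψ.continuousAt
    rwa [ContinuousAt, hψu] at h₁
  filter_upwards [htend.eventually (hf.and (hopen.and hiff.eventually_nhds)),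
    cdf.eventually_apply_implicitFunction hn hinv] with x ⟨h₁, h₂, h₃⟩ h₄
  refine (h₁.contDiffAt_implicitFunction hn h₂).congr_of_eventuallyEq ?_
  have hx := h₁.contDiffAt_implicitFunction hn h₂
  have htend' : Filter.Tendsto (fun y => (y, h₁.implicitFunction hn h₂ y)) (𝓝 x)
      (𝓝 (x, cdf.implicitFunction hn hinv x)) := by
    have h₅ : ContinuousAt (fun y => (y, h₁.implicitFunction hn h₂ y)) x :=
      continuousAt_id.prodMk hx.continuousAt
    have h₆ := h₁.implicitFunction_apply_self hn h₂
    rw [ContinuousAt] at h₅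
    rwa [show h₁.implicitFunction hn h₂ x = cdf.implicitFunction hn hinv x from h₆] at h₅
  filter_upwards [htend'.eventually h₃, h₁.eventually_apply_implicitFunction hn h₂] with y h₅ h₆
  exact h₅.1 (h₆.trans h₄)

end Implicit

section Slice

variable {EG : Type*} [NormedAddCommGroup EG] [NormedSpace ℝ EG] [FiniteDimensional ℝ EG]
  {G : Type*} [TopologicalSpace G] [ChartedSpace EG G] [Group G] [LieGroup 𝓘(ℝ, EG) ∞ G]
  {EP : Type*} [NormedAddCommGroup EP] [NormedSpace ℝ EP] [FiniteDimensional ℝ EP]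
  {P : Type*} [TopologicalSpace P] [ChartedSpace EP P] [IsManifold 𝓘(ℝ, EP) ∞ P]
  [MulAction G P] [ContMDiffSMul 𝓘(ℝ, EG) 𝓘(ℝ, EP) ∞ G P]

variable (EP) in
/-- Near a point with trivial stabilizer, every point is moved by exactly one group element near
`1` into the level set of a suitable function. -/
theorem exists_local_slice {p : P} (hp : ∀ g : G, g • p = p → g = 1) :
    ∃ (Φ : P → EG) (δ : P → G), δ p = 1 ∧
      (∀ᶠ q in 𝓝 p, ContMDiffAt 𝓘(ℝ, EP) 𝓘(ℝ, EG) ∞ δ q) ∧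
      ∀ᶠ x : G × P in 𝓝 (1, p), Φ (x.1 • x.2) = Φ p ↔ δ x.2 = x.1 := by
  have : IsManifold 𝓘(ℝ, EG) ∞ G := ContMDiffMul.toIsManifold
  have : CompleteSpace EG := FiniteDimensional.complete ℝ EG
  have : CompleteSpace EP := FiniteDimensional.complete ℝ EP
  have : ContinuousSMul G P := ContMDiffSMul.continuousSMul (I := 𝓘(ℝ, EG)) (I' := 𝓘(ℝ, EP)) ∞
  set cG := extChartAt 𝓘(ℝ, EG) (1 : G) with hcG
  set cP := extChartAt 𝓘(ℝ, EP) ((1 : G) • p) with hcP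
  have hpP : p ∈ cP.source := by
    have := mem_extChartAt_source (I := 𝓘(ℝ, EP)) ((1 : G) • p)
    rwa [← hcP, one_smul] at this
  have hoP : IsOpen cP.source := isOpen_extChartAt_source _
  have hoP' : IsOpen cP.target := isOpen_extChartAt_target _
  have hoG : IsOpen cG.source := isOpen_extChartAt_source _
  have hoG' : IsOpen cG.target := isOpen_extChartAt_target _
  have h1G : (1 : G) ∈ cG.source := mem_extChartAt_source _
  have horb : MDifferentiableAt 𝓘(ℝ, EG) 𝓘(ℝ, EP) (fun g : G => g • p) 1 :=
    (contMDiff_smul_const p).mdifferentiableAt (n := ∞) (by simp)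
  let ℓ : EG → EP := fun x => cP (cG.symm x • p)
  have hinj : LinearMap.ker (fderiv ℝ ℓ (cG 1)).toLinearMap = ⊥ := by
    rw [LinearMap.ker_eq_bot']
    intro Y hY
    refine eq_zero_of_mfderiv_smul_const_eq_zero (EG := EG) (EP := EP) hp ?_
    have h₁ : (mfderiv 𝓘(ℝ, EG) 𝓘(ℝ, EP) (fun g : G => g • p) 1 : EG →L[ℝ] EP) =
        fderiv ℝ ℓ (cG 1) := by
      have h₂ := horb.mfderiv
      rw [modelWithCornersSelf_coe, Set.range_id, fderivWithin_univ] at h₂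
      exact h₂
    exact (congrArg (fun L => L Y) h₁).trans hY
  obtain ⟨R₀, hR₀⟩ := LinearMap.exists_leftInverse_of_injective _ hinj
  let R : EP →L[ℝ] EG := R₀.toContinuousLinearMap
  let Φ : P → EG := fun q => R (cP q)
  let f : EP × EG → EG := fun x => Φ (cG.symm x.2 • cP.symm x.1)
  let u : EP × EG := (cP p, cG 1)
  have hsP : ∀ q ∈ cP.source, ContMDiffAt 𝓘(ℝ, EP) 𝓘(ℝ, EP) ∞ cP q := fun q hq =>
    contMDiffAt_extChartAt' (by rwa [hcP, extChartAt_source] at hq)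
  have hsG' : ∀ x ∈ cG.target, ContMDiffAt 𝓘(ℝ, EG) 𝓘(ℝ, EG) ∞ cG.symm x := fun x hx =>
    (contMDiffOn_extChartAt_symm (1 : G)).contMDiffAt (hoG'.mem_nhds hx)
  have hsP' : ∀ x ∈ cP.target, ContMDiffAt 𝓘(ℝ, EP) 𝓘(ℝ, EP) ∞ cP.symm x := fun x hx =>
    (contMDiffOn_extChartAt_symm ((1 : G) • p)).contMDiffAt (hoP'.mem_nhds hx)
  have hsmul : ∀ v : EP × EG, v.1 ∈ cP.target → v.2 ∈ cG.target →
      ContMDiffAt 𝓘(ℝ, EP × EG) 𝓘(ℝ, EP) ∞ (fun v : EP × EG => cG.symm v.2 • cP.symm v.1) v := by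
    intro v h₁ h₂
    exact ContMDiffAt.smul ((hsG' _ h₂).comp v contDiff_snd.contMDiff.contMDiffAt)
      ((hsP' _ h₁).comp v contDiff_fst.contMDiff.contMDiffAt)
  have hu₁ : u.1 ∈ cP.target := cP.map_source hpP
  have hu₂ : u.2 ∈ cG.target := cG.map_source h1G
  have hup : cG.symm u.2 • cP.symm u.1 = p := by
    simp only [u]
    rw [cG.left_inv h1G, cP.left_inv hpP, one_smul]
  have hfu : f u = Φ p := congrArg Φ hup
  have hf : ∀ᶠ v in 𝓝 u, ContDiffAt ℝ ∞ f v := by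
    have h₁ : ∀ᶠ v in 𝓝 u, cG.symm v.2 • cP.symm v.1 ∈ cP.source :=
      (hsmul u hu₁ hu₂).continuousAt.eventually (hoP.mem_nhds (by beta_reduce; rwa [hup]))
    filter_upwards [h₁, continuousAt_fst.eventually (hoP'.mem_nhds hu₁),
      continuousAt_snd.eventually (hoG'.mem_nhds hu₂)] with v h₂ h₃ h₄
    rw [← contMDiffAt_iff_contDiffAt]
    exact R.contDiff.contMDiff.contMDiffAt.comp v ((hsP _ h₂).comp v (hsmul v h₃ h₄))
  have hinv : (fderiv ℝ f u ∘L .inr ℝ EP EG).IsInvertible := by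
    have h₁ : fderiv ℝ f u ∘L .inr ℝ EP EG = ContinuousLinearMap.id ℝ EG := by
      have h₂ : HasFDerivAt f (fderiv ℝ f u) u :=
        (hf.self_of_nhds.differentiableAt (by simp)).hasFDerivAt
      have h₃ : HasFDerivAt (fun x => f (cP p, x)) (fderiv ℝ f u ∘L .inr ℝ EP EG) (cG 1) :=
        HasFDerivAt.comp (cG 1) h₂ (hasFDerivAt_prodMk_right (cP p) (cG 1))
      have h₄ : (fun x => f (cP p, x)) = fun x => R (ℓ x) := by
        funext x
        simp only [f, ℓ, Φ]
        rw [cP.left_inv hpP]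
      have h₅ : DifferentiableAt ℝ ℓ (cG 1) := by
        refine ContDiffAt.differentiableAt (n := ∞) ?_ (by simp)
        rw [← contMDiffAt_iff_contDiffAt]
        have h₆ : ContMDiffAt 𝓘(ℝ, EG) 𝓘(ℝ, EP) ∞ (fun x => cG.symm x • p) (cG 1) :=
          (hsG' _ hu₂).smul contMDiffAt_const
        refine (hsP _ ?_).comp _ h₆
        rwa [cG.left_inv h1G, one_smul]
      rw [h₄] at h₃
      have h₇ : HasFDerivAt (fun x => R (ℓ x)) (R ∘L fderiv ℝ ℓ (cG 1)) (cG 1) :=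
        R.hasFDerivAt.comp _ h₅.hasFDerivAt
      rw [h₃.unique h₇]
      ext Y
      exact LinearMap.congr_fun hR₀ Y
    rw [h₁]
    exact ⟨.refl ℝ EG, rfl⟩
  obtain ⟨ψ, hψu, hψ, hiff⟩ := exists_smooth_implicitFunction hf hinv
  have hcP₁ : ContinuousAt cP p := (hsP p hpP).continuousAt
  have hcG₁ : ContinuousAt cG 1 := continuousAt_extChartAt (1 : G)
  have hψt : ∀ᶠ q in 𝓝 p, ψ (cP q) ∈ cG.target := by
    have h₁ : ContinuousAt (fun q => ψ (cP q)) p :=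
      ContinuousAt.comp (f := cP) (g := ψ) hψ.self_of_nhds.continuousAt hcP₁
    refine h₁.eventually (hoG'.mem_nhds ?_)
    beta_reduce
    rw [show ψ (cP p) = cG 1 from hψu]
    exact hu₂
  refine ⟨Φ, fun q => cG.symm (ψ (cP q)), ?_, ?_, ?_⟩
  · beta_reduce
    rw [show ψ (cP p) = cG 1 from hψu, cG.left_inv h1G]
  · filter_upwards [hcP₁.eventually hψ, hoP.mem_nhds hpP, hψt] with q h₁ h₂ h₃
    exact (hsG' _ h₃).comp q (h₁.contMDiffAt.comp q (hsP q h₂))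
  · have hfst : ContinuousAt Prod.fst ((1 : G), p) := continuousAt_fst
    have hsnd : ContinuousAt Prod.snd ((1 : G), p) := continuousAt_snd
    have h₁ : ContinuousAt (fun x : G × P => (cP x.2, cG x.1)) (1, p) :=
      (ContinuousAt.comp (x := ((1 : G), p)) hcP₁ hsnd).prodMk
        (ContinuousAt.comp (x := ((1 : G), p)) hcG₁ hfst)
    filter_upwards [h₁.eventually hiff, hfst.eventually (hoG.mem_nhds h1G),
      hsnd.eventually (hoP.mem_nhds hpP), hsnd.eventually hψt] with x h₂ h₃ h₄ h₅
    rw [hfu] at h₂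
    simp only [f] at h₂
    rw [cG.left_inv h₃, cP.left_inv h₄] at h₂
    rw [h₂]
    constructor
    · intro h₆
      rw [h₆, cG.left_inv h₃]
    · intro h₆
      rw [← h₆, cG.right_inv h₅]

variable (EP) in
/-- A slice of a free and proper action: every orbit meets `S` at most once, and the points near
`p` are moved into `S` by a smooth map to the group. -/
theorem exists_slice [ProperSMul G P] (hfree : ∀ (g : G) (p : P), g • p = p → g = 1) {p : P}
    {N : Set P} (hN : N ∈ 𝓝 p) :
    ∃ S ⊆ N, p ∈ S ∧ (∀ (g : G), ∀ q ∈ S, g • q ∈ S → g = 1) ∧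
      ∃ δ : P → G, ∀ᶠ q in 𝓝 p, ContMDiffAt 𝓘(ℝ, EP) 𝓘(ℝ, EG) ∞ δ q ∧ δ q • q ∈ S := by
  obtain ⟨Φ, δ, hδ, hsm, hiff⟩ := exists_local_slice (EG := EG) EP (fun g => hfree g p)
  have h₁ := (ProperSMul.isProperMap_smul_pair (G := G) (X := P)).isClosedMap.eventually_nhds_fiber
    (p := fun x : G × P => Φ (x.1 • x.2) = Φ p ↔ δ x.2 = x.1) (p, p) (by
      rintro ⟨g, q⟩ hx
      obtain ⟨hx₁, hx₂⟩ : g • q = p ∧ q = p := Prod.ext_iff.1 hx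
      subst hx₂
      obtain rfl := hfree g q hx₁
      exact hiff)
  rw [nhds_prod_eq, Filter.Eventually, Filter.mem_prod_self_iff] at h₁
  obtain ⟨N', hN', h₁⟩ := h₁
  have h₂ : ∀ (g : G) (q : P), q ∈ N' → g • q ∈ N' → (Φ (g • q) = Φ p ↔ δ q = g) :=
    fun g q hq hgq => h₁ (Set.mk_mem_prod hgq hq) (g, q) rfl
  refine ⟨{q | q ∈ N ∩ N' ∧ Φ q = Φ p}, fun q hq => hq.1.1,
    ⟨⟨mem_of_mem_nhds hN, mem_of_mem_nhds hN'⟩, rfl⟩, fun g q hq hgq => ?_, δ, ?_⟩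
  · have h₃ := (h₂ g q hq.1.2 hgq.1.2).1 hgq.2
    have h₄ := (h₂ 1 q hq.1.2 (by rw [one_smul]; exact hq.1.2)).1 (by rw [one_smul]; exact hq.2)
    rw [← h₃, h₄]
  · have h₃ : ContinuousAt (fun q => δ q • q) p :=
      hsm.self_of_nhds.continuousAt.smul continuousAt_id
    have h₄ : ∀ᶠ q in 𝓝 p, δ q • q ∈ N ∩ N' :=
      h₃.eventually (by beta_reduce; rw [hδ, one_smul]; exact Filter.inter_mem hN hN')
    filter_upwards [hsm, h₄, hN'] with q h₅ h₆ h₇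
    exact ⟨h₅, h₆, (h₂ _ _ h₇ h₆.2).2 rfl⟩

end Slice

/-! ### Smoothness of the reduced Dirac structure -/

section Leaf

open Module

variable {EG : Type*} [NormedAddCommGroup EG] [NormedSpace ℝ EG] [FiniteDimensional ℝ EG]
  {G : Type*} [TopologicalSpace G] [ChartedSpace EG G] [Group G] [LieGroup 𝓘(ℝ, EG) ∞ G]
  [ConnectedSpace G]
  {EM : Type*} [NormedAddCommGroup EM] [NormedSpace ℝ EM] [FiniteDimensional ℝ EM]
  {M : Type*} [TopologicalSpace M] [ChartedSpace EM M] [IsManifold 𝓘(ℝ, EM) ∞ M] [T2Space M]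
  [MulAction G M] [ContMDiffSMul 𝓘(ℝ, EG) 𝓘(ℝ, EM) ∞ G M]
  {F : Type*} [NormedAddCommGroup F] [NormedSpace ℝ F] [FiniteDimensional ℝ F]
  {E : M → Type*} [∀ m, AddCommGroup (E m)] [∀ m, Module ℝ (E m)]
  [TopologicalSpace (TotalSpace F E)] [∀ m, TopologicalSpace (E m)]
  [FiberBundle F E] [VectorBundle ℝ F E] [ContMDiffVectorBundle ∞ F E 𝓘(ℝ, EM)]
  {𝒞 : CourantAlgebroid EM M F E}
  {𝔞 : Type*} [AddCommGroup 𝔞] [Module ℝ 𝔞] {𝒜 : ExactCourantAlgebra EG G 𝔞}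
  {ρ : ExtendedAction 𝒞 𝒜}
  {EP : Type*} [NormedAddCommGroup EP] [NormedSpace ℝ EP] [FiniteDimensional ℝ EP]
  {P : Type*} [TopologicalSpace P] [ChartedSpace EP P] [IsManifold 𝓘(ℝ, EP) ∞ P]
  [MulAction G P] [ContMDiffSMul 𝓘(ℝ, EG) 𝓘(ℝ, EP) ∞ G P] {ι : P → M}

theorem ExtendedAction.contMDiffAt_translate {a : P → G} {q : P}
    (ha : ContMDiffAt 𝓘(ℝ, EP) 𝓘(ℝ, EG) ∞ a q) (hι : ContMDiff 𝓘(ℝ, EP) 𝓘(ℝ, EM) ∞ ι)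
    (X : Cₛ^∞⟮𝓘(ℝ, EM); F, E⟯) :
    ContMDiffAt 𝓘(ℝ, EP) (𝓘(ℝ, EM).prod 𝓘(ℝ, F)) ∞
      (fun x => TotalSpace.mk' F (ι x) (ρ.translate X (a x) (ι x))) q := by
  have h₁ : ContMDiffAt 𝓘(ℝ, EP) 𝓘(ℝ, EM) ∞ (fun x => (a x)⁻¹ • ι x) q :=
    ha.inv.smul hι.contMDiffAt
  have h₂ : ContMDiffAt 𝓘(ℝ, EP) (𝓘(ℝ, EM).prod 𝓘(ℝ, F)) ∞
      (fun x => TotalSpace.mk' F ((a x)⁻¹ • ι x) (X ((a x)⁻¹ • ι x))) q :=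
    (X.contMDiff.contMDiffAt).comp q h₁
  have h₃ := (ρ.act_smooth.contMDiffAt).comp q (ha.prodMk h₂)
  refine h₃.congr_of_eventuallyEq (Filter.Eventually.of_forall fun x => ?_)
  have key : ∀ (g : G) (m m' : M) (hm : g • m = m') (v : E m),
      TotalSpace.mk' F m' (ρ.act g hm v) = TotalSpace.mk' F (g • m) (ρ.act g rfl v) := by
    rintro g m _ rfl v
    rfl
  exact key _ _ _ (smul_inv_smul (a x) (ι x)) _

namespace IsReducible

variable (h : IsReducible ρ EP ι) {D : ∀ m, Submodule ℝ (E m)}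
  (hD : 𝒞.toBracketBundle.IsDirac D) (hρD : ρ.Preserves D)
include h hD

theorem hasSectionsAt_reduction
    (hr : ∃ r : ℕ, ∀ p : P, finrank ℝ ↥(D (ι p) ⊓ ρ.Ktilde (ι p)) = r) (p : P) :
    HasSectionsAt EM F ι (fun p => ρ.reduction D (ι p)) p := by
  have := fun m => finiteDimensional_fibre F (E := E) m
  refine (h.isSubbundleAt_dirac_inf hD (Filter.Eventually.of_forall fun p' => ?_)).hasSections.sup
    (h.isSubbundleAt_Ktilde p).hasSections
  obtain ⟨r, hr⟩ := hr
  obtain ⟨k, hk⟩ := h.exists_rank_Ktilde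
  have h₁ := fun q : P => Submodule.finrank_sup_add_finrank_inf_eq (D (ι q)) (ρ.Ktilde (ι q))
  have h₂ := fun q : P => two_mul_finrank_of_orthogonal_eq (𝒞.form_nondegenerate (ι q))
    (CourantAlgebroid.orthogonal_dirac hD h.exact (ι q))
  simp only [hr, hk, finrank_fibre F] at h₁ h₂
  have := h₁ p
  have := h₁ p'
  have := h₂ p
  have := h₂ p'
  omega

theorem exists_section_represents_mem
    (hr : ∃ r : ℕ, ∀ p : P, finrank ℝ ↥(D (ι p) ⊓ ρ.Ktilde (ι p)) = r) {p : P} {e : E (ι p)}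
    (he : e ∈ ρ.reduction D (ι p)) {c : ρ.RedFibre (ι p)}
    (hc : Represents (𝒞.form (ι p)) (ρ.K (ι p)) e c) :
    ∃ X : Cₛ^∞⟮𝓘(ℝ, EM); F, E⟯, Represents (𝒞.form (ι p)) (ρ.K (ι p)) (X (ι p)) c ∧
      ∀ᶠ p' in 𝓝 p, X (ι p') ∈ ρ.Kperp (ι p') ⊓ ρ.reduction D (ι p') := by
  have := fun m => finiteDimensional_fibre F (E := E) m
  obtain ⟨Y, rfl, hY⟩ := h.hasSectionsAt_reduction hD hr p e he
  obtain ⟨k, hk⟩ := h.exists_rank_Ktilde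
  obtain ⟨X, η, hX, hη, hXη⟩ := (h.isSubbundleAt_Kperp p).hasSections.exists_split
    (h.isSubbundleAt_rhoH p).hasSections h.leaf.smooth.continuous (U := Y)
    (Filter.Eventually.of_forall fun p' => by
      have h₁ := fun q : P => finrank_orthogonal_add (𝒞.form_nondegenerate (ι q))
        (ρ.Ktilde (ι q))
      simp only [hk, finrank_fibre F] at h₁
      have h₂ := h₁ p
      have h₃ := h₁ p'
      rw [← h.orthogonal_Ktilde p', ← h.orthogonal_Ktilde p]
      omega)
    (hY.mono fun p' hp' => by
      have h₁ := h.reduction_le p' hp'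
      rwa [h.orthogonal_Ktilde] at h₁)
  refine ⟨X, hc.of_sub_mem ?_, ?_⟩
  · have h₁ : Y (ι p) - X (ι p) = η (ι p) := by
      rw [hXη.self_of_nhds, add_sub_cancel_left]
    have h₂ : X (ι p) - Y (ι p) = -η (ι p) := by rw [← h₁, neg_sub]
    refine ⟨?_, sub_mem hX.self_of_nhds hc.mem⟩
    rw [h₂]
    exact neg_mem (ρ.rhoH_le_K _ hη.self_of_nhds)
  · filter_upwards [hX, hη, hXη, hY] with p' h₁ h₂ h₃ h₄
    refine ⟨h₁, ?_⟩
    have h₅ : η (ι p') ∈ ρ.reduction D (ι p') :=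
      Submodule.mem_sup_right (ρ.rhoH_le_Ktilde h.exact _ h₂)
    have h₆ := sub_mem h₄ h₅
    rwa [h₃, add_sub_cancel_right] at h₆

include hρD

theorem finrank_redDirac (b : MulAction.orbitRel.Quotient G P) :
    finrank ℝ (ρ.redDirac h.equivariant D b) = finrank ℝ EP - finrank ℝ EG := by
  have := finiteDimensional_fibre F (E := E) (ι b.out)
  let ε := LinearEquiv.ofBijective (ρ.evalAt h.equivariant b b.out b.out_eq')
    ⟨h.evalAt_injective b.out_eq', h.evalAt_surjective b.out_eq'⟩
  have h₁ : (ρ.redDirac h.equivariant D b).map ε.toLinearMap =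
      redSubspace (𝒞.form (ι b.out)) (𝒞.anchor (ι b.out)) (ρ.K (ι b.out)) (D (ι b.out)) := by
    ext c
    constructor
    · rintro ⟨s, hs, rfl⟩
      exact (h.mem_redDirac_iff_evalAt hD hρD b.out_eq').1 hs
    · intro hc
      obtain ⟨s, rfl⟩ := h.evalAt_surjective b.out_eq' c
      exact ⟨s, (h.mem_redDirac_iff_evalAt hD hρD b.out_eq').2 hc, rfl⟩
  have h₂ := two_mul_finrank_of_orthogonal_eq
    (redForm_nondegenerate (𝒞.form_symm (ι b.out)) (𝒞.form_nondegenerate (ι b.out)))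
    (orthogonal_redSubspace (𝒞.form_symm _) (𝒞.form_nondegenerate _)
      (h.exact (ι b.out)) (h.reducedExact b.out)
      (CourantAlgebroid.orthogonal_dirac hD h.exact (ι b.out)))
  rw [← h₁, LinearEquiv.finrank_map_eq] at h₂
  exact Nat.eq_of_mul_eq_mul_left two_pos (h₂.trans (h.finrank_redFibre b.out))

/-- A section near a slice extends uniquely to an invariant section. -/
theorem exists_section_of_slice {S : Set P} (hS : ∀ (g : G), ∀ q ∈ S, g • q ∈ S → g = 1)
    {X : Cₛ^∞⟮𝓘(ℝ, EM); F, E⟯}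
    (hX : ∀ q ∈ S, X (ι q) ∈ ρ.Kperp (ι q) ⊓ ρ.reduction D (ι q)) :
    ∃ u : ∀ b, ρ.RedBundle h.equivariant b, (∀ b, u b ∈ ρ.redDirac h.equivariant D b) ∧
      ∀ q ∈ S, ρ.RepresentsAt h.equivariant u q (X (ι q)) := by
  have key : ∀ b : MulAction.orbitRel.Quotient G P, ∃ w : ρ.RedBundle h.equivariant b,
      w ∈ ρ.redDirac h.equivariant D b ∧
      ∀ q ∈ S, ∀ hq : (Quotient.mk'' q : MulAction.orbitRel.Quotient G P) = b,
        Represents (𝒞.form (ι q)) (ρ.K (ι q)) (X (ι q)) (ρ.evalAt h.equivariant b q hq w) := by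
    intro b
    by_cases hb : ∃ q ∈ S, (Quotient.mk'' q : MulAction.orbitRel.Quotient G P) = b
    · obtain ⟨q, hqS, hq⟩ := hb
      obtain ⟨w, hw⟩ := h.evalAt_surjective hq
        ((redKernel (𝒞.form (ι q)) (ρ.K (ι q))).mkQ ⟨X (ι q), (hX q hqS).1⟩)
      have hw' : Represents (𝒞.form (ι q)) (ρ.K (ι q)) (X (ι q))
          (ρ.evalAt h.equivariant b q hq w) := by
        rw [hw]
        exact represents_mk _
      refine ⟨w, (h.mem_redDirac_iff hD hρD hq hw').2 (hX q hqS).2, fun q' hqS' hq' => ?_⟩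
      obtain ⟨g, rfl⟩ := MulAction.orbitRel_apply.1 (Quotient.exact' (hq'.trans hq.symm))
      have hg := hS g q hqS hqS'
      have hqq : q = g • q := by rw [hg, one_smul]
      clear hg
      revert hq' hqS'
      beta_reduce
      rw [← hqq]
      intro _ _
      exact hw'
    · exact ⟨0, zero_mem _, fun q hqS hq => absurd ⟨q, hqS, hq⟩ hb⟩
  choose u hu hu' using key
  exact ⟨u, hu, fun q hq => hu' _ q hq rfl⟩

theorem isSmoothSubbundle_redDirac [ProperSMul G P]
    (hr : ∃ r : ℕ, ∀ p : P, finrank ℝ ↥(D (ι p) ⊓ ρ.Ktilde (ι p)) = r) :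
    (ρ.reducedCourant h.equivariant (EP := EP)).IsSmoothSubbundle
      (ρ.redDirac h.equivariant D) := by
  have : ContinuousSMul G P := ContMDiffSMul.continuousSMul (I := 𝓘(ℝ, EG)) (I' := 𝓘(ℝ, EP)) ∞
  refine ⟨fun b => Filter.Eventually.of_forall fun b' => ?_, fun b s hs => ?_⟩
  · rw [h.finrank_redDirac hD hρD, h.finrank_redDirac hD hρD]
  obtain ⟨p, rfl⟩ := Quotient.mk''_surjective b
  obtain ⟨e, he⟩ := exists_represents (ρ.evalAt h.equivariant _ p rfl s)
  obtain ⟨X, hXe, hX⟩ := h.exists_section_represents_mem hD hr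
    ((h.mem_redDirac_iff hD hρD rfl he).1 hs) he
  obtain ⟨S, hSN, hpS, hS, δ, hδ⟩ := exists_slice (EG := EG) EP h.free hX
  obtain ⟨u, huD, hu⟩ := h.exists_section_of_slice hD hρD hS hSN
  refine ⟨u, fun p₁ hp₁ => ?_, Filter.Eventually.of_forall huD,
    h.evalAt_injective rfl ((hu p hpS).eq hXe)⟩
  obtain ⟨k, rfl⟩ := MulAction.orbitRel_apply.1 (Quotient.exact' hp₁)
  let a : P → G := fun x => k * (δ (k⁻¹ • x))⁻¹
  refine ⟨fun x => ρ.translate X (a x) (ι x), ?_⟩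
  have hk : ContMDiff 𝓘(ℝ, EP) 𝓘(ℝ, EP) ∞ fun x : P => k⁻¹ • x :=
    ContMDiffSMul.contMDiff_const_smul (I := 𝓘(ℝ, EG)) (n := ∞) k⁻¹
  have hkp : Filter.Tendsto (fun x : P => k⁻¹ • x) (𝓝 (k • p)) (𝓝 p) := by
    have h₁ := hk.continuous.tendsto (k • p)
    rwa [inv_smul_smul] at h₁
  filter_upwards [hkp.eventually hδ] with x ⟨hx, hxS⟩
  refine ⟨ρ.contMDiffAt_translate ?_ h.leaf.smooth X, ?_⟩
  · have h₁ : ContMDiffAt 𝓘(ℝ, EP) 𝓘(ℝ, EG) ∞ (fun x => δ (k⁻¹ • x)) x :=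
      ContMDiffAt.comp x hx hk.contMDiffAt
    exact contMDiffAt_const.mul h₁.inv
  · have h₁ : a x • (δ (k⁻¹ • x) • k⁻¹ • x) = x := by
      simp only [a, mul_smul, inv_smul_smul, smul_inv_smul]
    have h₂ : a x • ι (δ (k⁻¹ • x) • k⁻¹ • x) = ι x := by rw [← h.equivariant, h₁]
    have h₃ := h.representsAt_act h₁ h₂ (hu _ hxS)
    rwa [ρ.act_eq_translate X h₂] at h₃

end IsReducible

end Leaf

end CourantReduction

end

theorem mainTheorem2
    {EG : Type*} [NormedAddCommGroup EG] [NormedSpace ℝ EG] [FiniteDimensional ℝ EG]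
    {G : Type*} [TopologicalSpace G] [ChartedSpace EG G] [Group G]
    [LieGroup 𝓘(ℝ, EG) ∞ G] [ConnectedSpace G]
    {EM : Type*} [NormedAddCommGroup EM] [NormedSpace ℝ EM] [FiniteDimensional ℝ EM]
    {M : Type*} [TopologicalSpace M] [ChartedSpace EM M] [IsManifold 𝓘(ℝ, EM) ∞ M]
    [T2Space M] [SecondCountableTopology M]
    [MulAction G M] [ContMDiffSMul 𝓘(ℝ, EG) 𝓘(ℝ, EM) ∞ G M]
    {F : Type*} [NormedAddCommGroup F] [NormedSpace ℝ F] [FiniteDimensional ℝ F]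
    {E : M → Type*} [∀ m, AddCommGroup (E m)] [∀ m, Module ℝ (E m)]
    [TopologicalSpace (TotalSpace F E)] [∀ m, TopologicalSpace (E m)]
    [FiberBundle F E] [VectorBundle ℝ F E] [ContMDiffVectorBundle ∞ F E 𝓘(ℝ, EM)]
    (𝒞 : CourantAlgebroid EM M F E) (h𝒞 : 𝒞.IsExact)
    {𝔞 : Type*} [AddCommGroup 𝔞] [Module ℝ 𝔞] (𝒜 : ExactCourantAlgebra EG G 𝔞)
    (ρ : ExtendedAction 𝒞 𝒜)
    {EP : Type*} [NormedAddCommGroup EP] [NormedSpace ℝ EP] [FiniteDimensional ℝ EP]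
    {P : Type*} [TopologicalSpace P] [ChartedSpace EP P] [IsManifold 𝓘(ℝ, EP) ∞ P]
    [T2Space P] [SecondCountableTopology P]
    (ι : P → M) (hleaf : IsLeaf ρ.bigDistribution (EP := EP) ι)
    [MulAction G P] [ContMDiffSMul 𝓘(ℝ, EG) 𝓘(ℝ, EP) ∞ G P]
    (hι : ∀ (g : G) (p : P), ι (g • p) = g • ι p)
    (hfree : ∀ (g : G) (p : P), g • p = p → g = 1) [ProperSMul G P]
    (hrank : ∃ r : ℕ, ∀ p : P, Module.finrank ℝ (ρ.rhoH (ι p)) = r)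
    (hexact : ρ.IsReducedExact ι)
    (D : ∀ m, Submodule ℝ (E m)) (hD : 𝒞.toBracketBundle.IsDirac D) (hρD : ρ.Preserves D) :
    ((ρ.reducedCourant hι (EP := EP)).IsSmoothSubbundle (ρ.redDirac hι D) →
      (ρ.reducedCourant hι (EP := EP)).IsDirac (ρ.redDirac hι D)) ∧
    ((∃ r : ℕ, ∀ p : P,
        Module.finrank ℝ ((D (ι p) ⊓ ρ.Ktilde (ι p) : Submodule ℝ (E (ι p)))) = r) →
      (ρ.reducedCourant hι (EP := EP)).IsSmoothSubbundle (ρ.redDirac hι D)) := by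
  have h : IsReducible ρ EP ι :=
    ⟨h𝒞, hleaf.toIsIntegralSubmanifold, hι, hfree, hrank, hexact⟩
  exact ⟨h.isDirac_redDirac hD hρD, h.isSmoothSubbundle_redDirac hD hρD⟩
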